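/- **Conventions.** A $\mathrm{C}^*$-algebra $A$ (unital or not) has *stable rank one* if the invertible elements of its unitization $A\oplus\mathbb{C}$ are dense in it (for unital $A$: if the invertible elements of $A$ are dense in $A$). *Traces.* Let $T_1(A)$ be the set of tracial states of $A$. $\mathrm{Aff}\,T_1(A)$ denotes the real vector space of functions $\tau\mapsto F(\tau)$ on $T_1(A)$ that are restrictions of weak-$*$ continuous affine functions $F$ with $F(0)=0$ on the weak-$*$ compact convex set of positive tracial functionals on $A$ of norm at most $1$ (such an $F$ is determined by its restriction; for unital $A$ this is the space of all continuous affine functions $T_1(A)\to\mathbb{R}$). It carries the norm $\|F\|=\sup_{\tau\in T_1(A)}|F(\tau)|$ (which is $0$ if $T_1(A)=\emptyset$), and every self-adjoint $h\in A$ gives an element $\widehat h(\tau)=\tau(h)$. A $*$-homomorphism $\phi\colon A\to B$ induces $\mathrm{Aff}\,T_1(\phi)\colon \mathrm{Aff}\,T_1(A)\to\mathrm{Aff}\,T_1(B)$, $F\mapsto(\tau\mapsto F(\tau\circ\phi))$; in particular $\widehat h\mapsto\widehat{\phi(h)}$. *Cuntz semigroup.* Let $\mathcal K$ be the compact operators on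 $\ell^2(\mathbb N)$. For $a,b\in(A\otimes\mathcal K)_+$ write $a\precsim b$ if for every $\epsilon>0$ there is $r\in A\otimes\mathcal K$ with $\|rbr^*-a\|<\epsilon$, and $a\sim b$ if $a\precsim b$ and $b\precsim a$. $\mathrm{Cu}(A)=(A\otimes\mathcal K)_+/\!\sim$ is ordered by $\precsim$, with addition given by diagonal sums (along an isomorphism $M_2(\mathcal K)\cong\mathcal K$). Put $\mathrm{Cu}(\phi)[x]=[(\phi\otimes\mathrm{id})(x)]$. In an ordered monoid, $x\ll y$ means that for every increasing sequence $(z_n)$ with a supremum $\geq y$ there is $n$ with $x\le z_n$. A Cu-morphism is an order-preserving monoid homomorphism that preserves $\ll$ and suprema of increasing sequences. *Thomsen semigroup.* Let $\mathbb G$ be the set of increasing lower semicontinuous functions $f\colon[0,1]\to\{0,1,\dots,\infty\}$ with $f(0)=0$, with pointwise order and addition. $\mathrm{Th}(\mathrm{Cu}(A))$ is the set of Cu-morphisms $\mathbb G\to\mathrm{Cu}(A)$, called Thomsen morphisms. *Distances.* For maps $\alpha,\beta\colon\mathbb G\to \mathrm{Cu}(B)$ let $d_{\mathrm{Cu}}(\alpha,\beta)\in[0,\infty]$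 be the infimum of all $r>0$ such that for all $0\le t<1$ $$\alpha(1_{(t,1]})\le\beta(1_{(\max(t-r,0),1]})\quad\text{and}\quad\beta(1_{(t,1]})\le\alpha(1_{(\max(t-r,0),1]}),$$ with $\inf\emptyset=\infty$. (Here $(\max(t-r,0),1]$ is the open $r$-neighbourhood of $(t,1]$ in $(0,1]$.) For a set $\mathrm N\subseteq\mathrm{Th}(\mathrm{Cu}(A))$ put $d_{\mathrm N}(\mathrm{Cu}(\phi),\mathrm{Cu}(\psi))=\sup_{\nu\in\mathrm N}d_{\mathrm{Cu}}(\mathrm{Cu}(\phi)\circ\nu,\mathrm{Cu}(\psi)\circ\nu)$. **Theorem.** Let $A$ be a $\mathrm C^*$-algebra of stable rank one. For any finite set $\mathrm H\subseteq\mathrm{Aff}\,T_1(A)$ there exists a finite set $\mathrm N\subseteq\mathrm{Th}(\mathrm{Cu}(A))$, depending only on $A$ and $\mathrm H$, with the following property. For any $\mathrm C^*$-algebra $B$ of stable rank one, any $*$-homomorphisms $\phi,\psi\colon A\to B$ and any $\epsilon>0$, $$d_{\mathrm N}(\mathrm{Cu}(\phi),\mathrm{Cu}(\psi))<\frac{\epsilon}{2}\quad\Longrightarrow\quad\max_{F\in\mathrm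 H}\big\|\mathrm{Aff}\,T_1(\phi)(F)-\mathrm{Aff}\,T_1(\psi)(F)\big\|<\epsilon.$$ (If $\mathrm H=\emptyset$ the conclusion is void.) -/

import Mathlib

set_option linter.unusedSectionVars false

noncomputable section

namespace CuntzSemigroup

/-! ### The stabilisation `A ⊗ K` -/

/-- Infinite matrices over `A` with only finitely many nonzero entries: the `*`-algebra
`M_∞(A) = ⋃ n, M_n(A)`. -/
structure FinMat (A : Type*) [Zero A] where
  entry : ℕ → ℕ → A
  exists_bound : ∃ n, ∀ i j, n ≤ i ∨ n ≤ j → entry i j = 0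

namespace FinMat

section Algebra

variable {A : Type*}

/-- `M` is supported in the upper left `n × n` block. -/
def SuppIn [Zero A] (n : ℕ) (M : FinMat A) : Prop :=
  ∀ i j, n ≤ i ∨ n ≤ j → M.entry i j = 0

theorem SuppIn.mono [Zero A] {n m : ℕ} {M : FinMat A} (h : M.SuppIn n) (hnm : n ≤ m) :
    M.SuppIn m :=
  fun i j hij => h i j (hij.imp hnm.trans hnm.trans)

theorem entry_injective [Zero A] : Function.Injective (entry : FinMat A → ℕ → ℕ → A) := by
  rintro ⟨M, _⟩ ⟨N, _⟩ h
  cases h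
  rfl

instance [Zero A] : Zero (FinMat A) := ⟨⟨0, 0, fun _ _ _ => rfl⟩⟩

instance [AddZeroClass A] : Add (FinMat A) :=
  ⟨fun M N => ⟨M.entry + N.entry, by
    obtain ⟨m, hm⟩ := M.exists_bound
    obtain ⟨n, hn⟩ := N.exists_bound
    refine ⟨max m n, fun i j h => ?_⟩
    simp only [Pi.add_apply]
    rw [hm i j (by omega), hn i j (by omega), add_zero]⟩⟩

instance [AddGroup A] : Neg (FinMat A) :=
  ⟨fun M => ⟨-M.entry, by
    obtain ⟨m, hm⟩ := M.exists_bound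
    exact ⟨m, fun i j h => by simp [hm i j h]⟩⟩⟩

instance [AddGroup A] : Sub (FinMat A) :=
  ⟨fun M N => ⟨M.entry - N.entry, by
    obtain ⟨m, hm⟩ := M.exists_bound
    obtain ⟨n, hn⟩ := N.exists_bound
    refine ⟨max m n, fun i j h => ?_⟩
    simp only [Pi.sub_apply]
    rw [hm i j (by omega), hn i j (by omega), sub_zero]⟩⟩

instance {R : Type*} [Zero A] [SMulZeroClass R A] : SMul R (FinMat A) :=
  ⟨fun c M => ⟨c • M.entry, by
    obtain ⟨m, hm⟩ := M.exists_bound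
    exact ⟨m, fun i j h => by simp [hm i j h]⟩⟩⟩

instance [AddCommGroup A] : AddCommGroup (FinMat A) :=
  entry_injective.addCommGroup _ rfl (fun _ _ => rfl) (fun _ => rfl) (fun _ _ => rfl)
    (fun _ _ => rfl) (fun _ _ => rfl)

/-- Entrywise evaluation as an additive map. -/
def entryHom [AddCommGroup A] : FinMat A →+ (ℕ → ℕ → A) where
  toFun := entry
  map_zero' := rfl
  map_add' _ _ := rfl

instance [AddCommGroup A] [Module ℂ A] : Module ℂ (FinMat A) :=
  entry_injective.module ℂ entryHom (fun _ _ => rfl)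

/-- Matrix multiplication (the sum has finitely many nonzero terms). -/
instance [NonUnitalNonAssocSemiring A] : Mul (FinMat A) :=
  ⟨fun M N => ⟨fun i j => ∑ᶠ k, M.entry i k * N.entry k j, by
    obtain ⟨m, hm⟩ := M.exists_bound
    obtain ⟨n, hn⟩ := N.exists_bound
    refine ⟨max m n, fun i j h => ?_⟩
    refine finsum_eq_zero_of_forall_eq_zero fun k => ?_
    rcases h with h | h
    · rw [hm i k (by omega), zero_mul]
    · rw [hn k j (by omega), mul_zero]⟩⟩

/-- The adjoint is the conjugate transpose. -/
instance [AddMonoid A] [StarAddMonoid A] : Star (FinMat A) :=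
  ⟨fun M => ⟨fun i j => star (M.entry j i), by
    obtain ⟨m, hm⟩ := M.exists_bound
    exact ⟨m, fun i j h => by rw [hm j i h.symm, star_zero]⟩⟩⟩

/-- The upper left `n × n` block. -/
def corner [Zero A] (n : ℕ) (M : FinMat A) : CStarMatrix (Fin n) (Fin n) A :=
  CStarMatrix.ofMatrix fun i j => M.entry i j

theorem ext_of_corner [Zero A] {n : ℕ} {M N : FinMat A} (hM : M.SuppIn n) (hN : N.SuppIn n)
    (h : M.corner n = N.corner n) : M = N := by
  apply entry_injective
  funext i j
  by_cases hij : n ≤ i ∨ n ≤ j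
  · rw [hM i j hij, hN i j hij]
  · push Not at hij
    exact congrFun (congrFun h ⟨i, hij.1⟩) ⟨j, hij.2⟩

theorem suppIn_zero [Zero A] (n : ℕ) : (0 : FinMat A).SuppIn n := fun _ _ _ => rfl

theorem SuppIn.add [AddZeroClass A] {n : ℕ} {M N : FinMat A} (hM : M.SuppIn n)
    (hN : N.SuppIn n) : (M + N).SuppIn n := fun i j h => by
  change M.entry i j + N.entry i j = 0
  rw [hM i j h, hN i j h, add_zero]

theorem SuppIn.neg [AddGroup A] {n : ℕ} {M : FinMat A} (hM : M.SuppIn n) :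
    (-M).SuppIn n := fun i j h => by
  change -M.entry i j = 0
  rw [hM i j h, neg_zero]

theorem SuppIn.smul {R : Type*} [Zero A] [SMulZeroClass R A] {n : ℕ} {M : FinMat A}
    (hM : M.SuppIn n) (c : R) : (c • M).SuppIn n := fun i j h => by
  change c • M.entry i j = 0
  rw [hM i j h, smul_zero]

theorem SuppIn.star [AddMonoid A] [StarAddMonoid A] {n : ℕ} {M : FinMat A} (hM : M.SuppIn n) :
    (star M).SuppIn n := fun i j h => by
  change Star.star (M.entry j i) = 0
  rw [hM j i h.symm, star_zero]

theorem SuppIn.mul [NonUnitalNonAssocSemiring A] {n : ℕ} {M N : FinMat A} (hM : M.SuppIn n)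
    (hN : N.SuppIn n) : (M * N).SuppIn n := fun i j h => by
  refine finsum_eq_zero_of_forall_eq_zero fun k => ?_
  rcases h with h | h
  · rw [hM i k (Or.inl h), zero_mul]
  · rw [hN k j (Or.inr h), mul_zero]

theorem corner_mul [NonUnitalNonAssocSemiring A] {n : ℕ} {M N : FinMat A} (hM : M.SuppIn n) :
    (M * N).corner n = M.corner n * N.corner n := by
  ext i j
  rw [CStarMatrix.mul_apply]
  change ∑ᶠ k, M.entry i k * N.entry k j = ∑ k : Fin n, M.entry i k * N.entry k j
  rw [Fin.sum_univ_eq_sum_range (fun k => M.entry i k * N.entry k j) n]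
  refine finsum_eq_sum_of_support_subset _ fun k hk => ?_
  by_contra hkn
  refine hk ?_
  dsimp only
  rw [hM i k (Or.inr (by simpa using hkn)), zero_mul]

theorem exists_suppIn₂ [Zero A] (M N : FinMat A) : ∃ n, M.SuppIn n ∧ N.SuppIn n := by
  obtain ⟨m, hm⟩ := M.exists_bound
  obtain ⟨n, hn⟩ := N.exists_bound
  exact ⟨max m n, SuppIn.mono hm (le_max_left _ _), SuppIn.mono hn (le_max_right _ _)⟩

theorem exists_suppIn₃ [Zero A] (M N P : FinMat A) :
    ∃ n, M.SuppIn n ∧ N.SuppIn n ∧ P.SuppIn n := by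
  obtain ⟨m, hM, hN⟩ := exists_suppIn₂ M N
  obtain ⟨n, hn⟩ := P.exists_bound
  exact ⟨max m n, hM.mono (le_max_left _ _), hN.mono (le_max_left _ _),
    SuppIn.mono hn (le_max_right _ _)⟩

instance [NonUnitalRing A] : NonUnitalRing (FinMat A) where
  left_distrib M N P := by
    obtain ⟨n, hM, hN, hP⟩ := exists_suppIn₃ M N P
    refine ext_of_corner (hM.mul (hN.add hP)) ((hM.mul hN).add (hM.mul hP)) ?_
    rw [corner_mul hM]
    exact (mul_add (M.corner n) (N.corner n) (P.corner n)).trans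
      (congrArg₂ (· + ·) (corner_mul hM).symm (corner_mul hM).symm)
  right_distrib M N P := by
    obtain ⟨n, hM, hN, hP⟩ := exists_suppIn₃ M N P
    refine ext_of_corner ((hM.add hN).mul hP) ((hM.mul hP).add (hN.mul hP)) ?_
    rw [corner_mul (hM.add hN)]
    exact (add_mul (M.corner n) (N.corner n) (P.corner n)).trans
      (congrArg₂ (· + ·) (corner_mul hM).symm (corner_mul hN).symm)
  zero_mul M := by
    obtain ⟨n, hM⟩ := M.exists_bound
    refine ext_of_corner ((suppIn_zero n).mul hM) (suppIn_zero n) ?_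
    rw [corner_mul (suppIn_zero n)]
    exact zero_mul (M.corner n)
  mul_zero M := by
    obtain ⟨n, hM⟩ := M.exists_bound
    refine ext_of_corner (SuppIn.mul hM (suppIn_zero n)) (suppIn_zero n) ?_
    rw [corner_mul hM]
    exact mul_zero (M.corner n)
  mul_assoc M N P := by
    obtain ⟨n, hM, hN, hP⟩ := exists_suppIn₃ M N P
    refine ext_of_corner ((hM.mul hN).mul hP) (hM.mul (hN.mul hP)) ?_
    rw [corner_mul (hM.mul hN), corner_mul hM, corner_mul hM, corner_mul hN, mul_assoc]

instance [NonUnitalRing A] [StarRing A] : StarRing (FinMat A) where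
  star_involutive M := entry_injective (by funext i j; exact star_star (M.entry i j))
  star_add M N := entry_injective (by
    funext i j; exact star_add (M.entry j i) (N.entry j i))
  star_mul M N := by
    obtain ⟨n, hM, hN⟩ := exists_suppIn₂ M N
    refine ext_of_corner (hM.mul hN).star (hN.star.mul hM.star) ?_
    rw [corner_mul hN.star]
    exact (congrArg star (corner_mul hM)).trans (star_mul (M.corner n) (N.corner n))

instance [NonUnitalRing A] [StarRing A] [Module ℂ A] [StarModule ℂ A] :
    StarModule ℂ (FinMat A) where
  star_smul c M := entry_injective (by funext i j; exact star_smul c (M.entry j i))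

instance [NonUnitalRing A] [Module ℂ A] [IsScalarTower ℂ A A] :
    IsScalarTower ℂ (FinMat A) (FinMat A) where
  smul_assoc c M N := by
    obtain ⟨n, hM, hN⟩ := exists_suppIn₂ M N
    refine ext_of_corner ((hM.smul c).mul hN) ((hM.mul hN).smul c) ?_
    rw [smul_eq_mul, corner_mul (hM.smul c)]
    exact (Matrix.smul_mul c (CStarMatrix.ofMatrix.symm (M.corner n))
      (CStarMatrix.ofMatrix.symm (N.corner n))).trans (congrArg (c • ·) (corner_mul hM).symm)

instance [NonUnitalRing A] [Module ℂ A] [SMulCommClass ℂ A A] :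
    SMulCommClass ℂ (FinMat A) (FinMat A) where
  smul_comm c M N := by
    obtain ⟨n, hM, hN⟩ := exists_suppIn₂ M N
    refine ext_of_corner ((hM.mul hN).smul c) (hM.mul (hN.smul c)) ?_
    rw [smul_eq_mul, smul_eq_mul, corner_mul hM]
    exact (congrArg (c • ·) (corner_mul hM)).trans
      (Matrix.mul_smul (CStarMatrix.ofMatrix.symm (M.corner n)) c
        (CStarMatrix.ofMatrix.symm (N.corner n))).symm

end Algebra

section Extend

variable {A : Type*} [Zero A]

/-- The matrix relabelled along `g`, with zero entries outside the range of `g`. -/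
def extendMat {ι κ : Type*} (g : ι ↪ κ) (M : ι → ι → A) : κ → κ → A :=
  Function.extend g (fun i => Function.extend g (M i) 0) 0

theorem extendMat_apply {ι κ : Type*} (g : ι ↪ κ) (M : ι → ι → A) (i j : ι) :
    extendMat g M (g i) (g j) = M i j := by
  simp [extendMat, g.injective.extend_apply]

theorem extendMat_left {ι κ : Type*} (g : ι ↪ κ) (M : ι → ι → A) {i : κ}
    (hi : ¬ ∃ a, g a = i) (j : κ) : extendMat g M i j = 0 := by
  simp [extendMat, Function.extend_apply' _ _ _ hi]

theorem extendMat_right {ι κ : Type*} (g : ι ↪ κ) (M : ι → ι → A) (i : κ) {j : κ}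
    (hj : ¬ ∃ a, g a = j) : extendMat g M i j = 0 := by
  by_cases hi : ∃ a, g a = i
  · obtain ⟨a, rfl⟩ := hi
    simp [extendMat, g.injective.extend_apply, Function.extend_apply' _ _ _ hj]
  · exact extendMat_left g M hi j

/-- A matrix over `κ` is the relabelling of `M` as soon as it has the right entries. -/
theorem eq_extendMat {ι κ : Type*} (g : ι ↪ κ) (M : ι → ι → A) (P : κ → κ → A)
    (h : ∀ a b, P (g a) (g b) = M a b) (hl : ∀ i j, (¬ ∃ a, g a = i) → P i j = 0)
    (hr : ∀ i j, (¬ ∃ a, g a = j) → P i j = 0) : P = extendMat g M := by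
  funext i j
  by_cases hi : ∃ a, g a = i
  · by_cases hj : ∃ b, g b = j
    · obtain ⟨a, rfl⟩ := hi
      obtain ⟨b, rfl⟩ := hj
      rw [h, extendMat_apply]
    · rw [hr i j hj, extendMat_right g M i hj]
  · rw [hl i j hi, extendMat_left g M hi]

end Extend

section Embed

variable {A : Type*} [NonUnitalRing A] [StarRing A] [Module ℂ A]

/-- The `*`-homomorphism `M_n(A) → M_m(A)` relabelling the indices along an injection. -/
def embed {n m : ℕ} (g : Fin n ↪ Fin m) :
    CStarMatrix (Fin n) (Fin n) A →⋆ₙₐ[ℂ] CStarMatrix (Fin m) (Fin m) A where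
  toFun M := CStarMatrix.ofMatrix (extendMat g M)
  map_smul' c M := by
    refine (eq_extendMat g (c • M) (c • extendMat g M) (fun a b => ?_) (fun i j h => ?_)
      fun i j h => ?_).symm
    · exact congrArg (c • ·) (extendMat_apply g M a b)
    · exact (congrArg (c • ·) (extendMat_left g M h j)).trans (smul_zero c)
    · exact (congrArg (c • ·) (extendMat_right g M i h)).trans (smul_zero c)
  map_zero' := (eq_extendMat g (fun _ _ => (0 : A)) 0 (fun _ _ => rfl) (fun _ _ _ => rfl)
      fun _ _ _ => rfl).symm
  map_add' M N := by
    refine (eq_extendMat g (M + N) (extendMat g M + extendMat g N) (fun a b => ?_)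
      (fun i j h => ?_) fun i j h => ?_).symm
    · exact congrArg₂ (· + ·) (extendMat_apply g M a b) (extendMat_apply g N a b)
    · exact (congrArg₂ (· + ·) (extendMat_left g M h j) (extendMat_left g N h j)).trans
        (add_zero 0)
    · exact (congrArg₂ (· + ·) (extendMat_right g M i h) (extendMat_right g N i h)).trans
        (add_zero 0)
  map_mul' M N := by
    refine (eq_extendMat g (M * N)
      (fun i j => ∑ k, extendMat g M i k * extendMat g N k j) (fun a b => ?_)
      (fun i j h => ?_) fun i j h => ?_).symm
    · refine (Fintype.sum_of_injective g g.injective (fun k => M a k * N k b) _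
        (fun k hk => ?_) fun k => ?_).symm
      · rw [extendMat_left g N (by simpa using hk), mul_zero]
      · exact (congrArg₂ (· * ·) (extendMat_apply g M a k) (extendMat_apply g N k b)).symm
    · exact Finset.sum_eq_zero fun k _ => by rw [extendMat_left g M h, zero_mul]
    · exact Finset.sum_eq_zero fun k _ => by rw [extendMat_right g N k h, mul_zero]
  map_star' M := by
    have h := eq_extendMat g (star M : CStarMatrix (Fin n) (Fin n) A) (fun i j => star (extendMat g M j i)) (fun a b => ?_)
      (fun i j h => ?_) fun i j h => ?_
    · ext i j
      rw [CStarMatrix.star_apply]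
      exact (congrFun (congrFun h i) j).symm
    · exact (congrArg star (extendMat_apply g M b a)).trans (CStarMatrix.star_apply).symm
    · rw [extendMat_right g M j h, star_zero]
    · rw [extendMat_left g M h, star_zero]

theorem embed_apply {n m : ℕ} (g : Fin n ↪ Fin m) (M : CStarMatrix (Fin n) (Fin n) A)
    (i j : Fin n) : embed g M (g i) (g j) = M i j :=
  extendMat_apply g M i j

theorem embed_injective {n m : ℕ} (g : Fin n ↪ Fin m) :
    Function.Injective (embed g : CStarMatrix (Fin n) (Fin n) A → _) := by
  intro M N h
  ext i j
  rw [← embed_apply g M, h, embed_apply]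

/-- Relabelling the matrix indices along an injection `f : ℕ → ℕ` (entries outside the range of
`f` are zero). This is conjugation by the isometry of `ℓ²(ℕ)` with `e_i ↦ e_{f i}`. -/
def relabel (f : ℕ ↪ ℕ) (M : FinMat A) : FinMat A where
  entry := extendMat f M.entry
  exists_bound := by
    obtain ⟨n, hn⟩ := M.exists_bound
    refine ⟨(Finset.range n).sup f + 1, fun i j h => ?_⟩
    have key : ∀ a, (Finset.range n).sup f + 1 ≤ f a → n ≤ a := fun a ha => by
      by_contra hlt
      have := Finset.le_sup (f := f) (Finset.mem_range.2 (not_le.1 hlt))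
      omega
    by_cases hi : ∃ a, f a = i
    · by_cases hj : ∃ b, f b = j
      · obtain ⟨a, rfl⟩ := hi
        obtain ⟨b, rfl⟩ := hj
        rw [extendMat_apply]
        exact hn a b (h.imp (key a) (key b))
      · exact extendMat_right _ _ _ hj
    · exact extendMat_left _ _ hi _

/-- A finite block in which relabelling is given by `embed`. -/
theorem relabel_block (f : ℕ ↪ ℕ) (n : ℕ) : ∃ (m : ℕ) (g : Fin n ↪ Fin m),
    ∀ M : FinMat A, M.SuppIn n →
      (relabel f M).SuppIn m ∧ (relabel f M).corner m = embed g (M.corner n) := by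
  have hb : ∀ a, a < n → f a < (Finset.range n).sup f + 1 := fun a ha => by
    have := Finset.le_sup (f := f) (Finset.mem_range.2 ha)
    omega
  have hz : ∀ M : FinMat A, M.SuppIn n → ∀ i j, (¬ ∃ a < n, f a = i) ∨ (¬ ∃ b < n, f b = j) →
      (relabel f M).entry i j = 0 := by
    intro M hM i j h
    by_cases hi : ∃ a, f a = i
    · by_cases hj : ∃ b, f b = j
      · obtain ⟨a, rfl⟩ := hi
        obtain ⟨b, rfl⟩ := hj
        refine (extendMat_apply f M.entry a b).trans (hM a b (h.imp (fun h => ?_) fun h => ?_))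
        · exact not_lt.1 fun ha => h ⟨a, ha, rfl⟩
        · exact not_lt.1 fun hb => h ⟨b, hb, rfl⟩
      · exact extendMat_right _ _ _ hj
    · exact extendMat_left _ _ hi _
  refine ⟨(Finset.range n).sup f + 1, ⟨fun a => ⟨f a, hb a a.2⟩, fun a b h => ?_⟩,
    fun M hM => ⟨fun i j h => ?_, ?_⟩⟩
  · simpa [Fin.ext_iff] using h
  · refine hz M hM i j (h.imp ?_ ?_) <;>
    · rintro h ⟨a, ha, rfl⟩
      exact absurd (hb a ha) (not_lt.2 h)
  · refine eq_extendMat _ (M.corner n) _ (fun a b => ?_) (fun i j h => ?_) fun i j h => ?_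
    · exact extendMat_apply f M.entry a b
    · refine hz M hM i j (Or.inl ?_)
      rintro ⟨a, ha, hai⟩
      exact h ⟨⟨a, ha⟩, Fin.ext hai⟩
    · refine hz M hM i j (Or.inr ?_)
      rintro ⟨a, ha, hai⟩
      exact h ⟨⟨a, ha⟩, Fin.ext hai⟩

/-- Relabelling as a `*`-homomorphism. -/
def relabelHom (f : ℕ ↪ ℕ) : FinMat A →⋆ₙₐ[ℂ] FinMat A where
  toFun := relabel f
  map_smul' c M := by
    obtain ⟨n, hM⟩ := M.exists_bound
    obtain ⟨m, g, hg⟩ := relabel_block (A := A) f n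
    have hM : M.SuppIn n := hM
    refine ext_of_corner (hg _ (hM.smul c)).1 ((hg _ hM).1.smul c) ?_
    rw [(hg _ (hM.smul c)).2]
    exact (map_smul (embed g) c (M.corner n)).trans (congrArg (c • ·) (hg _ hM).2.symm)
  map_zero' := by
    obtain ⟨m, g, hg⟩ := relabel_block (A := A) f 0
    refine ext_of_corner (hg _ (suppIn_zero 0)).1 (suppIn_zero m) ?_
    rw [(hg _ (suppIn_zero 0)).2]
    exact map_zero (embed g)
  map_add' M N := by
    obtain ⟨n, hM, hN⟩ := exists_suppIn₂ M N
    obtain ⟨m, g, hg⟩ := relabel_block (A := A) f n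
    refine ext_of_corner (hg _ (hM.add hN)).1 ((hg _ hM).1.add (hg _ hN).1) ?_
    rw [(hg _ (hM.add hN)).2]
    exact (map_add (embed g) (M.corner n) (N.corner n)).trans
      (congrArg₂ (· + ·) (hg _ hM).2.symm (hg _ hN).2.symm)
  map_mul' M N := by
    obtain ⟨n, hM, hN⟩ := exists_suppIn₂ M N
    obtain ⟨m, g, hg⟩ := relabel_block (A := A) f n
    refine ext_of_corner (hg _ (hM.mul hN)).1 ((hg _ hM).1.mul (hg _ hN).1) ?_
    rw [(hg _ (hM.mul hN)).2, corner_mul hM, map_mul, corner_mul (hg _ hM).1, (hg _ hM).2,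
      (hg _ hN).2]
  map_star' M := by
    obtain ⟨n, hM⟩ := M.exists_bound
    have hM : M.SuppIn n := hM
    obtain ⟨m, g, hg⟩ := relabel_block (A := A) f n
    refine ext_of_corner (hg _ hM.star).1 (hg _ hM).1.star ?_
    rw [(hg _ hM.star).2]
    exact (map_star (embed g) (M.corner n)).trans (congrArg star (hg _ hM).2.symm)

end Embed

section Norm

variable {A : Type*} [NonUnitalCStarAlgebra A] [PartialOrder A] [StarOrderedRing A]

theorem norm_corner_eq {n m : ℕ} {M : FinMat A} (hM : M.SuppIn n) (hnm : n ≤ m) :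
    ‖M.corner m‖ = ‖M.corner n‖ := by
  have h : M.corner m = embed (Fin.castLEEmb hnm) (M.corner n) := by
    have hlt : ∀ i : Fin m, (¬ ∃ a, Fin.castLEEmb hnm a = i) → n ≤ i := fun i hi => by
      by_contra hlt
      exact hi ⟨⟨i, not_le.1 hlt⟩, rfl⟩
    exact eq_extendMat _ (M.corner n) _ (fun a b => rfl)
      (fun i j h => hM _ _ (Or.inl (hlt i h))) fun i j h => hM _ _ (Or.inr (hlt j h))
  rw [h]
  exact NonUnitalStarAlgHom.norm_map (embed (Fin.castLEEmb hnm)) (embed_injective _) _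

/-- The C*-norm of `M_∞(A)`: the norm in `M_n(A)` of any block that contains all nonzero
entries (see `norm_eq`). -/
def blockNorm (M : FinMat A) : ℝ := ‖M.corner M.exists_bound.choose‖

theorem blockNorm_eq {n : ℕ} {M : FinMat A} (hM : M.SuppIn n) : blockNorm M = ‖M.corner n‖ := by
  have hc : M.SuppIn M.exists_bound.choose := M.exists_bound.choose_spec
  change ‖M.corner M.exists_bound.choose‖ = _
  rw [← norm_corner_eq hc (le_max_left _ n), ← norm_corner_eq hM (le_max_right _ n)]

/-- `blockNorm` as a bundled norm. -/
def addGroupNorm : AddGroupNorm (FinMat A) where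
  toFun := blockNorm
  map_zero' := by
    rw [blockNorm_eq (suppIn_zero 0)]
    exact norm_zero (E := CStarMatrix (Fin 0) (Fin 0) A)
  add_le' M N := by
    obtain ⟨n, hM, hN⟩ := exists_suppIn₂ M N
    rw [blockNorm_eq hM, blockNorm_eq hN, blockNorm_eq (hM.add hN)]
    exact norm_add_le (M.corner n) (N.corner n)
  neg' M := by
    obtain ⟨n, hM⟩ := M.exists_bound
    have hM : M.SuppIn n := hM
    rw [blockNorm_eq hM, blockNorm_eq hM.neg]
    exact norm_neg (M.corner n)
  eq_zero_of_map_eq_zero' M h := by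
    obtain ⟨n, hM⟩ := M.exists_bound
    have hM : M.SuppIn n := hM
    rw [blockNorm_eq hM] at h
    exact ext_of_corner hM (suppIn_zero n) (norm_eq_zero.1 h)

instance : NormedAddCommGroup (FinMat A) := addGroupNorm.toNormedAddCommGroup

theorem norm_eq {n : ℕ} {M : FinMat A} (hM : M.SuppIn n) : ‖M‖ = ‖M.corner n‖ :=
  blockNorm_eq hM

instance : NonUnitalNormedRing (FinMat A) where
  __ : NonUnitalRing (FinMat A) := inferInstance
  __ : NormedAddCommGroup (FinMat A) := inferInstance
  norm_mul_le M N := by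
    obtain ⟨n, hM, hN⟩ := exists_suppIn₂ M N
    have h := norm_mul_le (M.corner n) (N.corner n)
    rwa [← corner_mul hM, ← norm_eq (hM.mul hN), ← norm_eq hM, ← norm_eq hN] at h

instance : NormedSpace ℂ (FinMat A) where
  norm_smul_le c M := by
    obtain ⟨n, hM⟩ := M.exists_bound
    have hM : M.SuppIn n := hM
    have h : ‖(c • M).corner n‖ ≤ ‖c‖ * ‖M.corner n‖ := norm_smul_le c (M.corner n)
    rwa [← norm_eq (hM.smul c), ← norm_eq hM] at h

theorem norm_mul_self_le' (M : FinMat A) : ‖M‖ * ‖M‖ ≤ ‖star M * M‖ := by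
  obtain ⟨n, hM⟩ := M.exists_bound
  have hM : M.SuppIn n := hM
  rw [norm_eq hM, norm_eq (hM.star.mul hM), corner_mul hM.star]
  exact CStarRing.norm_mul_self_le (M.corner n)

instance : CStarRing (FinMat A) := ⟨norm_mul_self_le'⟩

theorem norm_relabelHom (f : ℕ ↪ ℕ) (M : FinMat A) : ‖relabelHom f M‖ = ‖M‖ := by
  obtain ⟨n, hM⟩ := M.exists_bound
  have hM : M.SuppIn n := hM
  obtain ⟨m, g, hg⟩ := relabel_block (A := A) f n
  change ‖relabel f M‖ = _
  rw [norm_eq (hg M hM).1, norm_eq hM, (hg M hM).2]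
  exact NonUnitalStarAlgHom.norm_map (embed g) (embed_injective _) _

end Norm

section Map

variable {A B : Type*} [NonUnitalCStarAlgebra A] [PartialOrder A] [StarOrderedRing A]
  [NonUnitalCStarAlgebra B] [PartialOrder B] [StarOrderedRing B]

/-- Entrywise application of a `*`-homomorphism. -/
def mapHom (φ : A →⋆ₙₐ[ℂ] B) : FinMat A →⋆ₙₐ[ℂ] FinMat B where
  toFun M := ⟨fun i j => φ (M.entry i j), by
    obtain ⟨n, hn⟩ := M.exists_bound
    exact ⟨n, fun i j h => by rw [hn i j h, map_zero]⟩⟩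
  map_smul' c M := entry_injective (by funext i j; exact map_smul φ c (M.entry i j))
  map_zero' := entry_injective (by funext i j; exact map_zero φ)
  map_add' M N := entry_injective (by
    funext i j; exact map_add φ (M.entry i j) (N.entry i j))
  map_mul' M N := entry_injective (by
    funext i j
    obtain ⟨n, hM⟩ := M.exists_bound
    refine AddMonoidHom.map_finsum (φ : A →+ B)
      (f := fun k => M.entry i k * N.entry k j) ?_ |>.trans ?_
    · refine (Finset.range n).finite_toSet.subset fun k hk => ?_
      by_contra hkn
      refine hk ?_
      dsimp only
      rw [hM i k (Or.inr (by simpa using hkn)), zero_mul]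
    · exact finsum_congr fun k => map_mul φ (M.entry i k) (N.entry k j))
  map_star' M := entry_injective (by funext i j; exact map_star φ (M.entry j i))

theorem norm_mapHom_le (φ : A →⋆ₙₐ[ℂ] B) (M : FinMat A) : ‖mapHom φ M‖ ≤ ‖M‖ := by
  obtain ⟨n, hM⟩ := M.exists_bound
  have hM : M.SuppIn n := hM
  have hM' : (mapHom φ M).SuppIn n := fun i j h => by
    change φ (M.entry i j) = 0
    rw [hM i j h, map_zero]
  rw [norm_eq hM, norm_eq hM']
  exact NonUnitalStarAlgHom.norm_apply_le (CStarMatrix.mapₙₐ φ) (M.corner n)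

end Map

end FinMat

section Completion

open UniformSpace

/-- The completion of a `*`-algebra in a C*-norm. -/
def CStarCompletion (α : Type*) [UniformSpace α] : Type _ := Completion α

namespace CStarCompletion

variable {α β : Type*} [NonUnitalNormedRing α] [NormedSpace ℂ α] [NonUnitalNormedRing β]
  [NormedSpace ℂ β]

instance : NormedAddCommGroup (CStarCompletion α) :=
  inferInstanceAs (NormedAddCommGroup (Completion α))

instance : NormedSpace ℂ (CStarCompletion α) :=
  inferInstanceAs (NormedSpace ℂ (Completion α))

instance : CompleteSpace (CStarCompletion α) :=
  inferInstanceAs (CompleteSpace (Completion α))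

/-- The canonical map into the completion. -/
def of (α : Type*) [NonUnitalNormedRing α] [NormedSpace ℂ α] : α →ₗᵢ[ℂ] CStarCompletion α :=
  Completion.toComplₗᵢ

theorem continuous_of : Continuous (of α) := (of α).continuous

theorem isDenseInducing_of : IsDenseInducing (of α) := Completion.isDenseInducing_coe

theorem induction {p : CStarCompletion α → Prop} (x : CStarCompletion α)
    (hc : IsClosed {x | p x}) (h : ∀ M : α, p (of α M)) : p x :=
  Completion.induction_on x hc h

theorem induction₂ {p : CStarCompletion α → CStarCompletion β → Prop} (x : CStarCompletion α)
    (y : CStarCompletion β) (hc : IsClosed {x : CStarCompletion α × CStarCompletion β | p x.1 x.2})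
    (h : ∀ (M : α) (N : β), p (of α M) (of β N)) : p x y :=
  Completion.induction_on₂ x y hc h

theorem induction₃ {p : CStarCompletion α → CStarCompletion α → CStarCompletion α → Prop}
    (x y z : CStarCompletion α)
    (hc : IsClosed {x : CStarCompletion α × CStarCompletion α × CStarCompletion α |
      p x.1 x.2.1 x.2.2})
    (h : ∀ M N P : α, p (of α M) (of α N) (of α P)) : p x y z :=
  Completion.induction_on₃ x y z hc h

/-- The product on the completion, by continuous extension. -/
instance : Mul (CStarCompletion α) :=
  ⟨Function.curry <| (isDenseInducing_of.prodMap isDenseInducing_of).extend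
    (of α ∘ Function.uncurry (· * · : α → α → α))⟩

theorem of_mul (M N : α) : of α (M * N) = of α M * of α N :=
  ((isDenseInducing_of.prodMap isDenseInducing_of).extend_eq
    (continuous_of.comp (@continuous_mul α _ _ _)) (M, N)).symm

instance : ContinuousMul (CStarCompletion α) where
  continuous_mul := by
    let m := (AddMonoidHom.mul : α →+ α →+ α).compr₂ (of α : α →+ CStarCompletion α)
    have h : Continuous fun p : α × α => m p.1 p.2 := continuous_of.comp continuous_mul
    have di : IsDenseInducing (of α : α →+ CStarCompletion α) := isDenseInducing_of
    exact (di.extend_Z_bilin di h :)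

instance : NonUnitalRing (CStarCompletion α) where
  __ : AddCommGroup (CStarCompletion α) := inferInstance
  __ : Mul (CStarCompletion α) := inferInstance
  zero_mul a := induction (p := fun a => 0 * a = 0) a
    (isClosed_eq (by fun_prop) continuous_const)
    fun a => by rw [← map_zero (of α), ← of_mul, zero_mul]
  mul_zero a := induction (p := fun a => a * 0 = 0) a
    (isClosed_eq (by fun_prop) continuous_const)
    fun a => by rw [← map_zero (of α), ← of_mul, mul_zero]
  mul_assoc a b c := induction₃ (p := fun a b c => a * b * c = a * (b * c)) a b c
    (isClosed_eq (by fun_prop) (by fun_prop))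
    fun a b c => by rw [← of_mul, ← of_mul, ← of_mul, ← of_mul, mul_assoc]
  left_distrib a b c := induction₃ (p := fun a b c => a * (b + c) = a * b + a * c) a b c
    (isClosed_eq (by fun_prop) (by fun_prop))
    fun a b c => by rw [← map_add, ← of_mul, ← of_mul, ← of_mul, ← map_add, mul_add]
  right_distrib a b c := induction₃ (p := fun a b c => (a + b) * c = a * c + b * c) a b c
    (isClosed_eq (by fun_prop) (by fun_prop))
    fun a b c => by rw [← map_add, ← of_mul, ← of_mul, ← of_mul, ← map_add, add_mul]

instance : NonUnitalNormedRing (CStarCompletion α) where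
  __ : NonUnitalRing (CStarCompletion α) := inferInstance
  __ : NormedAddCommGroup (CStarCompletion α) := inferInstance
  norm_mul_le x y := induction₂ (p := fun x y => ‖x * y‖ ≤ ‖x‖ * ‖y‖) x y
    (isClosed_le (by fun_prop) (by fun_prop)) fun M N => by
      rw [← of_mul, (of α).norm_map, (of α).norm_map, (of α).norm_map]
      exact norm_mul_le M N

variable [StarRing α] [CStarRing α] [StarRing β] [CStarRing β]

instance : Star (CStarCompletion α) := ⟨Completion.map star⟩

theorem of_star (M : α) : of α (star M) = star (of α M) :=
  (Completion.map_coe star_isometry.uniformContinuous M).symm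

instance : ContinuousStar (CStarCompletion α) := ⟨Completion.continuous_map⟩

instance : StarRing (CStarCompletion α) where
  star_involutive x := induction (p := fun x => star (star x) = x) x
    (isClosed_eq (continuous_star.comp continuous_star) continuous_id) fun M => by
      rw [← of_star, ← of_star, star_star]
  star_mul x y := induction₂ (p := fun x y => star (x * y) = star y * star x) x y
    (isClosed_eq (by fun_prop) (by fun_prop)) fun M N => by
      rw [← of_mul, ← of_star, ← of_star, ← of_star, star_mul, of_mul]
  star_add x y := induction₂ (p := fun x y => star (x + y) = star x + star y) x y
    (isClosed_eq (by fun_prop) (by fun_prop)) fun M N => by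
      rw [← map_add, ← of_star, ← of_star, ← of_star, star_add, map_add]

instance : CStarRing (CStarCompletion α) where
  norm_mul_self_le x := induction (p := fun x => ‖x‖ * ‖x‖ ≤ ‖star x * x‖) x (isClosed_le (by fun_prop) (by fun_prop)) fun M => by
    rw [← of_star, ← of_mul, (of α).norm_map, (of α).norm_map]
    exact CStarRing.norm_mul_self_le M

instance [IsScalarTower ℂ α α] [SMulCommClass ℂ α α] [StarModule ℂ α] :
    NonUnitalCStarAlgebra (CStarCompletion α) where
  smul_assoc c x y := induction₂ (p := fun x y => (c • x) * y = c • (x * y)) x y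
    (isClosed_eq ((continuous_fst.const_smul c).mul continuous_snd)
      (continuous_mul.const_smul c)) fun M N => by
        rw [← map_smul, ← of_mul, ← of_mul, ← map_smul, smul_mul_assoc]
  smul_comm c x y := induction₂ (p := fun x y => c • (x * y) = x * (c • y)) x y
    (isClosed_eq (continuous_mul.const_smul c)
      (continuous_fst.mul (continuous_snd.const_smul c))) fun M N => by
        rw [← map_smul, ← of_mul, ← of_mul, ← map_smul, mul_smul_comm]
  star_smul c x := induction (p := fun x => star (c • x) = star c • star x) x
    (isClosed_eq (continuous_star.comp (continuous_id.const_smul c))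
      (continuous_star.const_smul (star c))) fun M => by
        rw [← map_smul, ← of_star, ← of_star, star_smul, map_smul]

/-- The underlying function of `lift`. -/
def liftFun (F : α → β) : CStarCompletion α → CStarCompletion β := Completion.map F

theorem continuous_liftFun (F : α → β) : Continuous (liftFun F) := Completion.continuous_map

theorem uniformContinuous_of_contractive {F : α →⋆ₙₐ[ℂ] β} (hF : ∀ M, ‖F M‖ ≤ ‖M‖) :
    UniformContinuous F :=
  (AddMonoidHomClass.lipschitz_of_bound F 1 fun M => by simpa using hF M).uniformContinuous

theorem liftFun_of {F : α →⋆ₙₐ[ℂ] β} (hF : ∀ M, ‖F M‖ ≤ ‖M‖) (M : α) :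
    liftFun F (of α M) = of β (F M) :=
  Completion.map_coe (uniformContinuous_of_contractive hF) M

/-- Extension of a contractive `*`-homomorphism to the completions. -/
def lift (F : α →⋆ₙₐ[ℂ] β) (hF : ∀ M, ‖F M‖ ≤ ‖M‖) :
    CStarCompletion α →⋆ₙₐ[ℂ] CStarCompletion β where
  toFun := liftFun F
  map_smul' c x := induction (p := fun x => liftFun F (c • x) = c • liftFun F x) x
    (isClosed_eq ((continuous_liftFun F).comp (continuous_id.const_smul c))
      ((continuous_liftFun F).const_smul c)) fun M => by
        rw [← map_smul, liftFun_of hF, liftFun_of hF, map_smul, map_smul]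
  map_zero' := by rw [← map_zero (of α), liftFun_of hF, map_zero, map_zero]
  map_add' x y := induction₂
    (p := fun x y => liftFun F (x + y) = liftFun F x + liftFun F y) x y
    (isClosed_eq ((continuous_liftFun F).comp continuous_add)
      (((continuous_liftFun F).comp continuous_fst).add
        ((continuous_liftFun F).comp continuous_snd))) fun M N => by
      rw [← map_add, liftFun_of hF, liftFun_of hF, liftFun_of hF, map_add, map_add]
  map_mul' x y := induction₂
    (p := fun x y => liftFun F (x * y) = liftFun F x * liftFun F y) x y
    (isClosed_eq ((continuous_liftFun F).comp continuous_mul)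
      (((continuous_liftFun F).comp continuous_fst).mul
        ((continuous_liftFun F).comp continuous_snd))) fun M N => by
      rw [← of_mul, liftFun_of hF, liftFun_of hF, liftFun_of hF, map_mul, of_mul]
  map_star' x := induction (p := fun x => liftFun F (star x) = star (liftFun F x)) x
    (isClosed_eq ((continuous_liftFun F).comp continuous_star)
      (continuous_star.comp (continuous_liftFun F))) fun M => by
        rw [← of_star, liftFun_of hF, liftFun_of hF, map_star, of_star]

theorem continuous_lift (F : α →⋆ₙₐ[ℂ] β) (hF : ∀ M, ‖F M‖ ≤ ‖M‖) : Continuous (lift F hF) :=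
  continuous_liftFun F

theorem lift_of (F : α →⋆ₙₐ[ℂ] β) (hF : ∀ M, ‖F M‖ ≤ ‖M‖) (M : α) :
    lift F hF (of α M) = of β (F M) :=
  liftFun_of hF M

end CStarCompletion

end Completion

section Stabilisation

open CStarCompletion

variable {A B : Type*} [NonUnitalCStarAlgebra A] [PartialOrder A] [StarOrderedRing A]
  [NonUnitalCStarAlgebra B] [PartialOrder B] [StarOrderedRing B]

/-- The stabilisation `A ⊗ K`, where `K` is the algebra of compact operators on `ℓ²(ℕ)`: the
completion of `M_∞(A)` in its C*-norm. -/
abbrev Stab (A : Type*) [NonUnitalCStarAlgebra A] [PartialOrder A] [StarOrderedRing A] : Type _ :=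
  CStarCompletion (FinMat A)

namespace Stab

/-- Relabelling of the matrix indices, as an endomorphism of `A ⊗ K`. -/
def relabel (f : ℕ ↪ ℕ) : Stab A →⋆ₙₐ[ℂ] Stab A :=
  lift (FinMat.relabelHom f) fun M => (FinMat.norm_relabelHom f M).le

/-- `φ ⊗ id : A ⊗ K → B ⊗ K`. -/
def map (φ : A →⋆ₙₐ[ℂ] B) : Stab A →⋆ₙₐ[ℂ] Stab B :=
  lift (FinMat.mapHom φ) (FinMat.norm_mapHom_le φ)

theorem relabel_of (f : ℕ ↪ ℕ) (M : FinMat A) :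
    relabel f (of _ M) = of _ (FinMat.relabel f M) :=
  lift_of _ _ M

theorem map_of (φ : A →⋆ₙₐ[ℂ] B) (M : FinMat A) :
    map φ (of _ M) = of _ (FinMat.mapHom φ M) :=
  lift_of _ _ M

theorem continuous_relabel (f : ℕ ↪ ℕ) : Continuous (relabel f : Stab A → Stab A) :=
  continuous_lift _ _

theorem continuous_map (φ : A →⋆ₙₐ[ℂ] B) : Continuous (map φ) := continuous_lift _ _

theorem relabel_mul_relabel {f g : ℕ ↪ ℕ} (h : ∀ i j, f i ≠ g j) (x y : Stab A) :
    relabel f x * relabel g y = 0 := by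
  refine induction₂ (p := fun x y => relabel f x * relabel g y = 0) x y
    (isClosed_eq (((continuous_relabel f).comp continuous_fst).mul
      ((continuous_relabel g).comp continuous_snd)) continuous_const) fun M N => ?_
  rw [relabel_of, relabel_of, ← of_mul, ← map_zero (of (FinMat A))]
  congr 1
  apply FinMat.entry_injective
  funext i j
  refine finsum_eq_zero_of_forall_eq_zero fun k => ?_
  by_cases hk : ∃ a, f a = k
  · obtain ⟨a, rfl⟩ := hk
    have : (FinMat.relabel g N).entry (f a) j = 0 :=
      FinMat.extendMat_left g N.entry (fun ⟨b, hb⟩ => h a b hb.symm) j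
    rw [this, mul_zero]
  · have : (FinMat.relabel f M).entry i k = 0 := FinMat.extendMat_right f M.entry i hk
    rw [this, zero_mul]

/-- `i ↦ 2 i`. -/
def even : ℕ ↪ ℕ := ⟨fun i => 2 * i, fun i j h => by simpa using h⟩

/-- `i ↦ 2 i + 1`. -/
def odd : ℕ ↪ ℕ := ⟨fun i => 2 * i + 1, fun i j h => by simpa using h⟩

theorem even_ne_odd (i j : ℕ) : even i ≠ odd j := by
  change 2 * i ≠ 2 * j + 1
  omega

/-- The diagonal sum `x ⊕ y` in `A ⊗ K`: `x` acts on the even and `y` on the odd basis vectors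
(an isomorphism `M_2(K) ≅ K`). -/
def dsum (x y : Stab A) : Stab A := relabel even x + relabel odd y

theorem dsum_mul (x y z w : Stab A) : dsum x y * dsum z w = dsum (x * z) (y * w) := by
  simp only [dsum, mul_add, add_mul, ← map_mul, relabel_mul_relabel even_ne_odd,
    relabel_mul_relabel fun i j => (even_ne_odd j i).symm, add_zero, zero_add]

theorem star_dsum (x y : Stab A) : star (dsum x y) = dsum (star x) (star y) := by
  simp only [dsum, star_add, map_star]

theorem dsum_sub (x y z w : Stab A) : dsum x y - dsum z w = dsum (x - z) (y - w) := by
  simp only [dsum, map_sub]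
  abel

theorem norm_dsum_le (x y : Stab A) : ‖dsum x y‖ ≤ ‖x‖ + ‖y‖ :=
  (norm_add_le _ _).trans (add_le_add (NonUnitalStarAlgHom.norm_apply_le (relabel even) x)
    (NonUnitalStarAlgHom.norm_apply_le (relabel odd) y))

theorem map_dsum (φ : A →⋆ₙₐ[ℂ] B) (x y : Stab A) :
    map φ (dsum x y) = dsum (map φ x) (map φ y) := by
  have key : ∀ (f : ℕ ↪ ℕ) (x : Stab A), map φ (relabel f x) = relabel f (map φ x) := by
    intro f x
    refine induction x (isClosed_eq ((continuous_map φ).comp (continuous_relabel f))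
      ((continuous_relabel f).comp (continuous_map φ))) fun M => ?_
    change map φ (relabel f (of _ M)) = relabel f (map φ (of _ M))
    rw [relabel_of, map_of, map_of, relabel_of]
    congr 1
    apply FinMat.entry_injective
    refine FinMat.eq_extendMat f (FinMat.mapHom φ M).entry _ (fun a b => ?_)
      (fun i j h => ?_) fun i j h => ?_
    · exact congrArg φ (FinMat.extendMat_apply f M.entry a b)
    · exact (congrArg φ (FinMat.extendMat_left f M.entry h j)).trans (map_zero φ)
    · exact (congrArg φ (FinMat.extendMat_right f M.entry i h)).trans (map_zero φ)
  simp only [dsum, map_add, key]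

end Stab

end Stabilisation

/-! ### Cuntz comparison and the Cuntz semigroup -/

section Cuntz

/-- Positive elements of a C*-algebra. -/
def IsPos {D : Type*} [NonUnitalCStarAlgebra D] (a : D) : Prop := ∃ y, a = star y * y

/-- Cuntz subequivalence: `a ≾ b` if for every `ε > 0` there is `r` with `‖r b r* - a‖ < ε`. -/
def CuntzLE {D : Type*} [NonUnitalCStarAlgebra D] (a b : D) : Prop :=
  ∀ ε : ℝ, 0 < ε → ∃ r : D, ‖r * b * star r - a‖ < ε

theorem CuntzLE.refl {D : Type*} [NonUnitalCStarAlgebra D] (a : D) : CuntzLE a a := by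
  intro ε hε
  let _ := CStarAlgebra.spectralOrder D
  let _ := CStarAlgebra.spectralOrderedRing D
  have hl := CStarAlgebra.increasingApproximateUnit D
  have h1 := hl.tendsto_mul_right a
  have h2 := hl.tendsto_mul_left a
  obtain ⟨r, hr1, hr2, hr, hrs⟩ :=
    ((Metric.tendsto_nhds.1 h1 (ε / 2) (half_pos hε)).and
      ((Metric.tendsto_nhds.1 h2 (ε / 2) (half_pos hε)).and
        (hl.eventually_norm.and hl.eventually_star_eq))).exists
  refine ⟨r, ?_⟩
  rw [dist_eq_norm] at hr1 hr2
  rw [hrs]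
  have e : r * a * r - a = r * (a * r - a) + (r * a - a) := by
    rw [mul_sub, mul_assoc]
    abel
  calc ‖r * a * r - a‖ ≤ ‖r * (a * r - a)‖ + ‖r * a - a‖ := by rw [e]; exact norm_add_le _ _
    _ ≤ ‖r‖ * ‖a * r - a‖ + ‖r * a - a‖ := by gcongr; exact norm_mul_le _ _
    _ ≤ 1 * ‖a * r - a‖ + ‖r * a - a‖ := by gcongr
    _ < ε := by linarith

theorem CuntzLE.trans {D : Type*} [NonUnitalCStarAlgebra D] {a b c : D} (hab : CuntzLE a b)
    (hbc : CuntzLE b c) : CuntzLE a c := by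
  intro ε hε
  obtain ⟨r, hr⟩ := hab (ε / 2) (half_pos hε)
  have hpos : 0 < ε / 2 / (‖r‖ * ‖r‖ + 1) := by positivity
  obtain ⟨s, hs⟩ := hbc _ hpos
  refine ⟨r * s, ?_⟩
  have e : r * s * c * star (r * s) - a =
      r * (s * c * star s - b) * star r + (r * b * star r - a) := by
    rw [star_mul]
    noncomm_ring
  have h1 : ‖r * (s * c * star s - b) * star r‖ ≤ ‖r‖ * ‖r‖ * (ε / 2 / (‖r‖ * ‖r‖ + 1)) :=
    calc _ ≤ ‖r‖ * ‖s * c * star s - b‖ * ‖star r‖ := norm_mul₃_le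
      _ = ‖r‖ * ‖r‖ * ‖s * c * star s - b‖ := by rw [norm_star]; ring
      _ ≤ _ := by gcongr
  have h2 : ‖r‖ * ‖r‖ * (ε / 2 / (‖r‖ * ‖r‖ + 1)) ≤ ε / 2 := by
    rw [← mul_div_assoc, div_le_iff₀ (by positivity)]
    nlinarith [mul_self_nonneg ‖r‖]
  rw [e]
  linarith [norm_add_le (r * (s * c * star s - b) * star r) (r * b * star r - a)]

theorem CuntzLE.map {D E : Type*} [NonUnitalCStarAlgebra D] [NonUnitalCStarAlgebra E]
    (F : D →⋆ₙₐ[ℂ] E) {a b : D} (h : CuntzLE a b) : CuntzLE (F a) (F b) := by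
  intro ε hε
  obtain ⟨r, hr⟩ := h ε hε
  refine ⟨F r, lt_of_le_of_lt ?_ hr⟩
  rw [← map_star, ← map_mul, ← map_mul, ← map_sub]
  exact NonUnitalStarAlgHom.norm_apply_le F _

theorem IsPos.map {D E : Type*} [NonUnitalCStarAlgebra D] [NonUnitalCStarAlgebra E]
    (F : D →⋆ₙₐ[ℂ] E) {a : D} (h : IsPos a) : IsPos (F a) := by
  obtain ⟨y, rfl⟩ := h
  exact ⟨F y, by rw [map_mul, map_star]⟩

variable {A B : Type*} [NonUnitalCStarAlgebra A] [PartialOrder A] [StarOrderedRing A]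
  [NonUnitalCStarAlgebra B] [PartialOrder B] [StarOrderedRing B]

/-- The set `(A ⊗ K)_+`, preordered by Cuntz subequivalence. -/
structure PosStab (A : Type*) [NonUnitalCStarAlgebra A] [PartialOrder A] [StarOrderedRing A] where
  val : Stab A
  isPos : IsPos val

instance : Preorder (PosStab A) where
  le x y := CuntzLE x.val y.val
  le_refl x := CuntzLE.refl x.val
  le_trans _ _ _ := CuntzLE.trans

theorem PosStab.le_def {x y : PosStab A} : x ≤ y ↔ CuntzLE x.val y.val := Iff.rfl

/-- The diagonal sum of positive elements. -/
def PosStab.dsum (x y : PosStab A) : PosStab A :=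
  ⟨Stab.dsum x.val y.val, by
    obtain ⟨a, ha⟩ := x.isPos
    obtain ⟨b, hb⟩ := y.isPos
    exact ⟨Stab.dsum a b, by rw [ha, hb, Stab.star_dsum, Stab.dsum_mul]⟩⟩

theorem PosStab.dsum_le_dsum {x x' y y' : PosStab A} (hx : x ≤ x') (hy : y ≤ y') :
    x.dsum y ≤ x'.dsum y' := by
  intro ε hε
  obtain ⟨r, hr⟩ := hx (ε / 2) (half_pos hε)
  obtain ⟨s, hs⟩ := hy (ε / 2) (half_pos hε)
  refine ⟨Stab.dsum r s, ?_⟩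
  change ‖Stab.dsum r s * Stab.dsum x'.val y'.val * star (Stab.dsum r s) -
    Stab.dsum x.val y.val‖ < ε
  rw [Stab.star_dsum, Stab.dsum_mul, Stab.dsum_mul, Stab.dsum_sub]
  linarith [Stab.norm_dsum_le (r * x'.val * star r - x.val) (s * y'.val * star s - y.val)]

/-- `φ ⊗ id` on positive elements. -/
def PosStab.map (φ : A →⋆ₙₐ[ℂ] B) (x : PosStab A) : PosStab B :=
  ⟨Stab.map φ x.val, x.isPos.map _⟩

theorem PosStab.map_mono (φ : A →⋆ₙₐ[ℂ] B) : Monotone (PosStab.map φ) :=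
  fun _ _ h => CuntzLE.map (Stab.map φ) h

/-- The Cuntz semigroup `Cu(A) = (A ⊗ K)_+ / ~`, where `x ~ y` means `x ≾ y` and `y ≾ x`. -/
def Cu (A : Type*) [NonUnitalCStarAlgebra A] [PartialOrder A] [StarOrderedRing A] : Type _ :=
  Antisymmetrization (PosStab A) (· ≤ ·)

namespace Cu

/-- The order induced by Cuntz subequivalence. -/
instance : PartialOrder (Cu A) :=
  inferInstanceAs (PartialOrder (Antisymmetrization (PosStab A) (· ≤ ·)))

/-- The class of a positive element of `A ⊗ K`. -/
def mk (x : PosStab A) : Cu A := toAntisymmetrization (· ≤ ·) x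

theorem mk_le_mk {x y : PosStab A} : mk x ≤ mk y ↔ x ≤ y := Iff.rfl

instance : Zero (Cu A) := ⟨mk ⟨0, 0, by simp⟩⟩

/-- The addition induced by the diagonal sum. -/
instance : Add (Cu A) :=
  ⟨Quotient.map₂ PosStab.dsum fun _ _ hx _ _ hy =>
    ⟨PosStab.dsum_le_dsum hx.1 hy.1, PosStab.dsum_le_dsum hx.2 hy.2⟩⟩

theorem mk_add_mk (x y : PosStab A) : mk x + mk y = mk (x.dsum y) := rfl

/-- The map `Cu(φ) : Cu(A) → Cu(B)`, `[x] ↦ [(φ ⊗ id)(x)]`. -/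
def map (φ : A →⋆ₙₐ[ℂ] B) : Cu A → Cu B :=
  Quotient.map (PosStab.map φ) fun _ _ h => ⟨PosStab.map_mono φ h.1, PosStab.map_mono φ h.2⟩

theorem map_mk (φ : A →⋆ₙₐ[ℂ] B) (x : PosStab A) : map φ (mk x) = mk (x.map φ) := rfl

theorem map_mono (φ : A →⋆ₙₐ[ℂ] B) : Monotone (map φ) := by
  intro x y
  induction x, y using Quotient.ind₂
  exact fun h => PosStab.map_mono φ h

theorem map_zero (φ : A →⋆ₙₐ[ℂ] B) : map φ 0 = 0 :=
  congrArg mk (by simp [PosStab.map])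

theorem map_add (φ : A →⋆ₙₐ[ℂ] B) (x y : Cu A) : map φ (x + y) = map φ x + map φ y := by
  induction x, y using Quotient.ind₂
  refine congrArg mk ?_
  simp only [PosStab.map, PosStab.dsum, Stab.map_dsum]

end Cu

end Cuntz

/-! ### Cu-morphisms, the Thomsen semigroup and the metrics -/

section Comparison

open unitInterval

/-- The way-below (compact containment) relation `x ≪ y`. -/
def WayBelow {S : Type*} [Preorder S] (x y : S) : Prop :=
  ∀ z : ℕ → S, Monotone z → ∀ s, IsLUB (Set.range z) s → y ≤ s → ∃ k, x ≤ z k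

/-- Cu-morphisms: maps preserving `0`, addition, order, the way-below relation and suprema of
increasing sequences. -/
structure CuHom (S T : Type*) [Add S] [Zero S] [PartialOrder S] [Add T] [Zero T]
    [PartialOrder T] where
  toFun : S → T
  map_zero : toFun 0 = 0
  map_add : ∀ x y, toFun (x + y) = toFun x + toFun y
  monotone : Monotone toFun
  map_wayBelow : ∀ x y, WayBelow x y → WayBelow (toFun x) (toFun y)
  map_sup : ∀ z : ℕ → S, Monotone z → ∀ s, IsLUB (Set.range z) s →
    IsLUB (Set.range (toFun ∘ z)) (toFun s)

/-- The generator `𝔾` of the category `Cu`: the increasing lower semicontinuous functions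
`f : [0,1] → {0, 1, …, ∞}` with `f 0 = 0`. -/
structure GenG where
  toFun : I → ℕ∞
  lsc : LowerSemicontinuous toFun
  map_zero : toFun 0 = 0
  mono : Monotone toFun

namespace GenG

theorem toFun_injective : Function.Injective toFun := by
  rintro ⟨f, _, _, _⟩ ⟨g, _, _, _⟩ h
  cases h
  rfl

/-- The pointwise order. -/
instance : PartialOrder GenG where
  le f g := f.toFun ≤ g.toFun
  le_refl f := le_refl f.toFun
  le_trans f g h := le_trans (a := f.toFun) (b := g.toFun) (c := h.toFun)
  le_antisymm f g h h' := toFun_injective (le_antisymm h h')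

instance : Zero GenG := ⟨⟨0, lowerSemicontinuous_const, rfl, monotone_const⟩⟩

/-- Pointwise addition. -/
instance : Add GenG :=
  ⟨fun f g => ⟨f.toFun + g.toFun, f.lsc.add g.lsc, by simp [f.map_zero, g.map_zero],
    f.mono.add g.mono⟩⟩

/-- The indicator function of the half-open interval `(t, 1]`. -/
def ind (t : I) : GenG where
  toFun := Set.indicator (Set.Ioi t) 1
  lsc := isOpen_Ioi.lowerSemicontinuous_indicator zero_le_one
  map_zero := Set.indicator_of_notMem (s := Set.Ioi t) (fun h => not_lt_of_ge t.2.1 h) _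
  mono x y h := by
    by_cases hx : x ∈ Set.Ioi t
    · have hy : y ∈ Set.Ioi t := lt_of_lt_of_le hx h
      rw [Set.indicator_of_mem hx, Set.indicator_of_mem hy]
      rfl
    · rw [Set.indicator_of_notMem hx]
      exact bot_le

end GenG

/-- The Thomsen semigroup `Th(S) = Hom_Cu(𝔾, S)`. -/
abbrev Th (S : Type*) [Add S] [Zero S] [PartialOrder S] : Type _ := CuHom GenG S

/-- The left end point of the `r`-neighbourhood of `(t, 1]` in `(0, 1]`. -/
def lowerBy (r : ℝ) (t : I) : I := Set.projIcc 0 1 zero_le_one ((t : ℝ) - r)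

/-- The metric `d_Cu(α, β)`: the infimum of all `r > 0` such that `α(1_U) ≤ β(1_{U_r})` and
`β(1_U) ≤ α(1_{U_r})` for all open `U ⊆ (0, 1]` with `1_U ∈ 𝔾`, where `U_r` is the
`r`-neighbourhood of `U` in `(0, 1]` (it is `∞` if there is no such `r`). These `U` are the empty
set and `(t, 1]` for `0 ≤ t < 1`, and then `U_r` is `(max (t - r) 0, 1]`. -/
def dCu {T : Type*} [LE T] (α β : GenG → T) : ENNReal :=
  ⨅ (r : ℝ) (_ : 0 < r) (_ : ∀ t : I, t < 1 →
    α (GenG.ind t) ≤ β (GenG.ind (lowerBy r t)) ∧ β (GenG.ind t) ≤ α (GenG.ind (lowerBy r t))),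
    ENNReal.ofReal r

/-- `d_N(α, β) = sup_{ν ∈ N} d_Cu(α ∘ ν, β ∘ ν)`. -/
def dN {S T : Type*} [Add S] [Zero S] [PartialOrder S] [LE T] (N : Set (Th S)) (α β : S → T) :
    ENNReal :=
  ⨆ ν ∈ N, dCu (α ∘ ν.toFun) (β ∘ ν.toFun)

end Comparison

/-! ### Traces, affine functions and stable rank one -/

section Traces

/-- `A` has stable rank one: the invertible elements of the unitization are dense in it. (If `A`
has a unit, this means that the invertible elements of `A` are dense in `A`.) -/
def StableRankOne (A : Type*) [NonUnitalCStarAlgebra A] : Prop :=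
  Dense {x : Unitization ℂ A | IsUnit x}

variable {A B : Type*} [NonUnitalCStarAlgebra A] [NonUnitalCStarAlgebra B]

/-- Positive tracial functionals. -/
def IsTrace (τ : WeakDual ℂ A) : Prop :=
  (∀ a, 0 ≤ (τ (star a * a)).re ∧ (τ (star a * a)).im = 0) ∧ ∀ a b, τ (a * b) = τ (b * a)

/-- The compact convex set of positive tracial functionals of norm at most one, with the
weak-* topology. -/
def TraceBall (A : Type*) [NonUnitalCStarAlgebra A] : Set (WeakDual ℂ A) :=
  {τ | IsTrace τ ∧ ‖WeakDual.toStrongDual τ‖ ≤ 1}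

/-- `T₁(A)`: the tracial states of `A`. -/
def T₁ (A : Type*) [NonUnitalCStarAlgebra A] : Set (WeakDual ℂ A) :=
  {τ | IsTrace τ ∧ ‖WeakDual.toStrongDual τ‖ = 1}

theorem T₁_subset : T₁ A ⊆ TraceBall A := fun _ h => ⟨h.1, h.2.le⟩

/-- `Aff T₁(A)`. An element is a real affine function on the tracial states that is continuous in
the sense that its homogeneous extension `F (s • τ) = s * F τ` is weak-* continuous on
`TraceBall A`; equivalently, `F` is a continuous affine function on `TraceBall A` with `F 0 = 0`.
If `A` is unital, `T₁(A)` is compact and consists of the `τ` in `TraceBall A` with `τ 1 = 1`, and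
restriction to `T₁(A)` identifies `AffT₁ A` with the continuous affine functions on `T₁(A)`.
For every self-adjoint `h` it contains `ĥ : τ ↦ τ h`. -/
structure AffT₁ (A : Type*) [NonUnitalCStarAlgebra A] where
  toFun : TraceBall A → ℝ
  continuous_toFun : Continuous toFun
  map_zero : ∀ τ : TraceBall A, (τ : WeakDual ℂ A) = 0 → toFun τ = 0
  affine : ∀ (σ τ ρ : TraceBall A) (s : ℝ), 0 ≤ s → s ≤ 1 →
    (ρ : WeakDual ℂ A) = (s : ℂ) • (σ : WeakDual ℂ A) + ((1 - s : ℝ) : ℂ) • (τ : WeakDual ℂ A) →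
    toFun ρ = s * toFun σ + (1 - s) * toFun τ

/-- A `*`-homomorphism as a continuous linear map. -/
def homCLM (φ : A →⋆ₙₐ[ℂ] B) : A →L[ℂ] B :=
  LinearMap.mkContinuous ((φ : A →ₙₐ[ℂ] B) : A →ₗ[ℂ] B) 1 fun a => by
    rw [one_mul]
    exact NonUnitalStarAlgHom.norm_apply_le φ a

theorem homCLM_apply (φ : A →⋆ₙₐ[ℂ] B) (a : A) : homCLM φ a = φ a := rfl

/-- `φ^*`: composition of traces with `φ`. -/
def tracePullback (φ : A →⋆ₙₐ[ℂ] B) (τ : TraceBall B) : TraceBall A :=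
  ⟨StrongDual.toWeakDual ((WeakDual.toStrongDual τ.1).comp (homCLM φ)), by
    refine ⟨⟨fun a => ?_, fun a b => ?_⟩, ?_⟩
    · have h := τ.2.1.1 (φ a)
      rw [← map_star, ← map_mul] at h
      exact h
    · have h := τ.2.1.2 (φ a) (φ b)
      rw [← map_mul, ← map_mul] at h
      exact h
    · refine (ContinuousLinearMap.opNorm_comp_le _ _).trans ?_
      have h : ‖homCLM φ‖ ≤ 1 := LinearMap.mkContinuous_norm_le _ zero_le_one _
      exact mul_le_one₀ τ.2.2 (norm_nonneg _) h⟩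

theorem tracePullback_apply (φ : A →⋆ₙₐ[ℂ] B) (τ : TraceBall B) (a : A) :
    (tracePullback φ τ).1 a = τ.1 (φ a) := rfl

theorem continuous_tracePullback (φ : A →⋆ₙₐ[ℂ] B) : Continuous (tracePullback φ) :=
  Continuous.subtype_mk (WeakDual.continuous_of_continuous_eval fun a =>
    (WeakDual.eval_continuous (φ a)).comp continuous_subtype_val) _

namespace AffT₁

/-- `Aff T₁(φ) : Aff T₁(A) → Aff T₁(B)`, `F ↦ F ∘ φ^*`. It maps `ĥ` to the function of `φ h`. -/
def map (φ : A →⋆ₙₐ[ℂ] B) (F : AffT₁ A) : AffT₁ B where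
  toFun τ := F.toFun (tracePullback φ τ)
  continuous_toFun := F.continuous_toFun.comp (continuous_tracePullback φ)
  map_zero τ h := F.map_zero _ (by
    apply DFunLike.ext
    intro a
    rw [tracePullback_apply, h]
    rfl)
  affine σ τ ρ s h0 h1 h := F.affine _ _ _ s h0 h1 (by
    apply DFunLike.ext
    intro a
    rw [tracePullback_apply, h]
    rfl)

/-- The norm distance `‖F - G‖ = sup_{τ ∈ T₁(A)} |F τ - G τ|`. -/
def dist (F G : AffT₁ A) : ENNReal :=
  ⨆ (τ : TraceBall A) (_ : (τ : WeakDual ℂ A) ∈ T₁ A), ENNReal.ofReal |F.toFun τ - G.toFun τ|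

/-- `ĥ : τ ↦ τ h` for self-adjoint `h`. -/
def ev (h : selfAdjoint A) : AffT₁ A where
  toFun τ := (τ.1 (h : A)).re
  continuous_toFun := Complex.continuous_re.comp
    ((WeakDual.eval_continuous (h : A)).comp continuous_subtype_val)
  map_zero τ hτ := by
    rw [hτ]
    rfl
  affine σ τ ρ s _ _ hρ := by
    have h1 : ρ.1 (h : A) = (s : ℂ) * σ.1 (h : A) + ((1 - s : ℝ) : ℂ) * τ.1 (h : A) := by
      rw [hρ]
      rfl
    rw [h1, Complex.add_re, Complex.re_ofReal_mul, Complex.re_ofReal_mul]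

theorem map_ev_apply (φ : A →⋆ₙₐ[ℂ] B) (h : selfAdjoint A) (τ : TraceBall B) :
    (map φ (ev h)).toFun τ = (τ.1 (φ h)).re := rfl

end AffT₁

end Traces

end CuntzSemigroup
end

open CuntzSemigroup

universe u v

/-! Every `F` in `Aff T₁(A)` is `τ ↦ τ(h)` for a self-adjoint `h` (`AffT₁.exists_eq_selfAdjoint`),
so it suffices to control `τ(φ(x)) - τ(ψ(x))` for the two positive elements `x = h⁺` and `x = h⁻`.
Slice `x` into layers of height one, `min((x - k)₊, 1)` for `k < ⌈‖h‖⌉`. Each layer `a` is a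
positive contraction and defines a Thomsen morphism with `1_{(t,1]} ↦ [(a - t)₊]`; the set `N`
consists of these morphisms.

If `d_N < ε/2`, pick `r < ε/2` above `d_N`. For each layer `a` and `t < 1` this gives `(φ(a) - t)₊ ≾
(ψ(a) - max(t - r, 0))₊`, and the same with `φ` and `ψ` exchanged. A trace `τ` has a dimension
function `rank τ`, monotone for `≾` and with values in `[0,1]`, and `τ(b) = ∫₀¹ rank τ ((b - t)₊)
dt` for positive contractions `b`. A shift of the variable by `r` costs at most `r` times the total
drop of the integrand. On layer `k` of `y = ψ(x)` that drop is at most `rank τ ((y - k)₊) - rank τ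
((y - k - 1)₊)`, and the sum over `k` telescopes to at most `1`. Hence `|τ(φ(x)) - τ(ψ(x))| ≤ r`
whatever the norm of `x` (`reTrace_sub_le_of_cuntzLE`), and `h⁺` and `h⁻` together give `2r < ε`.
Normalising `h` instead of slicing it would multiply the error by `‖h‖`.

Two further ingredients carry the proof. First, `t ↦ [(a - t)₊]` must extend to a Cu-morphism on `𝔾`
(`IsScale.toTh`). This uses that increasing sequences in `Cu(A)` have suprema, and that `[(x - ε)₊]
≪ [x]` (`Cu.exists_sup`, `Cu.wayBelow_iff`). Secondly, the representation of `F` by `h` rests on a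
Jordan decomposition of differences of traces into traces (`exists_trace_add_eq_add`), which makes
`F` Lipschitz in norm. A minimax argument then approximates `F` by elements of controlled norm, and
iteration makes the approximation exact. -/

set_option linter.unusedSectionVars false
set_option linter.unusedVariables false

noncomputable section

namespace CuntzSemigroup

/-! ### Cuntz comparison by functional calculus: cut-downs and exact comparison. -/

section CuntzComparison

variable {D : Type*} [NonUnitalCStarAlgebra D]

theorem CuntzLE.of_approx {a b : D} (h : ∀ ε : ℝ, 0 < ε → ∃ c, ‖c - a‖ < ε ∧ CuntzLE c b) :
    CuntzLE a b := by
  intro ε hε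
  obtain ⟨c, hc, hcb⟩ := h (ε / 2) (half_pos hε)
  obtain ⟨r, hr⟩ := hcb (ε / 2) (half_pos hε)
  refine ⟨r, ?_⟩
  have := norm_add_le (r * b * star r - c) (c - a)
  rw [sub_add_sub_cancel] at this
  linarith

theorem CuntzLE.conj (r b : D) : CuntzLE (r * b * star r) b :=
  fun ε hε => ⟨r, by simpa using hε⟩

theorem CuntzLE.zero (b : D) : CuntzLE 0 b := fun ε hε => ⟨0, by simpa using hε⟩

/-- The scalar is absorbed into the conjugating element as `√c`. -/
theorem CuntzLE.smul {c : ℝ} (hc : 0 ≤ c) (b : D) : CuntzLE (c • b) b := by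
  have h : CuntzLE (c • b) (c • b) := CuntzLE.refl _
  intro ε hε
  obtain ⟨r, hr⟩ := h ε hε
  refine ⟨√c • r, ?_⟩
  have e : √c • r * b * star (√c • r) = r * (c • b) * star r := by
    rw [star_smul, star_trivial, smul_mul_assoc, mul_smul_comm, smul_mul_assoc, smul_smul,
      mul_smul_comm, smul_mul_assoc, Real.mul_self_sqrt hc]
  rwa [e]

variable [PartialOrder D] [StarOrderedRing D]

theorem isPos_iff_nonneg {a : D} : IsPos a ↔ 0 ≤ a :=
  CStarAlgebra.nonneg_iff_eq_star_mul_self.symm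

/-- This is `(1 - e) y (1 - e)` multiplied out; the unit is taken in the unitization. -/
theorem sub_conj_nonneg {y e : D} (hy : 0 ≤ y) (he : IsSelfAdjoint e) :
    0 ≤ y - e * y - y * e + e * y * e := by
  rw [← Unitization.inr_nonneg_iff]
  have h := star_left_conjugate_nonneg (Unitization.inr_nonneg_iff.2 hy)
    (1 - (e : Unitization ℂ D))
  have e1 : star (1 - (e : Unitization ℂ D)) = 1 - (e : Unitization ℂ D) := by
    rw [star_sub, star_one, ← Unitization.inr_star, he.star_eq]
  rw [e1] at h
  convert h using 1
  simp only [Unitization.inr_add, Unitization.inr_sub, Unitization.inr_mul]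
  noncomm_ring

/-- The function `s ↦ √s / (s + δ)`, a substitute for `s ^ (-1/2)` that vanishes at `0`. -/
def invSqrtFun (δ s : ℝ) : ℝ := √s / (|s| + δ)

theorem continuous_invSqrtFun {δ : ℝ} (hδ : 0 < δ) : Continuous (invSqrtFun δ) := by
  unfold invSqrtFun
  refine Continuous.div (by fun_prop) (by fun_prop) fun s => ?_
  positivity

theorem invSqrtFun_zero (δ : ℝ) : invSqrtFun δ 0 = 0 := by simp [invSqrtFun]

theorem sq_invSqrtFun {δ s : ℝ} (hs : 0 ≤ s) : invSqrtFun δ s ^ 2 = s / (s + δ) ^ 2 := by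
  rw [invSqrtFun, div_pow, Real.sq_sqrt hs, abs_of_nonneg hs]

/-- A substitute for `S ^ (-1/2)`. -/
def invSqrt (δ : ℝ) (S : D) : D := cfcₙ (invSqrtFun δ) S

theorem isSelfAdjoint_invSqrt (δ : ℝ) (S : D) : IsSelfAdjoint (invSqrt δ S) :=
  cfcₙ_predicate _ S

theorem spec_nonneg {S : D} (hS : 0 ≤ S) {s : ℝ} (hs : s ∈ quasispectrum ℝ S) : 0 ≤ s :=
  quasispectrum_nonneg_of_nonneg S hS s hs

/-- On the spectrum this function is `s² / (s + δ)²`, which is at most `1` and tends to `1` for `s >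
0` as `δ → 0`: an approximate unit for everything dominated by `S`. -/
theorem invSqrt_conj_eq {δ : ℝ} (hδ : 0 < δ) {S : D} (hS : 0 ≤ S) :
    invSqrt δ S * S * invSqrt δ S = cfcₙ (fun s => s * invSqrtFun δ s ^ 2) S := by
  have hc := continuous_invSqrtFun hδ
  have h0 := invSqrtFun_zero δ
  have hsa : IsSelfAdjoint S := .of_nonneg hS
  have h1 : invSqrt δ S * S = cfcₙ (fun s => invSqrtFun δ s * s) S := by
    rw [cfcₙ_mul (invSqrtFun δ) (fun s => s) S hc.continuousOn h0 (by fun_prop) rfl,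
      cfcₙ_id' ℝ S]
    rfl
  rw [h1, invSqrt, ← cfcₙ_mul _ _ S (by fun_prop) (by simp) hc.continuousOn h0]
  congr 1
  funext s
  ring

/-- If `x ≤ S`, then `g S g` with `g = invSqrt δ S` is almost a right unit for `√x`. -/
theorem norm_sqrt_sub_sqrt_mul_le {δ : ℝ} (hδ : 0 < δ) {x S : D} (hx : 0 ≤ x) (hxS : x ≤ S) :
    ‖CFC.sqrt x - CFC.sqrt x * (invSqrt δ S * S * invSqrt δ S)‖ ≤ √δ := by
  have hS : 0 ≤ S := hx.trans hxS
  have hsa : IsSelfAdjoint S := .of_nonneg hS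
  have hc := continuous_invSqrtFun hδ
  set e := invSqrt δ S * S * invSqrt δ S with he_def
  have hee : e = cfcₙ (fun s => s * invSqrtFun δ s ^ 2) S := invSqrt_conj_eq hδ hS
  have he : IsSelfAdjoint e := by rw [hee]; exact cfcₙ_predicate _ S
  have hw : IsSelfAdjoint (CFC.sqrt x) := .of_nonneg (CFC.sqrt_nonneg x)
  apply Real.le_sqrt_of_sq_le
  rw [sq, ← CStarRing.norm_star_mul_self]
  have e1 : star (CFC.sqrt x - CFC.sqrt x * e) * (CFC.sqrt x - CFC.sqrt x * e) =
      x - e * x - x * e + e * x * e := by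
    have hss := CFC.sqrt_mul_sqrt_self x
    rw [star_sub, star_mul, hw.star_eq, he.star_eq]
    calc _ = CFC.sqrt x * CFC.sqrt x - e * (CFC.sqrt x * CFC.sqrt x)
        - CFC.sqrt x * CFC.sqrt x * e + e * (CFC.sqrt x * CFC.sqrt x) * e := by noncomm_ring
      _ = _ := by rw [hss]
  rw [e1]
  -- Conjugation by `1 - e` is monotone, so `x` may be replaced by `S`; what remains is a function
  -- of `S` alone.
  have h2 : x - e * x - x * e + e * x * e ≤ S - e * S - S * e + e * S * e := by
    have := sub_conj_nonneg (sub_nonneg.2 hxS) he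
    rw [← sub_nonneg]
    convert this using 1
    noncomm_ring
  refine (CStarAlgebra.norm_le_norm_of_nonneg_of_le (sub_conj_nonneg hx he) h2).trans ?_
  have e2 : S - e * S - S * e + e * S * e =
      cfcₙ (fun s => s - (s * invSqrtFun δ s ^ 2) * s - s * (s * invSqrtFun δ s ^ 2)
        + (s * invSqrtFun δ s ^ 2) * s * (s * invSqrtFun δ s ^ 2)) S := by
    have hF : Continuous fun s => s * invSqrtFun δ s ^ 2 := by fun_prop
    rw [hee, cfcₙ_add (fun s => s - (s * invSqrtFun δ s ^ 2) * s - s * (s * invSqrtFun δ s ^ 2)) _ S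
        (by fun_prop) (by simp) (by fun_prop) (by simp),
      cfcₙ_sub _ _ S (by fun_prop) (by simp) (by fun_prop) (by simp),
      cfcₙ_sub _ _ S (by fun_prop) (by simp) (by fun_prop) (by simp),
      cfcₙ_mul (fun s => s * invSqrtFun δ s ^ 2 * s) (fun s => s * invSqrtFun δ s ^ 2) S
        (by fun_prop) (by simp) (by fun_prop) (by simp),
      cfcₙ_mul (fun s => s * invSqrtFun δ s ^ 2) (fun s => s) S
        (by fun_prop) (by simp) (by fun_prop) (by simp),
      cfcₙ_mul (fun s => s) (fun s => s * invSqrtFun δ s ^ 2) S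
        (by fun_prop) (by simp) (by fun_prop) (by simp), cfcₙ_id' ℝ S]
  rw [e2]
  refine norm_cfcₙ_le fun s hs => ?_
  have hs := spec_nonneg hS hs
  rw [sq_invSqrtFun hs]
  have hp : 0 < s + δ := by positivity
  -- The function is `s (1 - s²/(s+δ)²)²`, and `1 - s²/(s+δ)² = δ(2s+δ)/(s+δ)²`. The bound by `δ`
  -- then holds because the difference of the two sides is a polynomial with nonnegative
  -- coefficients.
  have e3 : s - (s * (s / (s + δ) ^ 2)) * s - s * (s * (s / (s + δ) ^ 2))
        + (s * (s / (s + δ) ^ 2)) * s * (s * (s / (s + δ) ^ 2)) =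
      s * (δ * (2 * s + δ) / (s + δ) ^ 2) ^ 2 := by
    field_simp
    ring
  rw [e3, Real.norm_of_nonneg (by positivity), div_pow, ← mul_div_assoc, div_le_iff₀ (by positivity)]
  have : (s + δ) ^ 4 * δ - s * (δ * (2 * s + δ)) ^ 2 = δ * (s ^ 4 + 2 * s ^ 2 * δ ^ 2 + 3 * s * δ ^ 3
    + δ ^ 4) := by ring
  have h5 : 0 ≤ δ * (s ^ 4 + 2 * s ^ 2 * δ ^ 2 + 3 * s * δ ^ 3 + δ ^ 4) := by positivity
  nlinarith [h5]

theorem norm_sqrt_conj_sub_le {δ : ℝ} (hδ : 0 < δ) {x S : D} (hx : 0 ≤ x) (hxS : x ≤ S) :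
    ‖CFC.sqrt x * (invSqrt δ S * S * invSqrt δ S) * CFC.sqrt x - x‖ ≤ √δ * ‖CFC.sqrt x‖ := by
  have h := norm_sqrt_sub_sqrt_mul_le hδ hx hxS
  have e : CFC.sqrt x * (invSqrt δ S * S * invSqrt δ S) * CFC.sqrt x - x =
      -((CFC.sqrt x - CFC.sqrt x * (invSqrt δ S * S * invSqrt δ S)) * CFC.sqrt x) := by
    rw [sub_mul, CFC.sqrt_mul_sqrt_self x]
    abel
  rw [e, norm_neg]
  exact (norm_mul_le _ _).trans (by gcongr)

theorem exists_pos_sqrt_mul_lt (c : ℝ) {ε : ℝ} (hε : 0 < ε) : ∃ δ : ℝ, 0 < δ ∧ √δ * c < ε := by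
  refine ⟨(ε / (|c| + 1)) ^ 2, by positivity, ?_⟩
  rw [Real.sqrt_sq (by positivity), div_mul_eq_mul_div, div_lt_iff₀ (by positivity)]
  have := le_abs_self c
  nlinarith

/-- With `g` close to `y^(-1/2)`, the element `√x g` conjugates `y` to `√x (g y g) √x`, which tends
to `x`. -/
theorem CuntzLE.of_le {x y : D} (hx : 0 ≤ x) (hxy : x ≤ y) : CuntzLE x y := by
  intro ε hε
  obtain ⟨δ, hδ, h⟩ := exists_pos_sqrt_mul_lt ‖CFC.sqrt x‖ hε
  refine ⟨CFC.sqrt x * invSqrt δ y, lt_of_le_of_lt ?_ h⟩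
  have hw : IsSelfAdjoint (CFC.sqrt x) := .of_nonneg (CFC.sqrt_nonneg x)
  rw [star_mul, hw.star_eq, (isSelfAdjoint_invSqrt δ y).star_eq]
  have := norm_sqrt_conj_sub_le hδ hx hxy
  rwa [show CFC.sqrt x * invSqrt δ y * y * (invSqrt δ y * CFC.sqrt x) =
    CFC.sqrt x * (invSqrt δ y * y * invSqrt δ y) * CFC.sqrt x by noncomm_ring]

/-- Multiplicative constants do not matter for `≾`, so a pointwise bound up to any factor `C` on the
spectrum compares two functions of the same element. -/
theorem CuntzLE.cfcₙ_of_le {f g : ℝ → ℝ} {a : D} (C : ℝ) (ha : 0 ≤ a) (hC : 0 ≤ C)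
    (hf : Continuous f) (hg : Continuous g) (hf0 : f 0 = 0) (hg0 : g 0 = 0)
    (h0 : ∀ x, 0 ≤ x → 0 ≤ f x) (h : ∀ x ∈ quasispectrum ℝ a, f x ≤ C * g x) :
    CuntzLE (cfcₙ f a) (cfcₙ g a) := by
  refine CuntzLE.trans (b := C • cfcₙ g a) (CuntzLE.of_le ?_ ?_) (CuntzLE.smul hC _)
  · exact cfcₙ_nonneg fun x hx => h0 x (spec_nonneg ha hx)
  · rw [← cfcₙ_smul C g a]
    exact cfcₙ_mono h (by fun_prop) (by fun_prop)

/-- The cut-down `(a - ε)₊`. -/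
def cut (ε : ℝ) (a : D) : D := cfcₙ (fun x : ℝ => max (x - ε) 0) a

theorem cut_nonneg (ε : ℝ) (a : D) : 0 ≤ cut ε a := cfcₙ_nonneg fun x _ => le_max_right _ _

theorem cut_zero {a : D} (ha : 0 ≤ a) : cut 0 a = a := by
  conv_rhs => rw [← cfcₙ_id' ℝ a]
  refine cfcₙ_congr fun x hx => ?_
  simpa using spec_nonneg ha hx

theorem norm_cut_sub_le {ε : ℝ} (hε : 0 ≤ ε) {a : D} (ha : 0 ≤ a) : ‖cut ε a - a‖ ≤ ε := by
  have e : cut ε a - a = cfcₙ (fun x : ℝ => max (x - ε) 0 - x) a := by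
    rw [cfcₙ_sub _ _ a (by fun_prop) (by simpa using hε), cfcₙ_id' ℝ a]
    rfl
  rw [e]
  refine norm_cfcₙ_le fun x hx => ?_
  have hx := spec_nonneg ha hx
  rw [Real.norm_eq_abs, abs_le]
  constructor
  · linarith [le_max_left (x - ε) 0]
  · rcases le_total (x - ε) 0 with h | h
    · rw [max_eq_right h]; linarith
    · rw [max_eq_left h]; linarith

theorem cut_cut {ε δ : ℝ} (hε : 0 ≤ ε) (hδ : 0 ≤ δ) {a : D} (ha : 0 ≤ a) :
    cut δ (cut ε a) = cut (ε + δ) a := by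
  unfold cut
  rw [← cfcₙ_comp' (fun x : ℝ => max (x - δ) 0) (fun x : ℝ => max (x - ε) 0) a (by fun_prop)
    (by simpa using hδ) (by fun_prop) (by simpa using hε)]
  refine cfcₙ_congr fun x _ => ?_
  rcases le_total (x - ε) 0 with h | h
  · rw [max_eq_right h, max_eq_right (by linarith), max_eq_right (by linarith)]
  · rw [max_eq_left h, sub_sub]

theorem cut_le_cut {ε δ : ℝ} (hε : 0 ≤ ε) (h : ε ≤ δ) {a : D} (ha : 0 ≤ a) : cut δ a ≤ cut ε a :=
  cfcₙ_mono (fun x _ => max_le_max (by linarith) le_rfl) (by fun_prop) (by fun_prop)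
    (by simpa using hε.trans h) (by simpa using hε)

theorem CuntzLE.cut_mono {ε δ : ℝ} (hε : 0 ≤ ε) (h : ε ≤ δ) {a : D} (ha : 0 ≤ a) :
    CuntzLE (cut δ a) (cut ε a) :=
  CuntzLE.of_le (cut_nonneg _ _) (cut_le_cut hε h ha)

theorem CuntzLE.cut_self {ε : ℝ} (hε : 0 ≤ ε) {a : D} (ha : 0 ≤ a) : CuntzLE (cut ε a) a := by
  simpa only [cut_zero ha] using CuntzLE.cut_mono le_rfl hε ha

theorem cut_eq_zero {ε : ℝ} {a : D} (ha : 0 ≤ a) (h : ‖a‖ ≤ ε) : cut ε a = 0 := by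
  rw [cut, ← cfcₙ_zero ℝ a]
  refine cfcₙ_congr fun x hx => ?_
  have h1 := norm_apply_le_norm_cfcₙ (fun x : ℝ => x) a hx
  rw [cfcₙ_id' ℝ a, Real.norm_eq_abs] at h1
  have := le_abs_self x
  exact max_eq_right (by linarith)

theorem CuntzLE.of_cut {a b : D} (ha : 0 ≤ a) (h : ∀ ε : ℝ, 0 < ε → CuntzLE (cut ε a) b) :
    CuntzLE a b :=
  CuntzLE.of_approx fun ε hε => ⟨_, (norm_cut_sub_le (half_pos hε).le ha).trans_lt (half_lt_self hε),
    h _ (half_pos hε)⟩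

/-- No multiple of `x²` dominates `x` near `0`, but after a cut-down one does: `(x - ε)₊ ≤ x² / ε`.
-/
theorem CuntzLE.sq {a : D} (ha : 0 ≤ a) : CuntzLE a (a * a) := by
  refine CuntzLE.of_cut ha fun ε hε => ?_
  have e : a * a = cfcₙ (fun x : ℝ => x * x) a := by
    rw [cfcₙ_mul (fun x : ℝ => x) (fun x : ℝ => x) a, cfcₙ_id' ℝ a]
  rw [e]
  refine CuntzLE.cfcₙ_of_le (1 / ε) ha (by positivity) (by fun_prop) (by fun_prop)
    (by simpa using hε.le) (by simp) (fun x _ => le_max_right _ _) fun x hx => ?_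
  have hx := spec_nonneg ha hx
  refine max_le ?_ (by positivity)
  rw [div_mul_eq_mul_div, one_mul, le_div_iff₀ hε]
  nlinarith [sq_nonneg (x - ε / 2)]

/-- `Y Y* ≾ (Y Y*)² = Y (Y* Y) Y* ≾ Y* Y`. -/
theorem CuntzLE.mul_star_self (Y : D) : CuntzLE (Y * star Y) (star Y * Y) := by
  refine (CuntzLE.sq (mul_star_self_nonneg Y)).trans ?_
  have : Y * star Y * (Y * star Y) = Y * (star Y * Y) * star Y := by noncomm_ring
  rw [this]
  exact CuntzLE.conj _ _

/-- If `‖a - b‖ < ε`, then `(a - ε)₊ ≤ h b h` for a suitable `h`. -/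
theorem exists_cut_le_conj {ε : ℝ} {a b : D} (ha : 0 ≤ a) (hb : 0 ≤ b) (h : ‖a - b‖ < ε) :
    ∃ k : D, IsSelfAdjoint k ∧ cut ε a ≤ k * b * k := by
  set δ := ‖a - b‖ with hδ
  have hδ0 : 0 ≤ δ := norm_nonneg _
  have hε : 0 < ε := hδ0.trans_lt h
  have hsa : IsSelfAdjoint a := .of_nonneg ha
  -- Chosen so that `f(x)² (x - δ) = (x - ε)₊`. The lower bound `ε - δ` of the denominator only
  -- takes effect where the numerator vanishes, and keeps `f` continuous.
  let f : ℝ → ℝ := fun x => √(max (x - ε) 0 / max (x - δ) (ε - δ))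
  have hfc : Continuous f := by
    refine Continuous.sqrt (Continuous.div (by fun_prop) (by fun_prop) fun x => ?_)
    exact (lt_of_lt_of_le (sub_pos.2 h) (le_max_right _ _)).ne'
  have hf0 : f 0 = 0 := by simp [f, hε.le]
  refine ⟨cfcₙ f a, cfcₙ_predicate _ a, ?_⟩
  have hk : IsSelfAdjoint (cfcₙ f a) := cfcₙ_predicate _ a
  have e1 : cfcₙ f a * a * cfcₙ f a - δ • (cfcₙ f a * cfcₙ f a) = cut ε a := by
    have : cfcₙ (fun x => f x * x * f x - δ • (f x * f x)) a =
        cfcₙ f a * a * cfcₙ f a - δ • (cfcₙ f a * cfcₙ f a) := by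
      rw [cfcₙ_sub _ _ a (by fun_prop) (by simp) (by fun_prop) (by simp [hf0]),
        cfcₙ_smul _ _ a (by fun_prop) (by simp [hf0]),
        cfcₙ_mul _ f a (by fun_prop) (by simp) (by fun_prop) hf0,
        cfcₙ_mul f _ a (by fun_prop) hf0 (by fun_prop) rfl,
        cfcₙ_mul f f a (by fun_prop) hf0 (by fun_prop) hf0, cfcₙ_id' ℝ a]
    rw [← this]
    refine cfcₙ_congr fun x _ => ?_
    have hm : 0 < max (x - δ) (ε - δ) := lt_of_lt_of_le (sub_pos.2 h) (le_max_right _ _)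
    have hff : f x * f x = max (x - ε) 0 / max (x - δ) (ε - δ) :=
      Real.mul_self_sqrt (div_nonneg (le_max_right _ _) hm.le)
    have : f x * x * f x - δ • (f x * f x) = (f x * f x) * (x - δ) := by
      rw [smul_eq_mul]; ring
    change f x * x * f x - δ • (f x * f x) = max (x - ε) 0
    rw [this, hff]
    rcases le_total (x - ε) 0 with hx | hx
    · rw [max_eq_right hx]; simp
    · have h3 : max (x - δ) (ε - δ) = x - δ := max_eq_left (by linarith)
      rw [h3] at hm ⊢
      field_simp
  rw [← e1]
  have hab : IsSelfAdjoint (a - b) := hsa.sub (.of_nonneg hb)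
  -- With `k = f(a)`: `k (a - b) k ≤ δ k²`, that is, `k a k - δ k² ≤ k b k`, and the left side is
  -- the cut-down.
  have h2 := CStarAlgebra.star_left_conjugate_le_norm_smul (a := cfcₙ f a) (b := a - b) hab
  rw [hk.star_eq, mul_sub, sub_mul] at h2
  rw [sub_le_iff_le_add, add_comm]
  exact sub_le_iff_le_add.1 h2

theorem CuntzLE.cut_of_norm_lt {ε : ℝ} {a b : D} (ha : 0 ≤ a) (hb : 0 ≤ b) (h : ‖a - b‖ < ε) :
    CuntzLE (cut ε a) b := by
  obtain ⟨k, hk, hle⟩ := exists_cut_le_conj ha hb h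
  refine (CuntzLE.of_le (cut_nonneg _ _) hle).trans ?_
  have := CuntzLE.conj k b
  rwa [hk.star_eq] at this

theorem tendsto_mul_mul_cut {b : D} (hb : 0 ≤ b) (r : D) {ε : ℝ} (hε : 0 < ε) :
    ∃ δ : ℝ, 0 < δ ∧ ‖r * cut δ b * star r - r * b * star r‖ < ε := by
  refine ⟨ε / (‖r‖ * ‖r‖ + 1), by positivity, ?_⟩
  rw [← sub_mul, ← mul_sub]
  calc _ ≤ ‖r‖ * ‖cut _ b - b‖ * ‖star r‖ := norm_mul₃_le
    _ ≤ ‖r‖ * (ε / (‖r‖ * ‖r‖ + 1)) * ‖r‖ := by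
        rw [norm_star]
        gcongr
        exact norm_cut_sub_le (by positivity) hb
    _ = ε * (‖r‖ * ‖r‖ / (‖r‖ * ‖r‖ + 1)) := by ring
    _ < ε * 1 := by
        gcongr
        rw [div_lt_one (by positivity)]
        linarith
    _ = ε := mul_one ε

theorem CuntzLE.exists_conj_cut {a b : D} (hb : 0 ≤ b) (h : CuntzLE a b) {ε : ℝ}
    (hε : 0 < ε) : ∃ δ : ℝ, 0 < δ ∧ ∃ r : D, ‖a - r * cut δ b * star r‖ < ε := by
  obtain ⟨r, hr⟩ := h (ε / 2) (half_pos hε)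
  obtain ⟨δ, hδ, hd⟩ := tendsto_mul_mul_cut hb r (half_pos hε)
  refine ⟨δ, hδ, r, ?_⟩
  rw [norm_sub_rev]
  have := norm_add_le (r * cut δ b * star r - r * b * star r) (r * b * star r - a)
  rw [sub_add_sub_cancel] at this
  linarith

/-- Cutting `a` down leaves room to cut `b` down as well, since a conjugate of `b` near `a` survives
replacing `b` by a nearby cut-down. This is the source of compact containment in `Cu`. -/
theorem CuntzLE.exists_cut {a b : D} (ha : 0 ≤ a) (hb : 0 ≤ b) (h : CuntzLE a b) {ε : ℝ}
    (hε : 0 < ε) : ∃ δ : ℝ, 0 < δ ∧ CuntzLE (cut ε a) (cut δ b) := by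
  obtain ⟨δ, hδ, r, hr⟩ := h.exists_conj_cut hb hε
  exact ⟨δ, hδ, (CuntzLE.cut_of_norm_lt ha (star_right_conjugate_nonneg (cut_nonneg _ _) r) hr).trans
    (CuntzLE.conj _ _)⟩

/-- If `x ≤ Y* Y`, then `x = X* X` for some `X` in the closed right ideal generated by `Y`. -/
theorem exists_star_mul_self_eq_of_le {x Y : D} (hx : 0 ≤ x) (h : x ≤ star Y * Y) :
    ∃ X : D, star X * X = x ∧ X ∈ closure (Set.range fun d => Y * d) := by
  set S := star Y * Y with hSdef
  have hS : 0 ≤ S := hx.trans h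
  have hsa : IsSelfAdjoint S := .of_nonneg hS
  have hw : IsSelfAdjoint (CFC.sqrt x) := .of_nonneg (CFC.sqrt_nonneg x)
  -- These approximate `Y S^(-1/2) √x`, the polar part of `Y` applied to `√x`. The polar part itself
  -- need not exist in `D`, but the products converge.
  let u : ℕ → D := fun n => Y * (invSqrt (1 / ((n : ℝ) + 1)) S * CFC.sqrt x)
  have key : ∀ δ η : ℝ, 0 < δ → δ ≤ η → ‖Y * (invSqrt δ S * CFC.sqrt x) -
      Y * (invSqrt η S * CFC.sqrt x)‖ ≤ √η := by
    intro δ η hδ hδη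
    have hη : 0 < η := hδ.trans_le hδη
    have hcδ := continuous_invSqrtFun hδ
    have hcη := continuous_invSqrtFun hη
    have h0δ := invSqrtFun_zero δ
    have h0η := invSqrtFun_zero η
    set k := invSqrt δ S - invSqrt η S with hk
    have hksa : IsSelfAdjoint k := (isSelfAdjoint_invSqrt δ S).sub (isSelfAdjoint_invSqrt η S)
    have hkf : k = cfcₙ (fun s => invSqrtFun δ s - invSqrtFun η s) S := by
      rw [cfcₙ_sub _ _ S hcδ.continuousOn h0δ hcη.continuousOn h0η]; rfl
    rw [← mul_sub, ← sub_mul, ← hk]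
    apply Real.le_sqrt_of_sq_le
    rw [sq, ← CStarRing.norm_star_mul_self]
    -- `q` plays the role of `|Y| k`: by the C*-identity `‖Y k √x‖² = ‖q √x‖² = ‖q x q‖ ≤ ‖q S q‖`,
    -- and the last is a scalar estimate on the spectrum of `S`.
    set q := cfcₙ (fun s => √s * (invSqrtFun δ s - invSqrtFun η s)) S with hq
    have hqsa : IsSelfAdjoint q := cfcₙ_predicate _ S
    have hkSk : k * S * k = q * q := by
      rw [hkf, hq, ← cfcₙ_mul _ _ S (by fun_prop) (by simp) (by fun_prop) (by simp)]
      conv_lhs => enter [1, 2]; rw [← cfcₙ_id' ℝ S]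
      rw [← cfcₙ_mul _ _ S (by fun_prop) (by simp [h0δ, h0η]) (by fun_prop) rfl,
        ← cfcₙ_mul _ _ S (by fun_prop) (by simp) (by fun_prop) (by simp [h0δ, h0η])]
      refine cfcₙ_congr fun s hs => ?_
      have hs := spec_nonneg hS hs
      have := Real.mul_self_sqrt hs
      linear_combination (-(invSqrtFun δ s - invSqrtFun η s) ^ 2) * this
    have e1 : star (Y * (k * CFC.sqrt x)) * (Y * (k * CFC.sqrt x)) =
        star (q * CFC.sqrt x) * (q * CFC.sqrt x) := by
      rw [star_mul, star_mul, star_mul, hw.star_eq, hksa.star_eq, hqsa.star_eq]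
      calc _ = CFC.sqrt x * (k * (star Y * Y) * k) * CFC.sqrt x := by noncomm_ring
        _ = CFC.sqrt x * (q * q) * CFC.sqrt x := by rw [← hSdef, hkSk]
        _ = _ := by noncomm_ring
    have e2 : q * CFC.sqrt x * star (q * CFC.sqrt x) = q * x * q := by
      rw [star_mul, hw.star_eq, hqsa.star_eq]
      calc _ = q * (CFC.sqrt x * CFC.sqrt x) * q := by noncomm_ring
        _ = _ := by rw [CFC.sqrt_mul_sqrt_self x]
    rw [e1, CStarRing.norm_star_mul_self, ← CStarRing.norm_self_mul_star, e2]
    have h3 : q * x * q ≤ q * S * q := by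
      have := star_left_conjugate_le_conjugate h q
      rwa [hqsa.star_eq] at this
    have h4 : 0 ≤ q * x * q := by
      have := star_left_conjugate_nonneg hx q
      rwa [hqsa.star_eq] at this
    refine (CStarAlgebra.norm_le_norm_of_nonneg_of_le h4 h3).trans ?_
    have e3 : q * S * q = cfcₙ (fun s => (√s * (invSqrtFun δ s - invSqrtFun η s)) * s *
        (√s * (invSqrtFun δ s - invSqrtFun η s))) S := by
      rw [cfcₙ_mul _ _ S (by fun_prop) (by simp) (by fun_prop) (by simp),
        cfcₙ_mul _ (fun s => s) S (by fun_prop) (by simp) (by fun_prop) rfl, cfcₙ_id' ℝ S]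
    rw [e3]
    refine norm_cfcₙ_le fun s hs => ?_
    have hs := spec_nonneg hS hs
    have hss := Real.mul_self_sqrt hs
    have hd1 : 0 < s + δ := by positivity
    have hd2 : 0 < s + η := by positivity
    have e4 : (√s * (invSqrtFun δ s - invSqrtFun η s)) * s *
        (√s * (invSqrtFun δ s - invSqrtFun η s)) = s * (s / (s + δ) - s / (s + η)) ^ 2 := by
      unfold invSqrtFun
      rw [abs_of_nonneg hs]
      have : √s * (√s / (s + δ) - √s / (s + η)) = s / (s + δ) - s / (s + η) := by
        rw [mul_sub, ← mul_div_assoc, ← mul_div_assoc, hss]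
      rw [this]
      ring
    rw [e4, Real.norm_of_nonneg (by positivity)]
    have h5 : 0 ≤ s / (s + δ) - s / (s + η) :=
      sub_nonneg.2 (div_le_div_of_nonneg_left hs hd1 (by linarith))
    have h6 : s / (s + δ) - s / (s + η) ≤ η / (s + η) := by
      have a1 : s / (s + δ) ≤ 1 := by rw [div_le_one hd1]; linarith
      have a2 : s / (s + η) = 1 - η / (s + η) := by field_simp; ring
      linarith
    have h7 : (s / (s + δ) - s / (s + η)) ^ 2 ≤ (η / (s + η)) ^ 2 := pow_le_pow_left₀ h5 h6 2
    calc _ ≤ s * (η / (s + η)) ^ 2 := by gcongr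
      _ = s * η ^ 2 / (s + η) ^ 2 := by rw [div_pow, mul_div_assoc]
      _ ≤ η := by
        rw [div_le_iff₀ (by positivity)]
        nlinarith [mul_nonneg hs hη.le, mul_nonneg hη.le (sq_nonneg s), pow_pos hη 3,
          mul_nonneg hs (sq_nonneg η)]
  have hlim : Filter.Tendsto (fun n : ℕ => √(1 / ((n : ℝ) + 1))) Filter.atTop (nhds 0) := by
    have := (Real.continuous_sqrt.tendsto 0).comp tendsto_one_div_add_atTop_nhds_zero_nat
    rwa [Real.sqrt_zero] at this
  have hcau : CauchySeq u := by
    refine cauchySeq_of_le_tendsto_0' _ (fun n m hnm => ?_) hlim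
    rw [dist_eq_norm, norm_sub_rev]
    exact key _ _ (by positivity) (by gcongr)
  obtain ⟨X, hX⟩ := cauchySeq_tendsto_of_complete hcau
  refine ⟨X, ?_, ?_⟩
  · have h1 : Filter.Tendsto (fun n => star (u n) * u n) Filter.atTop (nhds (star X * X)) :=
      (hX.star).mul hX
    refine tendsto_nhds_unique h1 ?_
    rw [tendsto_iff_norm_sub_tendsto_zero]
    have hl2 : Filter.Tendsto (fun n : ℕ => √(1 / ((n : ℝ) + 1)) * ‖CFC.sqrt x‖) Filter.atTop
        (nhds 0) := by simpa using hlim.mul_const ‖CFC.sqrt x‖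
    refine squeeze_zero (fun _ => norm_nonneg _) (fun n => ?_) hl2
    have e := norm_sqrt_conj_sub_le (δ := 1 / ((n : ℝ) + 1)) (by positivity) hx h
    have e' : star (u n) * u n = CFC.sqrt x * (invSqrt (1 / ((n : ℝ) + 1)) S * S *
        invSqrt (1 / ((n : ℝ) + 1)) S) * CFC.sqrt x := by
      change star (Y * (invSqrt _ S * CFC.sqrt x)) * (Y * (invSqrt _ S * CFC.sqrt x)) = _
      rw [star_mul, star_mul, hw.star_eq, (isSelfAdjoint_invSqrt _ S).star_eq, hSdef]
      noncomm_ring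
    rwa [e']
  · exact mem_closure_of_tendsto hX (Filter.Eventually.of_forall fun n => ⟨_, rfl⟩)

/-- Exact form of Cuntz comparison for cut-downs. -/
theorem CuntzLE.exists_cut_eq {a b : D} (ha : 0 ≤ a) (hb : 0 ≤ b) (h : CuntzLE a b) {ε : ℝ}
    (hε : 0 < ε) : ∃ δ : ℝ, 0 < δ ∧ ∀ η : ℝ, 0 ≤ η → η ≤ δ → ∃ r : D,
      cut ε a = r * cut η b * star r := by
  obtain ⟨δ, hδ, r, hr⟩ := h.exists_conj_cut hb hε
  set c := cut δ b with hc
  have hc0 : 0 ≤ c := cut_nonneg _ _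
  have hsc : IsSelfAdjoint (CFC.sqrt c) := .of_nonneg (CFC.sqrt_nonneg c)
  obtain ⟨k, hk, hle⟩ := exists_cut_le_conj ha (star_right_conjugate_nonneg hc0 r) hr
  obtain ⟨X, hX, hXc⟩ := exists_star_mul_self_eq_of_le (x := cut ε a)
    (Y := CFC.sqrt c * star r * k) (cut_nonneg _ _) (by
      convert hle using 1
      rw [star_mul, star_mul, star_star, hk.star_eq, hsc.star_eq]
      calc _ = k * (r * (CFC.sqrt c * CFC.sqrt c) * star r) * k := by noncomm_ring
        _ = _ := by rw [CFC.sqrt_mul_sqrt_self c])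
  have hsb : IsSelfAdjoint b := .of_nonneg hb
  refine ⟨δ / 4, by positivity, fun η hη0 hη => ?_⟩
  -- `p` vanishes up to `δ/2` and is `1` from `δ` on. Thus `p(b)` is a unit for `(b - δ)₊`, and for
  -- `η ≤ δ/4` it factors as `q(b) (b - η)₊ q(b)`, because `x - η ≥ δ/4` where `p` is nonzero.
  let p : ℝ → ℝ := fun x => min (max (x - δ / 2) 0 / (δ / 2)) 1
  let q : ℝ → ℝ := fun x => √(p x / max (x - η) (δ / 4))
  have hm : ∀ x : ℝ, 0 < max (x - η) (δ / 4) := fun x =>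
    lt_of_lt_of_le (by positivity) (le_max_right _ _)
  have hp : Continuous p := by fun_prop
  have hp0 : p 0 = 0 := by
    have : max (0 - δ / 2) 0 = 0 := max_eq_right (by linarith)
    simp only [p, this]
    simp
  have hpn : ∀ x, 0 ≤ p x := fun x => le_min (by positivity) zero_le_one
  have hq : Continuous q := Continuous.sqrt (Continuous.div hp (by fun_prop) fun x => (hm x).ne')
  have hq0 : q 0 = 0 := by simp [q, hp0]
  have hqsa : IsSelfAdjoint (cfcₙ q b) := cfcₙ_predicate _ b
  have hpsa : IsSelfAdjoint (cfcₙ p b) := cfcₙ_predicate _ b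
  have hqq : cfcₙ q b * cut η b * cfcₙ q b = cfcₙ p b := by
    unfold cut
    rw [← cfcₙ_mul _ _ b (by fun_prop) hq0 (by fun_prop) (by simpa using hη0),
      ← cfcₙ_mul _ _ b (by fun_prop) (by simp [hq0]) (by fun_prop) hq0]
    refine cfcₙ_congr fun x _ => ?_
    have e1 : q x * q x = p x / max (x - η) (δ / 4) :=
      Real.mul_self_sqrt (div_nonneg (hpn x) (hm x).le)
    have e2 : q x * max (x - η) 0 * q x = (q x * q x) * max (x - η) 0 := by ring
    change q x * max (x - η) 0 * q x = p x
    rw [e2, e1]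
    rcases le_total x (δ / 2) with hx | hx
    · have h1 : p x = 0 := by
        have : max (x - δ / 2) 0 = 0 := max_eq_right (by linarith)
        simp only [p, this]
        simp
      rw [h1]; simp
    · have h1 : max (x - η) 0 = x - η := max_eq_left (by linarith)
      have hpos : 0 < x - η := by linarith
      rw [h1, max_eq_left (show δ / 4 ≤ x - η by linarith)]
      field_simp
  have hpc : cfcₙ p b * c = c := by
    rw [hc, cut, ← cfcₙ_mul _ _ b (by fun_prop) hp0 (by fun_prop) (by simpa using hδ.le)]
    refine cfcₙ_congr fun x _ => ?_
    change p x * max (x - δ) 0 = max (x - δ) 0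
    rcases le_total x δ with hx | hx
    · rw [max_eq_right (by linarith)]; simp
    · have : p x = 1 := by
        refine min_eq_right ?_
        rw [le_div_iff₀ (by positivity)]
        exact le_max_of_le_left (by linarith)
      rw [this, one_mul]
  have hpsc : cfcₙ p b * CFC.sqrt c = CFC.sqrt c := by
    rw [← sub_eq_zero, ← CStarRing.mul_star_self_eq_zero_iff, star_sub, star_mul, hsc.star_eq,
      hpsa.star_eq]
    calc _ = cfcₙ p b * (CFC.sqrt c * CFC.sqrt c) * cfcₙ p b - cfcₙ p b * (CFC.sqrt c * CFC.sqrt c)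
          - (CFC.sqrt c * CFC.sqrt c) * cfcₙ p b + CFC.sqrt c * CFC.sqrt c := by noncomm_ring
      _ = 0 := by rw [CFC.sqrt_mul_sqrt_self c, hpc]; abel
  -- `X` lies in the closed right ideal generated by `√c r* k`, and `p(b)` fixes `√c`. Hence `X* X =
  -- X* p(b) X`, into which the factorisation of `p(b)` is inserted.
  have hpX : cfcₙ p b * X = X := by
    have hcl : IsClosed {X : D | cfcₙ p b * X = X} := isClosed_eq (by fun_prop) continuous_id
    refine closure_minimal ?_ hcl hXc
    rintro _ ⟨d, rfl⟩
    change cfcₙ p b * (CFC.sqrt c * star r * k * d) = CFC.sqrt c * star r * k * d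
    simp only [← mul_assoc]
    rw [hpsc]
  refine ⟨star X * cfcₙ q b, ?_⟩
  rw [star_mul, star_star, hqsa.star_eq, ← hX]
  calc star X * X = star X * (cfcₙ p b * X) := by rw [hpX]
    _ = star X * ((cfcₙ q b * cut η b * cfcₙ q b) * X) := by rw [hqq]
    _ = _ := by noncomm_ring

end CuntzComparison

end CuntzSemigroup
end


noncomputable section

namespace CuntzSemigroup

/-! ### Row relabellings of finite matrices and the corner embedding. -/

namespace FinMat

section Row

variable {A : Type*}

/-- Relabelling of the rows along `f`: left multiplication by the isometry `e_i ↦ e_{f i}`. -/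
def row [Zero A] (f : ℕ ↪ ℕ) (M : FinMat A) : FinMat A where
  entry := Function.extend f M.entry 0
  exists_bound := by
    obtain ⟨n, hn⟩ := M.exists_bound
    refine ⟨(Finset.range n).sup f + 1 + n, fun i j h => ?_⟩
    by_cases hi : ∃ a, f a = i
    · obtain ⟨a, rfl⟩ := hi
      rw [f.injective.extend_apply]
      refine hn a j (h.imp (fun ha => ?_) fun hj => by omega)
      by_contra hlt
      have := Finset.le_sup (f := f) (Finset.mem_range.2 (not_le.1 hlt))
      omega
    · rw [Function.extend_apply' _ _ _ hi]
      rfl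

theorem row_apply [Zero A] (f : ℕ ↪ ℕ) (M : FinMat A) (a j : ℕ) :
    (row f M).entry (f a) j = M.entry a j :=
  congrFun (f.injective.extend_apply _ _ a) j

theorem row_apply' [Zero A] (f : ℕ ↪ ℕ) (M : FinMat A) {i : ℕ} (hi : ¬ ∃ a, f a = i) (j : ℕ) :
    (row f M).entry i j = 0 :=
  congrFun (Function.extend_apply' _ _ _ hi) j

theorem ext_entry [Zero A] {M N : FinMat A} (h : ∀ i j, M.entry i j = N.entry i j) : M = N :=
  entry_injective (funext fun i => funext fun j => h i j)

theorem row_add [AddCommGroup A] (f : ℕ ↪ ℕ) (M N : FinMat A) :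
    row f (M + N) = row f M + row f N := by
  refine ext_entry fun i j => ?_
  change _ = (row f M).entry i j + (row f N).entry i j
  by_cases hi : ∃ a, f a = i
  · obtain ⟨a, rfl⟩ := hi
    simp only [row_apply]
    rfl
  · simp only [row_apply' f _ hi, add_zero]

theorem row_mul [NonUnitalRing A] (f : ℕ ↪ ℕ) (M N : FinMat A) :
    row f M * N = row f (M * N) := by
  refine ext_entry fun i j => ?_
  change ∑ᶠ k, (row f M).entry i k * N.entry k j = _
  by_cases hi : ∃ a, f a = i
  · obtain ⟨a, rfl⟩ := hi
    simp only [row_apply]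
    rfl
  · simp only [row_apply' f _ hi, zero_mul, finsum_zero]

/-- Write `V_f` for the isometry `e_i ↦ e_{f i}`, which acts on `M_∞(A)` as a multiplier; this is
`V_f* V_f = 1`. -/
theorem star_row_mul_row [NonUnitalRing A] [StarRing A] (f : ℕ ↪ ℕ) (M N : FinMat A) :
    star (row f M) * row f N = star M * N := by
  refine ext_entry fun i j => ?_
  change ∑ᶠ k, star ((row f M).entry k i) * (row f N).entry k j =
    ∑ᶠ k, star (M.entry k i) * N.entry k j
  rw [← finsum_mem_univ (fun k => star (M.entry k i) * N.entry k j),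
    ← finsum_mem_univ (fun k => star ((row f M).entry k i) * (row f N).entry k j)]
  rw [← finsum_mem_inter_support_eq (fun k => star ((row f M).entry k i) * (row f N).entry k j)
    (Set.range f) Set.univ]
  · rw [finsum_mem_range f.injective, finsum_mem_univ]
    simp only [row_apply]
  · ext k
    simp only [Set.mem_inter_iff, Set.mem_range, Function.mem_support, Set.mem_univ, true_and,
      and_iff_right_iff_imp]
    intro hk
    by_contra hcon
    exact hk (by rw [row_apply' f N hcon, mul_zero])

/-- Isometries with orthogonal ranges: `V_f* V_g = 0`. -/
theorem star_row_mul_row_of_ne [NonUnitalRing A] [StarRing A] {f g : ℕ ↪ ℕ}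
    (h : ∀ i j, f i ≠ g j) (M N : FinMat A) : star (row f M) * row g N = 0 := by
  refine ext_entry fun i j => ?_
  refine finsum_eq_zero_of_forall_eq_zero fun k => ?_
  change star ((row f M).entry k i) * (row g N).entry k j = 0
  by_cases hk : ∃ a, f a = k
  · obtain ⟨a, rfl⟩ := hk
    rw [row_apply' g N fun ⟨b, hb⟩ => h a b hb.symm, mul_zero]
  · rw [row_apply' f M hk, star_zero, zero_mul]

/-- Both sides are `V_f M* V_g*`: left multiplication by `V_f` commutes with right multiplication by
`V_g*`. -/
theorem star_row_star_row [NonUnitalRing A] [StarRing A] (f g : ℕ ↪ ℕ) (M : FinMat A) :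
    star (row g (star (row f (star M)))) = row f (star (row g M)) := by
  refine ext_entry fun i j => ?_
  change star ((row g (star (row f (star M)))).entry j i) = _
  by_cases hi : ∃ a, f a = i <;> by_cases hj : ∃ b, g b = j
  · obtain ⟨a, rfl⟩ := hi
    obtain ⟨b, rfl⟩ := hj
    rw [row_apply, row_apply]
    change star (star ((row f (star M)).entry (f a) b)) = star ((row g M).entry (g b) a)
    rw [row_apply, row_apply, star_star]
    rfl
  · obtain ⟨a, rfl⟩ := hi
    rw [row_apply, row_apply' g _ hj]
    change _ = star ((row g M).entry j a)
    rw [row_apply' g _ hj]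
  · obtain ⟨b, rfl⟩ := hj
    rw [row_apply, row_apply' f _ hi]
    change star (star ((row f (star M)).entry i b)) = 0
    rw [row_apply' f _ hi, star_zero, star_zero]
  · rw [row_apply' g _ hj, row_apply' f _ hi, star_zero]

theorem relabel_eq_row [NonUnitalRing A] [StarRing A] [Module ℂ A] (f : ℕ ↪ ℕ) (M : FinMat A) :
    relabel f M = row f (star (row f (star M))) := by
  refine (entry_injective (eq_extendMat f M.entry _ (fun a b => ?_) (fun i j h => ?_)
    fun i j h => ?_)).symm
  · rw [row_apply]
    change star ((row f (star M)).entry (f b) a) = _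
    rw [row_apply]
    exact star_star _
  · exact row_apply' f _ h j
  · by_cases hi : ∃ a, f a = i
    · obtain ⟨a, rfl⟩ := hi
      rw [row_apply]
      change star ((row f (star M)).entry j a) = 0
      rw [row_apply' f _ h, star_zero]
    · exact row_apply' f _ hi j

end Row

section Single

variable {A B : Type*}

theorem finsum_eq_of_ne_zero {A : Type*} [AddCommMonoid A] (u : ℕ → A) (h : ∀ k, k ≠ 0 → u k = 0) :
    ∑ᶠ k, u k = u 0 :=
  finsum_eq_single u 0 h

/-- The matrix with the entry `a` in the upper left corner and zeros elsewhere. -/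
def single [NonUnitalRing A] [StarRing A] [Module ℂ A] : A →⋆ₙₐ[ℂ] FinMat A where
  toFun a := ⟨fun i j => if i = 0 ∧ j = 0 then a else 0, 1, fun i j h =>
    if_neg (by omega)⟩
  map_smul' c a := ext_entry fun i j => by
    change (if i = 0 ∧ j = 0 then c • a else 0) = c • (if i = 0 ∧ j = 0 then a else 0)
    split_ifs <;> simp
  map_zero' := ext_entry fun i j => by
    change (if i = 0 ∧ j = 0 then (0 : A) else 0) = 0
    simp
  map_add' a b := ext_entry fun i j => by
    change (if i = 0 ∧ j = 0 then a + b else 0) =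
      (if i = 0 ∧ j = 0 then a else 0) + (if i = 0 ∧ j = 0 then b else 0)
    split_ifs <;> simp
  map_mul' a b := ext_entry fun i j => by
    change (if i = 0 ∧ j = 0 then a * b else 0) =
      ∑ᶠ k, (if i = 0 ∧ k = 0 then a else 0) * (if k = 0 ∧ j = 0 then b else 0)
    rw [finsum_eq_of_ne_zero _ fun k hk => by simp [hk]]
    by_cases hi : i = 0 <;> by_cases hj : j = 0 <;> simp [hi, hj]
  map_star' a := ext_entry fun i j => by
    change (if i = 0 ∧ j = 0 then star a else 0) = star (if j = 0 ∧ i = 0 then a else 0)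
    by_cases hi : i = 0 <;> by_cases hj : j = 0 <;> simp [hi, hj]

theorem single_apply_zero [NonUnitalRing A] [StarRing A] [Module ℂ A] (a : A) :
    (single a).entry 0 0 = a := by
  change (if (0 : ℕ) = 0 ∧ (0 : ℕ) = 0 then a else 0) = a
  simp

/-- Compression to the corner turns a conjugation in `M_∞(A)` into one in `A`; this brings Cuntz
comparison back from `A ⊗ K` to `A`. -/
theorem conj_single_apply_zero [NonUnitalRing A] [StarRing A] [Module ℂ A] (R : FinMat A) (b : A) :
    (R * single b * star R).entry 0 0 = R.entry 0 0 * b * star (R.entry 0 0) := by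
  have h1 : ∀ i, ∀ j, (R * single b).entry i j = if j = 0 then R.entry i 0 * b else 0 := by
    intro i j
    change ∑ᶠ k, R.entry i k * (if k = 0 ∧ j = 0 then b else 0) = _
    rw [finsum_eq_of_ne_zero _ fun k hk => by simp [hk]]
    by_cases hj : j = 0 <;> simp [hj]
  change ∑ᶠ k, (R * single b).entry 0 k * star (R.entry 0 k) = _
  rw [finsum_eq_of_ne_zero _ fun k hk => by simp [h1, hk], h1, if_pos rfl]

variable [NonUnitalCStarAlgebra A] [PartialOrder A] [StarOrderedRing A]
  [NonUnitalCStarAlgebra B] [PartialOrder B] [StarOrderedRing B]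

theorem norm_entry_le (M : FinMat A) (i j : ℕ) : ‖M.entry i j‖ ≤ ‖M‖ := by
  obtain ⟨n, hM⟩ := M.exists_bound
  have hM : M.SuppIn n := hM
  have hM' := hM.mono (show n ≤ n + i + j + 1 by omega)
  rw [norm_eq hM']
  exact CStarMatrix.norm_entry_le_norm (M := M.corner (n + i + j + 1)) (i := ⟨i, by omega⟩)
    (j := ⟨j, by omega⟩)

theorem mapHom_single (φ : A →⋆ₙₐ[ℂ] B) (a : A) : mapHom φ (single a) = single (φ a) := by
  refine ext_entry fun i j => ?_
  change φ (if i = 0 ∧ j = 0 then a else 0) = if i = 0 ∧ j = 0 then φ a else 0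
  split_ifs <;> simp

theorem norm_row (f : ℕ ↪ ℕ) (M : FinMat A) : ‖row f M‖ = ‖M‖ := by
  have h := CStarRing.norm_star_mul_self (x := row f M)
  rw [star_row_mul_row, CStarRing.norm_star_mul_self] at h
  exact (mul_self_inj (norm_nonneg _) (norm_nonneg _)).1 h.symm

theorem isometry_row (f : ℕ ↪ ℕ) : Isometry (row f : FinMat A → FinMat A) :=
  AddMonoidHomClass.isometry_of_norm (AddMonoidHom.mk' (row f) (row_add f)) (norm_row f)

end Single

end FinMat

open CStarCompletion

variable {A B : Type*} [NonUnitalCStarAlgebra A] [PartialOrder A] [StarOrderedRing A]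
  [NonUnitalCStarAlgebra B] [PartialOrder B] [StarOrderedRing B]

/-! ### Isometries acting on the stabilisation, and orthogonal sums. -/

namespace Stab

instance : PartialOrder (Stab A) := CStarAlgebra.spectralOrder _

instance : StarOrderedRing (Stab A) := CStarAlgebra.spectralOrderedRing _

/-- Relabelling of the rows. -/
def row (f : ℕ ↪ ℕ) : Stab A → Stab A := liftFun (FinMat.row f)

theorem continuous_row (f : ℕ ↪ ℕ) : Continuous (row f : Stab A → Stab A) :=
  continuous_liftFun _

theorem row_of (f : ℕ ↪ ℕ) (M : FinMat A) : row f (of _ M) = of _ (FinMat.row f M) :=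
  UniformSpace.Completion.map_coe (FinMat.isometry_row f).uniformContinuous M

theorem row_mul (f : ℕ ↪ ℕ) (x y : Stab A) : row f x * y = row f (x * y) := by
  refine induction₂ (p := fun x y => row f x * y = row f (x * y)) x y
    (isClosed_eq (((continuous_row f).comp continuous_fst).mul continuous_snd)
      ((continuous_row f).comp continuous_mul)) fun M N => ?_
  rw [row_of, ← of_mul, ← of_mul, row_of, FinMat.row_mul]

theorem star_row_mul_row (f : ℕ ↪ ℕ) (x y : Stab A) : star (row f x) * row f y = star x * y := by
  refine induction₂ (p := fun x y => star (row f x) * row f y = star x * y) x y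
    (isClosed_eq ((continuous_star.comp ((continuous_row f).comp continuous_fst)).mul
      ((continuous_row f).comp continuous_snd))
      ((continuous_star.comp continuous_fst).mul continuous_snd)) fun M N => ?_
  rw [row_of, row_of, ← of_star, ← of_star, ← of_mul, ← of_mul, FinMat.star_row_mul_row]

theorem star_row_mul_row_of_ne {f g : ℕ ↪ ℕ} (h : ∀ i j, f i ≠ g j) (x y : Stab A) :
    star (row f x) * row g y = 0 := by
  refine induction₂ (p := fun x y => star (row f x) * row g y = 0) x y
    (isClosed_eq ((continuous_star.comp ((continuous_row f).comp continuous_fst)).mul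
      ((continuous_row g).comp continuous_snd)) continuous_const) fun M N => ?_
  rw [row_of, row_of, ← of_star, ← of_mul, FinMat.star_row_mul_row_of_ne h, map_zero]

theorem star_row_star_row (f g : ℕ ↪ ℕ) (x : Stab A) :
    star (row g (star (row f (star x)))) = row f (star (row g x)) := by
  have hf := continuous_row (A := A) f
  have hg := continuous_row (A := A) g
  refine induction (p := fun x => star (row g (star (row f (star x)))) = row f (star (row g x))) x
    (isClosed_eq (by fun_prop) (by fun_prop)) fun M => ?_
  rw [← of_star, row_of, ← of_star, row_of, ← of_star, row_of, ← of_star, row_of,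
    FinMat.star_row_star_row]

theorem relabel_eq_row (f : ℕ ↪ ℕ) (x : Stab A) :
    relabel f x = row f (star (row f (star x))) := by
  have hf := continuous_row (A := A) f
  refine induction (p := fun x => relabel f x = row f (star (row f (star x)))) x
    (isClosed_eq (continuous_relabel f) (by fun_prop)) fun M => ?_
  rw [relabel_of, ← of_star, row_of, ← of_star, row_of, FinMat.relabel_eq_row]

theorem norm_row (f : ℕ ↪ ℕ) (x : Stab A) : ‖row f x‖ = ‖x‖ := by
  have h := CStarRing.norm_star_mul_self (x := row f x)
  rw [star_row_mul_row, CStarRing.norm_star_mul_self] at h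
  exact (mul_self_inj (norm_nonneg _) (norm_nonneg _)).1 h.symm

/-- The matrix with rows relabelled along `g` and columns relabelled along `f`. -/
def relabel₂ (g f : ℕ ↪ ℕ) (x : Stab A) : Stab A := row g (star (row f (star x)))

theorem star_relabel₂ (g f : ℕ ↪ ℕ) (x : Stab A) :
    star (relabel₂ g f x) = relabel₂ f g (star x) := by
  rw [relabel₂, star_row_star_row, relabel₂, star_star]

/-- With the isometries `V`, this is `V_g x V_f* V_f y V_h* = V_g x y V_h*`. -/
theorem relabel₂_mul_relabel₂ (g f h : ℕ ↪ ℕ) (x y : Stab A) :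
    relabel₂ g f x * relabel₂ f h y = relabel₂ g h (x * y) := by
  have e : star (row h (star (x * y))) = x * star (row h (star y)) := by
    rw [star_mul, ← row_mul, star_mul, star_star]
  rw [relabel₂, row_mul, relabel₂, star_row_mul_row, star_star, relabel₂, e]

theorem relabel₂_mul_relabel₂_of_ne {f f' : ℕ ↪ ℕ} (hf : ∀ i j, f i ≠ f' j) (g h : ℕ ↪ ℕ)
    (x y : Stab A) : relabel₂ g f x * relabel₂ f' h y = 0 := by
  have h0 : row g (0 : Stab A) = 0 := by
    have := norm_row g (0 : Stab A)
    rwa [norm_zero, norm_eq_zero] at this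
  rw [relabel₂, row_mul, relabel₂, star_row_mul_row_of_ne hf, h0]

/-- Orthogonal sums do not depend on the relabellings, up to Cuntz equivalence. -/
theorem cuntzLE_sum_relabel {ι : Type*} [Fintype ι] [DecidableEq ι] (f g : ι → (ℕ ↪ ℕ))
    (hf : ∀ i j, i ≠ j → ∀ a b, f i a ≠ f j b) (x : ι → Stab A) :
    CuntzLE (∑ i, relabel (g i) (x i)) (∑ i, relabel (f i) (x i)) := by
  intro ε hε
  have hc : (0 : ℝ) < ε / (Fintype.card ι + 1) := by positivity
  choose p hp using fun i => CuntzLE.refl (x i) _ hc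
  -- Here `p i` conjugates `x i` to nearly itself. The conjugating element moves block `f i` to
  -- block `g i`, and the mixed terms vanish because the ranges of the `f i` are disjoint.
  refine ⟨∑ i, relabel₂ (g i) (f i) (p i), ?_⟩
  have hr : ∀ (f : ℕ ↪ ℕ) (x : Stab A), relabel f x = relabel₂ f f x := relabel_eq_row
  have e1 : (∑ i, relabel₂ (g i) (f i) (p i)) * (∑ i, relabel (f i) (x i)) =
      ∑ i, relabel₂ (g i) (f i) (p i * x i) := by
    rw [Finset.sum_mul_sum]
    refine Finset.sum_congr rfl fun i _ => ?_
    rw [Finset.sum_eq_single i]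
    · rw [hr, relabel₂_mul_relabel₂]
    · intro j _ hj
      rw [hr, relabel₂_mul_relabel₂_of_ne (hf i j hj.symm)]
    · simp
  have e2 : (∑ i, relabel₂ (g i) (f i) (p i * x i)) * star (∑ i, relabel₂ (g i) (f i) (p i)) =
      ∑ i, relabel (g i) (p i * x i * star (p i)) := by
    rw [star_sum, Finset.sum_mul_sum]
    refine Finset.sum_congr rfl fun i _ => ?_
    rw [Finset.sum_eq_single i]
    · rw [star_relabel₂, relabel₂_mul_relabel₂, hr]
    · intro j _ hj
      rw [star_relabel₂, relabel₂_mul_relabel₂_of_ne (hf i j hj.symm)]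
    · simp
  rw [e1, e2, ← Finset.sum_sub_distrib]
  calc _ ≤ ∑ i, ‖relabel (g i) (p i * x i * star (p i)) - relabel (g i) (x i)‖ := norm_sum_le _ _
    _ ≤ ∑ i : ι, ε / (Fintype.card ι + 1) := by
        refine Finset.sum_le_sum fun i _ => ?_
        rw [← map_sub]
        exact (NonUnitalStarAlgHom.norm_apply_le _ _).trans (hp i).le
    _ = Fintype.card ι * ε / (Fintype.card ι + 1) := by
        rw [Finset.sum_const, Finset.card_univ, nsmul_eq_mul, mul_div_assoc]
    _ < ε := by
        rw [div_lt_iff₀ (by positivity)]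
        nlinarith

theorem relabel_relabel (f g : ℕ ↪ ℕ) (x : Stab A) :
    relabel f (relabel g x) = relabel (g.trans f) x := by
  refine induction x (isClosed_eq ((continuous_relabel f).comp (continuous_relabel g))
    (continuous_relabel _)) fun M => ?_
  change relabel f (relabel g (of _ M)) = relabel (g.trans f) (of _ M)
  rw [relabel_of, relabel_of, relabel_of]
  congr 1
  refine FinMat.entry_injective (FinMat.eq_extendMat (g.trans f) M.entry _ (fun a b => ?_)
    (fun i j h => ?_) fun i j h => ?_)
  · exact (FinMat.extendMat_apply f _ _ _).trans (FinMat.extendMat_apply g _ _ _)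
  · by_cases hi : ∃ a, f a = i
    · by_cases hj : ∃ a, f a = j
      · obtain ⟨a, rfl⟩ := hi
        obtain ⟨b, rfl⟩ := hj
        refine (FinMat.extendMat_apply f _ _ _).trans (FinMat.extendMat_left g _ ?_ _)
        rintro ⟨c, rfl⟩
        exact h ⟨c, rfl⟩
      · exact FinMat.extendMat_right f _ _ hj
    · exact FinMat.extendMat_left f _ hi _
  · by_cases hi : ∃ a, f a = i
    · by_cases hj : ∃ a, f a = j
      · obtain ⟨a, rfl⟩ := hi
        obtain ⟨b, rfl⟩ := hj
        refine (FinMat.extendMat_apply f _ _ _).trans (FinMat.extendMat_right g _ _ ?_)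
        rintro ⟨c, rfl⟩
        exact h ⟨c, rfl⟩
      · exact FinMat.extendMat_right f _ _ hj
    · exact FinMat.extendMat_left f _ hi _

theorem relabel_refl (x : Stab A) : relabel (Function.Embedding.refl ℕ) x = x := by
  refine induction (p := fun x => relabel (Function.Embedding.refl ℕ) x = x) x
    (isClosed_eq (continuous_relabel _) continuous_id) fun M => ?_
  rw [relabel_of]
  congr 1
  exact (FinMat.entry_injective (FinMat.eq_extendMat (Function.Embedding.refl ℕ) M.entry M.entry
    (fun a b => rfl) (fun i j h => (h ⟨i, rfl⟩).elim) fun i j h => (h ⟨j, rfl⟩).elim)).symm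

theorem even_apply (i : ℕ) : even i = 2 * i := rfl

theorem odd_apply (i : ℕ) : odd i = 2 * i + 1 := rfl

/-- The embedding of `A` as the upper left corner of `A ⊗ K`. -/
def corner : A →⋆ₙₐ[ℂ] Stab A where
  toFun a := of _ (FinMat.single a)
  map_smul' c a := by rw [map_smul]; exact map_smul _ _ _
  map_zero' := by rw [map_zero, map_zero]
  map_add' a b := by rw [map_add, map_add]
  map_mul' a b := by rw [map_mul, of_mul]
  map_star' a := by rw [map_star, of_star]

theorem map_corner (φ : A →⋆ₙₐ[ℂ] B) (a : A) : map φ (corner a) = corner (φ a) := by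
  change map φ (of _ (FinMat.single a)) = of _ (FinMat.single (φ a))
  rw [map_of, FinMat.mapHom_single]

/-- The conjugating element may be taken to be a finite matrix by density; its upper left entry then
does the job in `A`, since entries are bounded by the norm. -/
theorem cuntzLE_of_corner {a b : A} (h : CuntzLE (corner a) (corner b)) : CuntzLE a b := by
  intro ε hε
  obtain ⟨r, hr⟩ := h ε hε
  have ho : IsOpen {r : Stab A | ‖r * corner b * star r - corner a‖ < ε} :=
    isOpen_lt (by fun_prop) continuous_const
  obtain ⟨R, hR⟩ := (isDenseInducing_of (α := FinMat A)).dense.exists_mem_open ho ⟨r, hr⟩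
  refine ⟨R.entry 0 0, lt_of_le_of_lt ?_ hR⟩
  have e : of _ R * corner b * star (of _ R) - corner a =
      of _ (R * FinMat.single b * star R - FinMat.single a) := by
    rw [map_sub, of_mul, of_mul, of_star]
    rfl
  rw [e, (of (FinMat A)).norm_map]
  have h := FinMat.norm_entry_le (R * FinMat.single b * star R - FinMat.single a) 0 0
  change ‖(R * FinMat.single b * star R).entry 0 0 - (FinMat.single a).entry 0 0‖ ≤ _ at h
  rwa [FinMat.conj_single_apply_zero, FinMat.single_apply_zero] at h

end Stab

/-! ### `Cu(A)` as an ordered commutative monoid. -/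

namespace Cu

theorem mk_eq_mk {x y : PosStab A} (h1 : CuntzLE x.val y.val) (h2 : CuntzLE y.val x.val) :
    mk x = mk y := le_antisymm (mk_le_mk.2 h1) (mk_le_mk.2 h2)

theorem exists_mk (s : Cu A) : ∃ x, mk x = s := Quotient.exists_rep s

theorem zero_le (s : Cu A) : 0 ≤ s := by
  obtain ⟨x, rfl⟩ := exists_mk s
  exact CuntzLE.zero x.val

theorem add_le_add' {s s' t t' : Cu A} (h1 : s ≤ s') (h2 : t ≤ t') : s + t ≤ s' + t' := by
  obtain ⟨x, rfl⟩ := exists_mk s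
  obtain ⟨y, rfl⟩ := exists_mk t
  obtain ⟨x', rfl⟩ := exists_mk s'
  obtain ⟨y', rfl⟩ := exists_mk t'
  exact PosStab.dsum_le_dsum h1 h2

/-- Both bracketings are sums of `x`, `y`, `z` relabelled along three injections with disjoint
ranges, so `Stab.cuntzLE_sum_relabel` applies in both directions. -/
theorem cuntzLE_dsum_dsum {x y z : Stab A} : 
    CuntzLE (Stab.dsum (Stab.dsum x y) z) (Stab.dsum x (Stab.dsum y z)) ∧
    CuntzLE (Stab.dsum x (Stab.dsum y z)) (Stab.dsum (Stab.dsum x y) z) := by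
  let f : Fin 3 → (ℕ ↪ ℕ) := ![Stab.even.trans Stab.even, Stab.odd.trans Stab.even, Stab.odd]
  let g : Fin 3 → (ℕ ↪ ℕ) := ![Stab.even, Stab.even.trans Stab.odd, Stab.odd.trans Stab.odd]
  have hf : ∀ i j, i ≠ j → ∀ a b, f i a ≠ f j b := by
    intro i j hij a b h
    fin_cases i <;> fin_cases j <;> first | exact hij rfl | skip
    all_goals simp [f, Stab.even_apply, Stab.odd_apply] at h; omega
  have hg : ∀ i j, i ≠ j → ∀ a b, g i a ≠ g j b := by
    intro i j hij a b h
    fin_cases i <;> fin_cases j <;> first | exact hij rfl | skip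
    all_goals simp [g, Stab.even_apply, Stab.odd_apply] at h; omega
  have e1 : Stab.dsum (Stab.dsum x y) z = ∑ i, Stab.relabel (f i) (![x, y, z] i) := by
    simp only [Stab.dsum, _root_.map_add, Stab.relabel_relabel, Fin.sum_univ_three]
    rfl
  have e2 : Stab.dsum x (Stab.dsum y z) = ∑ i, Stab.relabel (g i) (![x, y, z] i) := by
    simp only [Stab.dsum, _root_.map_add, Stab.relabel_relabel, Fin.sum_univ_three, ← add_assoc]
    rfl
  rw [e1, e2]
  exact ⟨Stab.cuntzLE_sum_relabel g f hg _, Stab.cuntzLE_sum_relabel f g hf _⟩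

theorem cuntzLE_dsum_comm (x y : Stab A) : CuntzLE (Stab.dsum x y) (Stab.dsum y x) := by
  have h := Stab.cuntzLE_sum_relabel (A := A) ![Stab.odd, Stab.even] ![Stab.even, Stab.odd]
    (by
      intro i j hij a b h
      fin_cases i <;> fin_cases j <;> first | exact hij rfl | skip
      all_goals simp [Stab.even_apply, Stab.odd_apply] at h; omega) ![x, y]
  rw [Fin.sum_univ_two, Fin.sum_univ_two] at h
  rw [Stab.dsum, Stab.dsum, add_comm (Stab.relabel Stab.even y)]
  exact h

theorem cuntzLE_relabel (f g : ℕ ↪ ℕ) (x : Stab A) :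
    CuntzLE (Stab.relabel f x) (Stab.relabel g x) := by
  have h := Stab.cuntzLE_sum_relabel (A := A) (ι := Unit) (fun _ => g) (fun _ => f)
    (fun i j h => (h rfl).elim) fun _ => x
  simpa using h

theorem add_zero' (s : Cu A) : s + 0 = s := by
  obtain ⟨x, rfl⟩ := exists_mk s
  have e : Stab.dsum x.val 0 = Stab.relabel Stab.even x.val := by
    rw [Stab.dsum, _root_.map_zero, add_zero]
  refine mk_eq_mk ?_ ?_
  · change CuntzLE (Stab.dsum x.val 0) x.val
    have := cuntzLE_relabel Stab.even (Function.Embedding.refl ℕ) x.val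
    rwa [Stab.relabel_refl, ← e] at this
  · change CuntzLE x.val (Stab.dsum x.val 0)
    have := cuntzLE_relabel (Function.Embedding.refl ℕ) Stab.even x.val
    rwa [Stab.relabel_refl, ← e] at this

theorem add_comm' (s t : Cu A) : s + t = t + s := by
  obtain ⟨x, rfl⟩ := exists_mk s
  obtain ⟨y, rfl⟩ := exists_mk t
  exact mk_eq_mk (cuntzLE_dsum_comm _ _) (cuntzLE_dsum_comm _ _)

theorem add_assoc' (s t u : Cu A) : s + t + u = s + (t + u) := by
  obtain ⟨x, rfl⟩ := exists_mk s
  obtain ⟨y, rfl⟩ := exists_mk t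
  obtain ⟨z, rfl⟩ := exists_mk u
  exact mk_eq_mk cuntzLE_dsum_dsum.1 cuntzLE_dsum_dsum.2

instance : AddCommMonoid (Cu A) where
  add_assoc := add_assoc'
  zero_add s := by rw [add_comm', add_zero']
  add_zero := add_zero'
  add_comm := add_comm'
  nsmul := nsmulRec

end Cu

end CuntzSemigroup
end


noncomputable section

namespace CuntzSemigroup

open CStarCompletion

variable {A : Type*} [NonUnitalCStarAlgebra A] [PartialOrder A] [StarOrderedRing A]

/-! ### Vectors attached to a chain of exact comparisons. -/

section Gram

variable {D : Type*} [NonUnitalCStarAlgebra D] [PartialOrder D] [StarOrderedRing D]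

/-- For a chain `y n = r n * y (n + 1) * (r n)*`, the adjoint of the image in `D` of the generator
`√(y i)` under the composition of `k` connecting maps. -/
def chainVec (y r : ℕ → D) : ℕ → ℕ → D
  | i, 0 => CFC.sqrt (y i)
  | i, k + 1 => r i * chainVec y r (i + 1) k

variable {y r : ℕ → D}

theorem chainVec_zero_mul_star (hy : ∀ n, 0 ≤ y n) (i : ℕ) :
    chainVec y r i 0 * star (chainVec y r i 0) = y i := by
  have : IsSelfAdjoint (CFC.sqrt (y i)) := .of_nonneg (CFC.sqrt_nonneg _)
  rw [chainVec, this.star_eq, CFC.sqrt_mul_sqrt_self _ (hy i)]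

/-- The vector is `r_i ⋯ r_{i+k-1} √(y_{i+k})`, so the chain relation collapses its square from the
inside out. -/
theorem chainVec_mul_star (hy : ∀ n, 0 ≤ y n) (hr : ∀ n, y n = r n * y (n + 1) * star (r n))
    (i k : ℕ) : chainVec y r i k * star (chainVec y r i k) = y i := by
  induction k generalizing i with
  | zero => exact chainVec_zero_mul_star hy i
  | succ k ih =>
    rw [chainVec, star_mul]
    calc _ = r i * (chainVec y r (i + 1) k * star (chainVec y r (i + 1) k)) * star (r i) := by
          noncomm_ring
      _ = y i := by rw [ih, ← hr]

/-- Moving the common end `i + k = j + l` of both products one step on changes nothing, because the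
innermost factor is `y_m = r_m y_{m+1} r_m*`. Inner products of these vectors therefore depend only
on `i` and `j`, and a limiting Gram matrix makes sense. -/
theorem chainVec_succ_mul_star (hy : ∀ n, 0 ≤ y n)
    (hr : ∀ n, y n = r n * y (n + 1) * star (r n)) (k l i j : ℕ) (h : i + k = j + l) :
    chainVec y r i (k + 1) * star (chainVec y r j (l + 1)) =
      chainVec y r i k * star (chainVec y r j l) := by
  induction k generalizing i with
  | zero =>
    induction l generalizing j with
    | zero =>
      obtain rfl : i = j := by omega
      rw [chainVec_mul_star hy hr, chainVec_mul_star hy hr]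
    | succ l ih =>
      have := ih (j + 1) (by omega)
      rw [chainVec.eq_2 y r j, chainVec.eq_2 y r j, star_mul, star_mul, ← mul_assoc, this,
        ← mul_assoc]
  | succ k ih =>
    rw [chainVec.eq_2 y r i, chainVec.eq_2 y r i, mul_assoc, ih (i + 1) (by omega), ← mul_assoc]

theorem norm_chainVec_le (hy : ∀ n, 0 ≤ y n) (hr : ∀ n, y n = r n * y (n + 1) * star (r n))
    (h1 : ∀ n, ‖y n‖ ≤ 1) (i k : ℕ) : ‖chainVec y r i k‖ ≤ 1 := by
  have h := CStarRing.norm_self_mul_star (x := chainVec y r i k)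
  rw [chainVec_mul_star hy hr] at h
  have := h1 i
  nlinarith [norm_nonneg (chainVec y r i k)]

/-- The vector ends in `√(y_{i+k})`, so its square in the other order is a conjugate of a bounded
element by that root. -/
theorem exists_star_mul_chainVec_le (hy : ∀ n, 0 ≤ y n) (i k : ℕ) :
    ∃ C : ℝ, 0 ≤ C ∧ star (chainVec y r i k) * chainVec y r i k ≤ C • y (i + k) := by
  induction k generalizing i with
  | zero =>
    have : IsSelfAdjoint (CFC.sqrt (y i)) := .of_nonneg (CFC.sqrt_nonneg _)
    refine ⟨1, zero_le_one, ?_⟩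
    rw [chainVec, this.star_eq, CFC.sqrt_mul_sqrt_self _ (hy i), one_smul]
    rfl
  | succ k ih =>
    obtain ⟨C, hC, h⟩ := ih (i + 1)
    refine ⟨‖star (r i) * r i‖ * C, by positivity, ?_⟩
    have h1 := CStarAlgebra.star_left_conjugate_le_norm_smul (a := chainVec y r (i + 1) k)
      (b := star (r i) * r i) (.star_mul_self _)
    rw [chainVec, star_mul]
    calc _ = star (chainVec y r (i + 1) k) * (star (r i) * r i) * chainVec y r (i + 1) k := by
          noncomm_ring
      _ ≤ _ := h1
      _ ≤ ‖star (r i) * r i‖ • (C • y (i + 1 + k)) := smul_le_smul_of_nonneg_left h (norm_nonneg _)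
      _ = _ := by rw [smul_smul, show i + 1 + k = i + (k + 1) by omega]

end Gram

/-! ### Suprema of increasing sequences in `(A ⊗ K)₊`. -/

namespace Stab

/-- The injections `k ↦ (i, k)` with disjoint ranges. -/
def pairEmb (i : ℕ) : ℕ ↪ ℕ := ⟨Nat.pair i, fun a b h => by simpa using h⟩

theorem pairEmb_ne {i j : ℕ} (h : i ≠ j) (a b : ℕ) : pairEmb i a ≠ pairEmb j b := by
  change Nat.pair i a ≠ Nat.pair j b
  simp [h]

theorem row_mul_star_row (f g : ℕ ↪ ℕ) (a b : Stab A) :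
    row f a * star (row g b) = row f (star (row g (star (a * star b)))) := by
  have e : star (row g (star (a * star b))) = a * star (row g b) := by
    rw [star_mul, star_star, ← row_mul, star_mul, star_star]
  rw [row_mul, e]

/-- Every chain `y n = r n * y (n + 1) * (r n)*` has a supremum, the class of a Gram matrix. -/
theorem exists_sup_of_chain {y r : ℕ → Stab A} (hy : ∀ n, 0 ≤ y n) (h1 : ∀ n, ‖y n‖ ≤ 1)
    (hr : ∀ n, y n = r n * y (n + 1) * star (r n)) :
    ∃ s : Stab A, 0 ≤ s ∧ (∀ n, CuntzLE (y n) s) ∧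
      ∀ ε : ℝ, 0 < ε → ∃ n, CuntzLE (cut ε s) (y n) := by
  set c := chainVec y r with hc
  -- Row `i` carries the weight `2^(-i)`, and distinct rows have orthogonal ranges. With `c` the
  -- chain vectors, `Y n = ∑ t i (n - i)` has the Gram matrix `Y n (Y n)*` with entries `2^(-i-j)
  -- c_{i,n-i} c_{j,n-j}*`.
  let t : ℕ → ℕ → Stab A := fun i k => row (pairEmb i) ((1 / 2 : ℝ) ^ i • c i k)
  have ht : ∀ i k, ‖t i k‖ ≤ (1 / 2 : ℝ) ^ i := fun i k => by
    change ‖row _ _‖ ≤ _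
    rw [norm_row, norm_smul, Real.norm_of_nonneg (by positivity)]
    have := norm_chainVec_le hy hr h1 i k
    exact mul_le_of_le_one_right (by positivity) this
  have htt : ∀ k l i j, i + k = j + l → t i (k + 1) * star (t j (l + 1)) =
      t i k * star (t j l) := by
    intro k l i j h
    change row _ _ * star (row _ _) = row _ _ * star (row _ _)
    rw [row_mul_star_row, row_mul_star_row, star_smul, star_smul, smul_mul_smul_comm,
      smul_mul_smul_comm, chainVec_succ_mul_star hy hr k l i j h]
  let Y : ℕ → Stab A := fun n => ∑ i ∈ Finset.range (n + 1), t i (n - i)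
  -- `Y'` moves the end of every row one step on without adding a row, so it has the same Gram
  -- matrix as `Y n`. Thus `G (n + 1) - G n` only involves the new row, of norm at most
  -- `2^(-(n+1))`, and `G` converges although convergence of `Y` is not claimed.
  let Y' : ℕ → Stab A := fun n => ∑ i ∈ Finset.range (n + 1), t i (n + 1 - i)
  let G : ℕ → Stab A := fun n => Y n * star (Y n)
  have hYY' : ∀ n, Y' n * star (Y' n) = G n := by
    intro n
    simp only [G, Y, Y', star_sum, Finset.sum_mul_sum]
    refine Finset.sum_congr rfl fun i hi => Finset.sum_congr rfl fun j hj => ?_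
    have hi := Finset.mem_range.1 hi
    have hj := Finset.mem_range.1 hj
    rw [show n + 1 - i = n - i + 1 by omega, show n + 1 - j = n - j + 1 by omega]
    exact htt _ _ _ _ (by omega)
  have hYsucc : ∀ n, Y (n + 1) = Y' n + t (n + 1) 0 := by
    intro n
    simp only [Y, Y']
    rw [Finset.sum_range_succ _ (n + 1), Nat.sub_self]
  have hY'n : ∀ n, ‖Y' n‖ ≤ 2 := by
    intro n
    refine (norm_sum_le _ _).trans ((Finset.sum_le_sum fun i _ => ht i _).trans ?_)
    exact sum_geometric_two_le (n + 1)
  have hdist : ∀ n, dist (G n) (G (n + 1)) ≤ 5 / 2 / 2 ^ n := by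
    intro n
    rw [dist_eq_norm, norm_sub_rev]
    have e : G (n + 1) - G n = Y' n * star (t (n + 1) 0) + t (n + 1) 0 * star (Y' n) +
        t (n + 1) 0 * star (t (n + 1) 0) := by
      rw [← hYY' n]
      simp only [G, hYsucc, star_add]
      noncomm_ring
    rw [e]
    have hT := ht (n + 1) 0
    have hT1 : ‖t (n + 1) 0‖ ≤ 1 := hT.trans (pow_le_one₀ (by norm_num) (by norm_num))
    have hT0 := norm_nonneg (t (n + 1) 0)
    calc _ ≤ ‖Y' n‖ * ‖t (n + 1) 0‖ + ‖t (n + 1) 0‖ * ‖Y' n‖ + ‖t (n + 1) 0‖ * ‖t (n + 1) 0‖ := by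
          refine (norm_add₃_le).trans ?_
          gcongr
          · exact (norm_mul_le _ _).trans_eq (by rw [norm_star])
          · exact (norm_mul_le _ _).trans_eq (by rw [norm_star])
          · exact (norm_mul_le _ _).trans_eq (by rw [norm_star])
      _ ≤ 5 * ‖t (n + 1) 0‖ := by nlinarith [hY'n n]
      _ ≤ 5 * (1 / 2) ^ (n + 1) := by gcongr
      _ = 5 / 2 / 2 ^ n := by rw [pow_succ, div_pow, one_pow]; ring
  obtain ⟨s, hs⟩ := cauchySeq_tendsto_of_complete (cauchySeq_of_le_geometric_two hdist)
  have hs0 : 0 ≤ s := ge_of_tendsto' hs fun n => mul_star_self_nonneg _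
  refine ⟨s, hs0, fun n => ?_, fun ε hε => ?_⟩
  · intro ε hε
    obtain ⟨p, hp⟩ := CuntzLE.refl (y n) ε hε
    -- With the row isometry `V_n`, this is `2^n p V_n*`. It extracts row `n` and undoes its weight,
    -- so `q (G m) q* = p y_n p*` for all `m ≥ n`.
    set q := star (row (pairEmb n) (star ((2 : ℝ) ^ n • p))) with hq
    refine ⟨q, ?_⟩
    have hqY : ∀ m, n ≤ m → q * Y m = p * c n (m - n) := by
      intro m hm
      simp only [Y, Finset.mul_sum]
      rw [Finset.sum_eq_single n]
      · change star (row _ _) * row _ _ = _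
        rw [star_row_mul_row, star_star, smul_mul_smul_comm, ← mul_pow]
        norm_num
      · intro i _ hi
        exact star_row_mul_row_of_ne (pairEmb_ne hi.symm) _ _
      · intro h
        exact absurd (Finset.mem_range.2 (by omega)) h
    have hqG : ∀ m, n ≤ m → q * G m * star q = p * y n * star p := by
      intro m hm
      calc q * G m * star q = (q * Y m) * star (q * Y m) := by
            simp only [G, star_mul]; noncomm_ring
        _ = p * (c n (m - n) * star (c n (m - n))) * star p := by
            rw [hqY m hm, star_mul]; noncomm_ring
        _ = _ := by rw [chainVec_mul_star hy hr]
    have hlim : Filter.Tendsto (fun m => q * G m * star q) Filter.atTop (nhds (q * s * star q)) :=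
      (hs.const_mul q).mul_const (star q)
    have : q * s * star q = p * y n * star p := by
      refine tendsto_nhds_unique hlim (tendsto_const_nhds.congr' ?_)
      filter_upwards [Filter.eventually_ge_atTop n] with m hm using (hqG m hm).symm
    rw [this]
    exact hp
  · obtain ⟨n, hn⟩ := ((Metric.tendsto_nhds.1 hs ε hε)).exists
    rw [dist_eq_norm, norm_sub_rev] at hn
    refine ⟨n, (CuntzLE.cut_of_norm_lt hs0 (mul_star_self_nonneg _) hn).trans
      ((CuntzLE.mul_star_self (Y n)).trans ?_)⟩
    -- After passing from `Y Y*` to `Y* Y` the orthogonality of the rows removes the cross terms,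
    -- and every remaining term is dominated by a multiple of `y n`.
    have e : star (Y n) * Y n = ∑ i ∈ Finset.range (n + 1), star (t i (n - i)) * t i (n - i) := by
      simp only [Y, star_sum, Finset.sum_mul_sum]
      refine Finset.sum_congr rfl fun i hi => ?_
      rw [Finset.sum_eq_single i]
      · intro j _ hj
        exact star_row_mul_row_of_ne (pairEmb_ne hj.symm) _ _
      · exact fun h => absurd hi h
    choose C hC hCle using fun i => exists_star_mul_chainVec_le (r := r) hy i (n - i)
    have hle : star (Y n) * Y n ≤ (∑ i ∈ Finset.range (n + 1), (1 / 2 : ℝ) ^ i * (1 / 2) ^ i * C i) •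
        y n := by
      rw [e, Finset.sum_smul]
      refine Finset.sum_le_sum fun i hi => ?_
      change star (row _ _) * row _ _ ≤ _
      rw [star_row_mul_row, star_smul, star_trivial, smul_mul_smul_comm,
        mul_smul ((1 / 2 : ℝ) ^ i * (1 / 2) ^ i) (C i)]
      have := hCle i
      rw [show i + (n - i) = n by have := Finset.mem_range.1 hi; omega] at this
      have hp : (0 : ℝ) ≤ (1 / 2) ^ i * (1 / 2) ^ i := by positivity
      exact smul_le_smul_of_nonneg_left this hp
    have hnn : (0 : ℝ) ≤ ∑ i ∈ Finset.range (n + 1), (1 / 2 : ℝ) ^ i * (1 / 2) ^ i * C i :=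
      Finset.sum_nonneg fun i _ => mul_nonneg (by positivity) (hC i)
    exact (CuntzLE.of_le (star_mul_self_nonneg (Y n)) hle).trans (CuntzLE.smul hnn _)

/-- An increasing sequence becomes an exact chain after cutting `z n` at suitable heights `e n`. The
recursion also makes the new cut-down dominate `(z k - 1/(n+2))₊` for all `k ≤ n + 1`, so the
supremum of the chain still dominates every `z k`. -/
theorem exists_sup_of_norm_le_one {z : ℕ → Stab A} (hz : ∀ n, 0 ≤ z n) (h1 : ∀ n, ‖z n‖ ≤ 1)
    (hmono : ∀ k n, k ≤ n → CuntzLE (z k) (z n)) :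
    ∃ s : Stab A, 0 ≤ s ∧ (∀ n, CuntzLE (z n) s) ∧
      ∀ ε : ℝ, 0 < ε → ∃ n, CuntzLE (cut ε s) (z n) := by
  have step : ∀ n (ε : {ε : ℝ // 0 < ε}), ∃ η : {ε : ℝ // 0 < ε},
      (∃ r, cut ε (z n) = r * cut η (z (n + 1)) * star r) ∧
      ∀ k ≤ n + 1, CuntzLE (cut (1 / ((n : ℝ) + 2)) (z k)) (cut η (z (n + 1))) := by
    rintro n ⟨ε, hε⟩
    -- Both requirements hold for all sufficiently small heights `η > 0`, so one height satisfies
    -- them at once.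
    have ev1 : ∀ᶠ η in nhdsWithin (0 : ℝ) (Set.Ioi 0),
        ∃ r, cut ε (z n) = r * cut η (z (n + 1)) * star r := by
      obtain ⟨δ, hδ, h⟩ := (hmono n (n + 1) n.le_succ).exists_cut_eq (hz n) (hz (n + 1)) hε
      filter_upwards [Ioc_mem_nhdsGT hδ] with η hη using h η hη.1.le hη.2
    have ev2 : ∀ᶠ η in nhdsWithin (0 : ℝ) (Set.Ioi 0), ∀ k ∈ Finset.range (n + 2),
        CuntzLE (cut (1 / ((n : ℝ) + 2)) (z k)) (cut η (z (n + 1))) := by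
      rw [Filter.eventually_all_finset]
      intro k hk
      obtain ⟨δ, hδ, h⟩ := (hmono k (n + 1) (by have := Finset.mem_range.1 hk; omega)).exists_cut
        (hz k) (hz (n + 1)) (ε := 1 / ((n : ℝ) + 2)) (by positivity)
      filter_upwards [Ioc_mem_nhdsGT hδ] with η hη using
        h.trans (CuntzLE.cut_mono hη.1.le hη.2 (hz (n + 1)))
    obtain ⟨η, ⟨h1, h2⟩, h3⟩ := ((ev1.and ev2).and self_mem_nhdsWithin).exists
    exact ⟨⟨η, h3⟩, h1, fun k hk => h2 k (Finset.mem_range.2 (by omega))⟩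
  choose next hnext1 hnext2 using step
  obtain ⟨e, he⟩ : ∃ e : ℕ → {ε : ℝ // 0 < ε}, ∀ n, e (n + 1) = next n (e n) :=
    ⟨fun n => Nat.rec ⟨1, one_pos⟩ (fun n ε => next n ε) n, fun _ => rfl⟩
  choose r hr using hnext1
  obtain ⟨s, hs0, hs1, hs2⟩ := exists_sup_of_chain (y := fun n => cut (e n).1 (z n))
    (r := fun n => r n (e n)) (fun n => cut_nonneg _ _)
    (fun n => (CStarAlgebra.norm_le_norm_of_nonneg_of_le (cut_nonneg _ _)
      ((cut_le_cut le_rfl (e n).2.le (hz n)).trans_eq (cut_zero (hz n)))).trans (h1 n))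
    fun n => by
      have := hr n (e n)
      rwa [← he] at this
  refine ⟨s, hs0, fun k => CuntzLE.of_cut (hz k) fun ε hε => ?_, fun ε hε => ?_⟩
  · obtain ⟨n, hn⟩ := exists_nat_one_div_lt hε
    have h2 := hnext2 (n + k) (e (n + k)) k (by omega)
    rw [← he] at h2
    refine CuntzLE.trans (CuntzLE.cut_mono (by positivity) ?_ (hz k)) (h2.trans (hs1 (n + k + 1)))
    refine le_trans ?_ hn.le
    push_cast
    gcongr
    · linarith [(Nat.cast_nonneg k : (0 : ℝ) ≤ k)]
    · norm_num
  · obtain ⟨n, hn⟩ := hs2 ε hε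
    exact ⟨n, hn.trans (CuntzLE.cut_self (e n).2.le (hz n))⟩

theorem exists_sup {z : ℕ → Stab A} (hz : ∀ n, 0 ≤ z n)
    (hmono : ∀ k n, k ≤ n → CuntzLE (z k) (z n)) :
    ∃ s : Stab A, 0 ≤ s ∧ (∀ n, CuntzLE (z n) s) ∧
      ∀ ε : ℝ, 0 < ε → ∃ n, CuntzLE (cut ε s) (z n) := by
  let t : ℕ → ℝ := fun n => (‖z n‖ + 1)⁻¹
  have ht : ∀ n, 0 < t n := fun n => by positivity
  have hzt : ∀ n, CuntzLE (z n) (t n • z n) := fun n => by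
    have := CuntzLE.smul (inv_nonneg.2 (ht n).le) (t n • z n)
    rwa [smul_smul, inv_mul_cancel₀ (ht n).ne', one_smul] at this
  obtain ⟨s, hs0, hs1, hs2⟩ := exists_sup_of_norm_le_one (z := fun n => t n • z n)
    (fun n => smul_nonneg (ht n).le (hz n))
    (fun n => by
      rw [norm_smul, Real.norm_of_nonneg (ht n).le, inv_mul_le_iff₀ (by positivity)]
      linarith)
    fun k n hkn => (CuntzLE.smul (ht k).le _).trans ((hmono k n hkn).trans (hzt n))
  refine ⟨s, hs0, fun n => (hzt n).trans (hs1 n), fun ε hε => ?_⟩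
  obtain ⟨n, hn⟩ := hs2 ε hε
  exact ⟨n, hn.trans (CuntzLE.smul (ht n).le _)⟩

/-- The diagonal sum as a `*`-homomorphism. -/
def dsumHom : Stab A × Stab A →⋆ₙₐ[ℂ] Stab A where
  toFun p := dsum p.1 p.2
  map_smul' c p := by simp [dsum]
  map_zero' := by simp [dsum]
  map_add' p q := by simp [dsum]; abel
  map_mul' p q := (dsum_mul _ _ _ _).symm
  map_star' p := (star_dsum _ _).symm

/-- The diagonal sum is a `*`-homomorphism on pairs, so it commutes with functional calculus, which
on pairs acts componentwise. -/
theorem cut_dsum {ε : ℝ} (hε : 0 ≤ ε) {x y : Stab A} (hx : 0 ≤ x) (hy : 0 ≤ y) :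
    cut ε (dsum x y) = dsum (cut ε x) (cut ε y) := by
  have hsx : IsSelfAdjoint x := .of_nonneg hx
  have hsy : IsSelfAdjoint y := .of_nonneg hy
  have hxy : IsSelfAdjoint (x, y) := Prod.ext hsx.star_eq hsy.star_eq
  have hc : Continuous (dsumHom : Stab A × Stab A → Stab A) := 
    ((continuous_relabel even).comp continuous_fst).add ((continuous_relabel odd).comp continuous_snd)
  have hd : IsSelfAdjoint (dsumHom (x, y)) := hxy.map dsumHom
  have h := dsumHom.map_cfcₙ (fun t : ℝ => max (t - ε) 0) (x, y) (by fun_prop) (by simpa using hε)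
    hc hxy hd
  rw [cfcₙ_map_prod (S := ℂ) (fun t : ℝ => max (t - ε) 0) x y (by fun_prop) hxy hsx hsy] at h
  exact h.symm

end Stab

namespace PosStab

/-- The cut-down `(x - ε)₊`. -/
def cut (ε : ℝ) (x : PosStab A) : PosStab A :=
  ⟨CuntzSemigroup.cut ε x.val, isPos_iff_nonneg.2 (cut_nonneg _ _)⟩

theorem nonneg (x : PosStab A) : 0 ≤ x.val := isPos_iff_nonneg.1 x.isPos

end PosStab

/-! ### Suprema and compact containment in `Cu(A)`. -/

namespace Cu

/-- The second clause is what later turns cut-downs into compactly contained elements: every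
cut-down of the supremum is already below a term of the sequence. -/
theorem exists_sup {z : ℕ → Cu A} (hz : Monotone z) :
    ∃ x : PosStab A, IsLUB (Set.range z) (mk x) ∧
      ∀ ε : ℝ, 0 < ε → ∃ n, mk (x.cut ε) ≤ z n := by
  choose y hy using fun n => exists_mk (z n)
  obtain ⟨s, hs0, hs1, hs2⟩ := Stab.exists_sup (z := fun n => (y n).val) (fun n => (y n).nonneg)
    fun k n hkn => by
      have := hz hkn
      rw [← hy, ← hy] at this
      exact this
  have h2 : ∀ ε : ℝ, 0 < ε → ∃ n, mk (PosStab.cut ε ⟨s, isPos_iff_nonneg.2 hs0⟩) ≤ z n := by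
    intro ε hε
    obtain ⟨n, hn⟩ := hs2 ε hε
    refine ⟨n, ?_⟩
    rw [← hy]
    exact hn
  refine ⟨⟨s, isPos_iff_nonneg.2 hs0⟩, ⟨?_, fun u hu => ?_⟩, h2⟩
  · rintro _ ⟨n, rfl⟩
    rw [← hy]
    exact hs1 n
  · obtain ⟨w, rfl⟩ := exists_mk u
    refine CuntzLE.of_cut hs0 fun ε hε => ?_
    obtain ⟨n, hn⟩ := h2 ε hε
    exact hn.trans (hu ⟨n, rfl⟩)

theorem exists_cut_le {x y : PosStab A} (h : mk x ≤ mk y) {ε : ℝ} (hε : 0 < ε) :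
    ∃ δ : ℝ, 0 < δ ∧ mk (x.cut ε) ≤ mk (y.cut δ) :=
  CuntzLE.exists_cut x.nonneg y.nonneg h hε

theorem le_of_cut_le {x : PosStab A} {u : Cu A} (h : ∀ ε : ℝ, 0 < ε → mk (x.cut ε) ≤ u) :
    mk x ≤ u := by
  obtain ⟨w, rfl⟩ := exists_mk u
  exact CuntzLE.of_cut x.nonneg h

theorem cut_le_cut {x : PosStab A} {ε δ : ℝ} (hε : 0 ≤ ε) (h : ε ≤ δ) :
    mk (x.cut δ) ≤ mk (x.cut ε) :=
  CuntzLE.cut_mono hε h x.nonneg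

theorem cut_le {x : PosStab A} {ε : ℝ} (hε : 0 ≤ ε) : mk (x.cut ε) ≤ mk x :=
  CuntzLE.cut_self hε x.nonneg

theorem exists_cut_le_of_isLUB {z : ℕ → Cu A} (hz : Monotone z) {x : PosStab A} {s : Cu A}
    (hs : IsLUB (Set.range z) s) (hx : mk x ≤ s) {ε : ℝ} (hε : 0 < ε) :
    ∃ n, mk (x.cut ε) ≤ z n := by
  obtain ⟨y, hy, h⟩ := exists_sup hz
  obtain rfl := hs.unique hy
  obtain ⟨δ, hδ, hle⟩ := exists_cut_le hx hε
  obtain ⟨n, hn⟩ := h δ hδ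
  exact ⟨n, hle.trans hn⟩

theorem wayBelow_of_le_cut {s : Cu A} {x : PosStab A} {ε : ℝ} (hε : 0 < ε)
    (h : s ≤ mk (x.cut ε)) : WayBelow s (mk x) := by
  intro z hz t ht hxt
  obtain ⟨n, hn⟩ := exists_cut_le_of_isLUB hz ht hxt hε
  exact ⟨n, h.trans hn⟩

theorem monotone_cut (x : PosStab A) : Monotone fun n : ℕ => mk (x.cut (1 / ((n : ℝ) + 1))) :=
  fun n m h => cut_le_cut (by positivity) (by gcongr)

theorem isLUB_cut (x : PosStab A) :
    IsLUB (Set.range fun n : ℕ => mk (x.cut (1 / ((n : ℝ) + 1)))) (mk x) := by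
  refine ⟨?_, fun u hu => le_of_cut_le fun ε hε => ?_⟩
  · rintro _ ⟨n, rfl⟩
    exact cut_le (by positivity)
  · obtain ⟨n, hn⟩ := exists_nat_one_div_lt hε
    exact (cut_le_cut (by positivity) hn.le).trans (hu ⟨n, rfl⟩)

/-- The cut-downs at `1/(n+1)` increase to `x`, which gives one direction; the other holds because
cut-downs are caught by terms of any sequence with supremum above `x`. -/
theorem wayBelow_iff {s : Cu A} {x : PosStab A} :
    WayBelow s (mk x) ↔ ∃ ε : ℝ, 0 < ε ∧ s ≤ mk (x.cut ε) := by
  refine ⟨fun h => ?_, fun ⟨ε, hε, h⟩ => wayBelow_of_le_cut hε h⟩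
  obtain ⟨n, hn⟩ := h _ (monotone_cut x) _ (isLUB_cut x) le_rfl
  exact ⟨_, by positivity, hn⟩

theorem mk_cut_dsum {ε : ℝ} (hε : 0 ≤ ε) (x y : PosStab A) :
    mk ((x.dsum y).cut ε) = mk (x.cut ε) + mk (y.cut ε) := by
  rw [mk_add_mk]
  congr 1
  have h := Stab.cut_dsum hε x.nonneg y.nonneg
  unfold PosStab.cut PosStab.dsum
  congr 1

/-- Cut both representatives at the smaller of the two heights; cut-downs commute with diagonal
sums. -/
theorem wayBelow_add {s s' t t' : Cu A} (hs : WayBelow s' s) (ht : WayBelow t' t) :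
    WayBelow (s' + t') (s + t) := by
  obtain ⟨x, rfl⟩ := exists_mk s
  obtain ⟨y, rfl⟩ := exists_mk t
  obtain ⟨ε, hε, hx⟩ := wayBelow_iff.1 hs
  obtain ⟨δ, hδ, hy⟩ := wayBelow_iff.1 ht
  rw [mk_add_mk]
  refine wayBelow_of_le_cut (lt_min hε hδ) ?_
  rw [mk_cut_dsum (le_min hε.le hδ.le)]
  exact add_le_add' (hx.trans (cut_le_cut (le_min hε.le hδ.le) (min_le_left _ _)))
    (hy.trans (cut_le_cut (le_min hε.le hδ.le) (min_le_right _ _)))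

theorem isLUB_add {z w : ℕ → Cu A} (hz : Monotone z) (hw : Monotone w) {s t : Cu A}
    (hs : IsLUB (Set.range z) s) (ht : IsLUB (Set.range w) t) :
    IsLUB (Set.range fun n => z n + w n) (s + t) := by
  obtain ⟨x, rfl⟩ := exists_mk s
  obtain ⟨y, rfl⟩ := exists_mk t
  refine ⟨?_, fun u hu => ?_⟩
  · rintro _ ⟨n, rfl⟩
    exact add_le_add' (hs.1 ⟨n, rfl⟩) (ht.1 ⟨n, rfl⟩)
  · rw [mk_add_mk]
    refine le_of_cut_le fun ε hε => ?_
    rw [mk_cut_dsum hε.le]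
    obtain ⟨n, hn⟩ := exists_cut_le_of_isLUB hz hs le_rfl hε
    obtain ⟨m, hm⟩ := exists_cut_le_of_isLUB hw ht le_rfl hε
    exact (add_le_add' (hn.trans (hz (le_max_left n m))) (hm.trans (hw (le_max_right n m)))).trans
      (hu ⟨max n m, rfl⟩)

end Cu

end CuntzSemigroup
end


noncomputable section

namespace CuntzSemigroup

open unitInterval

theorem WayBelow.mono {S : Type*} [Preorder S] {x x' y y' : S} (h : WayBelow x y) (hx : x' ≤ x)
    (hy : y ≤ y') : WayBelow x' y' := fun z hz s hs hys => by
  obtain ⟨k, hk⟩ := h z hz s hs (hy.trans hys)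
  exact ⟨k, hx.trans hk⟩

/-! ### Layer decomposition of the functions in `𝔾`. -/

namespace GenG

/-- The number of parameters `t` in `l` with `t < x`: the value at `x` of the sum of the
indicator functions `1_{(t, 1]}`, `t ∈ l`. -/
def count (l : Multiset I) (x : I) : ℕ := l.countP (· < x)

theorem count_cons (t : I) (l : Multiset I) (x : I) :
    count (t ::ₘ l) x = count l x + if t < x then 1 else 0 := Multiset.countP_cons _ _ _

theorem count_add (l l' : Multiset I) (x : I) : count (l + l') x = count l x + count l' x :=
  Multiset.countP_add _ _ _

theorem ind_apply (t x : I) : (ind t).toFun x = if t < x then 1 else 0 := by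
  change Set.indicator (Set.Ioi t) 1 x = _
  rw [Set.indicator_apply]
  rfl

theorem exists_eq_count (l : Multiset I) : ∃ g : GenG, ∀ x, g.toFun x = count l x := by
  induction l using Multiset.induction with
  | empty => exact ⟨0, fun x => rfl⟩
  | cons t l ih =>
    obtain ⟨g, hg⟩ := ih
    refine ⟨g + ind t, fun x => ?_⟩
    change g.toFun x + (ind t).toFun x = _
    rw [hg, ind_apply, count_cons]
    split_ifs <;> simp

/-- The set where `f > i` is open by semicontinuity and closed upwards, hence of the form `(t, 1]`,
with `t` the greatest element of its complement. The complement contains `0` because `f 0 = 0`. -/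
theorem exists_threshold (f : GenG) (i : ℕ) : ∃ t : I, ∀ x, t < x ↔ (i : ℕ∞) < f.toFun x := by
  let U : Set I := f.toFun ⁻¹' Set.Ioi (i : ℕ∞)
  have hU : IsOpen U := f.lsc.isOpen_preimage _
  have hup : ∀ x y : I, x ≤ y → x ∈ U → y ∈ U := fun x y hxy hx => lt_of_lt_of_le hx (f.mono hxy)
  have h0 : (0 : I) ∉ U := fun h => by
    have h : (i : ℕ∞) < f.toFun 0 := h
    rw [f.map_zero] at h
    exact not_lt_bot h
  rcases U.eq_empty_or_nonempty with hemp | hne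
  · refine ⟨1, fun x => iff_of_false (not_lt_of_ge x.2.2) fun h => ?_⟩
    have : x ∈ U := h
    rw [hemp] at this
    exact this
  · have hcl : IsClosed Uᶜ := hU.isClosed_compl
    obtain ⟨t, ht, hmax⟩ := hcl.isCompact.exists_isGreatest ⟨0, h0⟩
    refine ⟨t, fun x => ⟨fun hx => ?_, fun hx => ?_⟩⟩
    · by_contra hcon
      exact absurd (hmax hcon) (not_le.2 hx)
    · by_contra hcon
      exact ht (hup x t (not_lt.1 hcon) hx)

/-- The parameters `t` with `f = ∑ i, 1_{(t i, 1]}`. -/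
def threshold (f : GenG) (i : ℕ) : I := (exists_threshold f i).choose

theorem threshold_lt_iff (f : GenG) (i : ℕ) (x : I) :
    threshold f i < x ↔ (i : ℕ∞) < f.toFun x := (exists_threshold f i).choose_spec x

/-- The first `n` parameters of `f`. -/
def thresholds (f : GenG) (n : ℕ) : Multiset I := (Multiset.range n).map (threshold f)

theorem count_thresholds (f : GenG) (n : ℕ) (x : I) :
    (count (thresholds f n) x : ℕ∞) = min (n : ℕ∞) (f.toFun x) := by
  induction n with
  | zero => simp [thresholds, count]
  | succ n ih =>
    rw [thresholds, Multiset.range_succ, Multiset.map_cons, count_cons]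
    change ((count (thresholds f n) x + _ : ℕ) : ℕ∞) = _
    rw [Nat.cast_add, ih]
    by_cases h : (n : ℕ∞) < f.toFun x
    · rw [if_pos ((threshold_lt_iff f n x).2 h), min_eq_left h.le,
        min_eq_left (by exact_mod_cast Order.add_one_le_of_lt h)]
      simp
    · rw [if_neg (fun h' => h ((threshold_lt_iff f n x).1 h'))]
      have h := not_lt.1 h
      rw [min_eq_right h, min_eq_right (h.trans (by exact_mod_cast n.le_succ))]
      simp

/-- `l` is a finite set of parameters with `∑ t ∈ l, 1_{(t, 1]} ≤ f`. -/
def IsBelow (l : Multiset I) (f : GenG) : Prop := ∀ x, (count l x : ℕ∞) ≤ f.toFun x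

theorem isBelow_thresholds (f : GenG) (n : ℕ) : IsBelow (thresholds f n) f := fun x => by
  rw [count_thresholds]
  exact min_le_right _ _

/-- `count l` never exceeds the size of `l`, so truncating `f` at that height loses nothing. -/
theorem IsBelow.count_le {l : Multiset I} {f : GenG} (h : IsBelow l f) (x : I) :
    count l x ≤ count (thresholds f l.card) x := by
  have : (count l x : ℕ∞) ≤ count (thresholds f l.card) x := by
    rw [count_thresholds]
    exact le_min (by exact_mod_cast Multiset.countP_le_card _ _) (h x)
  exact_mod_cast this

/-- The pointwise supremum belongs to `𝔾`, so the least upper bound lies below it. -/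
theorem exists_lt_of_isLUB {f : ℕ → GenG} (hf : Monotone f) {g : GenG}
    (hg : IsLUB (Set.range f) g) {x : I} {j : ℕ} (h : (j : ℕ∞) < g.toFun x) :
    ∃ n, (j : ℕ∞) < (f n).toFun x := by
  let s : GenG := ⟨fun x => ⨆ n, (f n).toFun x, lowerSemicontinuous_iSup fun n => (f n).lsc,
    by simp [GenG.map_zero], fun x y hxy => iSup_mono fun n => (f n).mono hxy⟩
  have hs : g ≤ s := hg.2 (by
    rintro _ ⟨n, rfl⟩ x
    exact le_iSup (fun n => (f n).toFun x) n)
  exact lt_iSup_iff.1 (h.trans_le (hs x))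

/-- The parameter `t + 1 / (k + 1)`. -/
def shift (k : ℕ) (t : I) : I := Set.projIcc 0 1 zero_le_one ((t : ℝ) + 1 / ((k : ℝ) + 1))

theorem le_shift (k : ℕ) (t : I) : t ≤ shift k t := by
  conv_lhs => rw [← Set.projIcc_val zero_le_one t]
  exact Set.monotone_projIcc _ (le_add_of_nonneg_right (by positivity))

theorem lt_shift (k : ℕ) {t : I} (ht : t < 1) : t < shift k t := by
  rw [← Subtype.coe_lt_coe, shift, Set.coe_projIcc]
  have h1 : (t : ℝ) < 1 := ht
  exact lt_max_of_lt_right (lt_min h1 (lt_add_of_pos_right _ (by positivity)))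

theorem shift_anti {k m : ℕ} (h : k ≤ m) (t : I) : shift m t ≤ shift k t := by
  apply Set.monotone_projIcc
  gcongr

theorem exists_shift_lt {t x : I} (h : t < x) : ∃ n, shift n t < x := by
  have h1 : (0 : ℝ) < x - t := sub_pos.2 h
  obtain ⟨n, hn⟩ := exists_nat_one_div_lt h1
  refine ⟨n, ?_⟩
  rw [← Subtype.coe_lt_coe, shift, Set.coe_projIcc]
  refine max_lt (lt_of_le_of_lt t.2.1 h) (min_lt_of_right_lt (by linarith))

/-- A compactness statement. It suffices to compare at the finitely many points `shift k t` with `t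
∈ l`, `t < 1`, each strictly to the right of its `t`. There `g` is at least the number of parameters
`≤ t`, and some `f n` reaches that value. -/
theorem exists_isBelow_shift {f : ℕ → GenG} (hf : Monotone f) {g : GenG}
    (hg : IsLUB (Set.range f) g) {l : Multiset I} (hl : IsBelow l g) (k : ℕ) :
    ∃ n, IsBelow (l.map (shift k)) (f n) := by
  have ev : ∀ᶠ n in Filter.atTop, ∀ t ∈ l.toFinset, t < 1 →
      (l.countP (· ≤ t) : ℕ∞) ≤ (f n).toFun (shift k t) := by
    rw [Filter.eventually_all_finset]
    intro t ht
    rw [Multiset.mem_toFinset] at ht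
    by_cases ht1 : t < 1
    · have hpos : 0 < l.countP (· ≤ t) := Multiset.countP_pos.2 ⟨t, ht, le_rfl⟩
      have hle : l.countP (· ≤ t) ≤ count l (shift k t) := by
        rw [count, Multiset.countP_eq_card_filter, Multiset.countP_eq_card_filter]
        exact Multiset.card_le_card (Multiset.monotone_filter_right l
          fun s hs => lt_of_le_of_lt hs (lt_shift k ht1))
      have hlt : ((l.countP (· ≤ t) - 1 : ℕ) : ℕ∞) < g.toFun (shift k t) := by
        refine lt_of_lt_of_le ?_ (hl (shift k t))
        exact_mod_cast (by omega : l.countP (· ≤ t) - 1 < count l (shift k t))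
      obtain ⟨n, hn⟩ := exists_lt_of_isLUB hf hg hlt
      filter_upwards [Filter.eventually_ge_atTop n] with m hm _
      have h1 := Order.add_one_le_of_lt (hn.trans_le (hf hm (shift k t)))
      have h2 : ((l.countP (· ≤ t) - 1 : ℕ) : ℕ∞) + 1 = (l.countP (· ≤ t) : ℕ∞) := by
        exact_mod_cast (by omega : l.countP (· ≤ t) - 1 + 1 = l.countP (· ≤ t))
      rwa [h2] at h1
    · exact Filter.Eventually.of_forall fun n h => absurd h ht1
  obtain ⟨n, hn⟩ := ev.exists
  refine ⟨n, fun x => ?_⟩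
  have hc : count (l.map (shift k)) x = (l.filter fun s => shift k s < x).card := by
    rw [count, Multiset.countP_map]
  rw [hc]
  rcases (l.filter fun s => shift k s < x).toFinset.eq_empty_or_nonempty with hemp | hne
  · rw [Multiset.toFinset_eq_empty.1 hemp]
    simp
  · obtain ⟨t, ht, hmax⟩ := Finset.exists_max_image _ id hne
    rw [Multiset.mem_toFinset, Multiset.mem_filter] at ht
    have ht1 : t < 1 := lt_of_le_of_lt (le_shift k t) (ht.2.trans_le x.2.2)
    refine le_trans ?_ ((hn t (Multiset.mem_toFinset.2 ht.1) ht1).trans ((f n).mono ht.2.le))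
    rw [Multiset.countP_eq_card_filter]
    exact_mod_cast Multiset.card_le_card (Multiset.le_filter.2 ⟨Multiset.filter_le _ _,
      fun s hs => hmax s (Multiset.mem_toFinset.2 hs)⟩)

/-- Simple functions that are compactly contained in `g` and increase to `g`. -/
def approx (g : GenG) (n : ℕ) : GenG :=
  (exists_eq_count ((thresholds g n).map (shift n))).choose

theorem approx_apply (g : GenG) (n : ℕ) (x : I) :
    (approx g n).toFun x = count ((thresholds g n).map (shift n)) x :=
  (exists_eq_count ((thresholds g n).map (shift n))).choose_spec x

theorem count_map_shift (g : GenG) (n : ℕ) (x : I) :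
    count ((thresholds g n).map (shift n)) x =
      ((Finset.range n).filter fun i => shift n (threshold g i) < x).card := by
  rw [thresholds, Multiset.map_map, count, Multiset.countP_map]
  rfl

theorem monotone_approx (g : GenG) : Monotone (approx g) := by
  intro n m hnm x
  rw [approx_apply, approx_apply, count_map_shift, count_map_shift]
  refine Nat.cast_le.2 (Finset.card_le_card fun i hi => ?_)
  rw [Finset.mem_filter, Finset.mem_range] at hi ⊢
  exact ⟨hi.1.trans_le hnm, lt_of_le_of_lt (shift_anti hnm _) hi.2⟩

theorem isLUB_approx (g : GenG) : IsLUB (Set.range (approx g)) g := by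
  constructor
  · rintro _ ⟨n, rfl⟩ x
    rw [approx_apply]
    refine le_trans ?_ (isBelow_thresholds g n x)
    rw [count, count, Multiset.countP_map, Multiset.countP_eq_card_filter]
    exact Nat.cast_le.2 (Multiset.card_le_card (Multiset.monotone_filter_right _
      fun i hi => lt_of_le_of_lt (le_shift n _) hi))
  · intro u hu x
    refine ENat.forall_natCast_le_iff_le.1 fun j hj => ?_
    rcases j with _ | j
    · simp
    have ev : ∀ᶠ n in Filter.atTop, ∀ i ∈ Finset.range (j + 1), shift n (threshold g i) < x := by
      rw [Filter.eventually_all_finset]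
      intro i hi
      have hlt : threshold g i < x := by
        rw [threshold_lt_iff]
        refine lt_of_lt_of_le ?_ hj
        exact_mod_cast Finset.mem_range.1 hi
      obtain ⟨n, hn⟩ := exists_shift_lt hlt
      filter_upwards [Filter.eventually_ge_atTop n] with m hm using
        lt_of_le_of_lt (shift_anti hm _) hn
    obtain ⟨n, hn, hnj⟩ := (ev.and (Filter.eventually_ge_atTop (j + 1))).exists
    refine le_trans ?_ (hu ⟨n, rfl⟩ x)
    rw [approx_apply, count_map_shift]
    norm_cast
    calc j + 1 = (Finset.range (j + 1)).card := (Finset.card_range _).symm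
      _ ≤ _ := Finset.card_le_card fun i hi => by
        rw [Finset.mem_filter]
        exact ⟨Finset.mem_range.2 ((Finset.mem_range.1 hi).trans_le hnj), hn i hi⟩

end GenG

/-! ### Thomsen morphisms from scales `t ↦ [(a - t)₊]`. -/

section Extension

open GenG

variable {A : Type*} [NonUnitalCStarAlgebra A] [PartialOrder A] [StarOrderedRing A]

/-- A scale in `Cu(A)`: the image of the functions `1_{(t, 1]}` under a Cu-morphism. -/
structure IsScale (e : I → Cu A) : Prop where
  map_one : e 1 = 0
  antitone : Antitone e
  isLUB : ∀ t, IsLUB (Set.range fun k => e (shift k t)) (e t)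
  wayBelow : ∀ k t, WayBelow (e (shift k t)) (e t)

/-- The value of the morphism on a finite sum of functions `1_{(t, 1]}`. -/
def scaleSum (e : I → Cu A) (l : Multiset I) : Cu A := (l.map e).sum

theorem scaleSum_cons (e : I → Cu A) (t : I) (l : Multiset I) :
    scaleSum e (t ::ₘ l) = e t + scaleSum e l := by
  rw [scaleSum, Multiset.map_cons, Multiset.sum_cons]
  rfl

variable {e : I → Cu A}

/-- Greedy matching: the smallest parameter `t` of `l` is paired with some `t' ≤ t` of `l'`, the
pair is removed, and the inequality of counts persists. Parameters equal to `1` contribute zero. -/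
theorem IsScale.sum_le_sum (he : IsScale e) {l l' : Multiset I}
    (h : ∀ x, count l x ≤ count l' x) : scaleSum e l ≤ scaleSum e l' := by
  induction hn : l.card generalizing l l' with
  | zero =>
    rw [Multiset.card_eq_zero] at hn
    rw [hn]
    exact Cu.zero_le _
  | succ n ih =>
    have hne : l.toFinset.Nonempty := by
      rw [Multiset.toFinset_nonempty, ← Multiset.card_pos]
      omega
    obtain ⟨t, ht, hmin⟩ := Finset.exists_min_image _ id hne
    obtain ⟨l₀, rfl⟩ := Multiset.exists_cons_of_mem (Multiset.mem_toFinset.1 ht)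
    have hcard : l₀.card = n := by simpa using hn
    rw [scaleSum_cons]
    rcases eq_or_lt_of_le (show t ≤ 1 from t.2.2) with rfl | ht1
    · rw [he.map_one, zero_add]
      refine ih (fun x => le_trans ?_ (h x)) hcard
      rw [count_cons]
      exact Nat.le_add_right _ _
    · have hex : ∃ t' ∈ l', t' ≤ t := by
        by_contra! hcon
        -- If all parameters of `l'` lie to the right of `t`, then at their minimum `l'` counts
        -- nothing while `l` counts `t`. For empty `l'` the infimum is `1`, still above `t`.
        let x := l'.toFinset.inf id
        have hx : t < x := (Finset.lt_inf_iff (show t < ⊤ from ht1)).2 fun s hs =>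
          hcon s (Multiset.mem_toFinset.1 hs)
        have h1 : count l' x = 0 := Multiset.countP_eq_zero.2 fun s hs =>
          not_lt.2 (Finset.inf_le (f := id) (Multiset.mem_toFinset.2 hs))
        have h2 := h x
        rw [h1, count_cons, if_pos hx] at h2
        omega
      obtain ⟨t', ht', htt⟩ := hex
      obtain ⟨l₀', rfl⟩ := Multiset.exists_cons_of_mem ht'
      rw [scaleSum_cons]
      refine Cu.add_le_add' (he.antitone htt) (ih (fun x => ?_) hcard)
      -- Up to `t` the list `l₀` counts nothing, as `t` is minimal; beyond `t` both sides lose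
      -- exactly one.
      rcases le_or_gt x t with hx | hx
      · have : count l₀ x = 0 := Multiset.countP_eq_zero.2 fun s hs => not_lt.2
          (hx.trans (hmin s (Multiset.mem_toFinset.2 (Multiset.mem_cons_of_mem hs))))
        omega
      · have := h x
        rw [count_cons, count_cons, if_pos hx, if_pos (lt_of_le_of_lt htt hx)] at this
        omega

theorem IsScale.isLUB_scaleSum (he : IsScale e) (l : Multiset I) :
    IsLUB (Set.range fun k => scaleSum e (l.map (shift k))) (scaleSum e l) := by
  induction l using Multiset.induction with
  | empty =>
    simp only [Multiset.map_zero, Set.range_const]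
    exact isLUB_singleton
  | cons t l ih =>
    simp only [Multiset.map_cons, scaleSum_cons]
    refine Cu.isLUB_add (fun k m h => he.antitone (shift_anti h t)) (fun k m h => ?_)
      (he.isLUB t) ih
    refine he.sum_le_sum fun x => ?_
    rw [count, count, Multiset.countP_map, Multiset.countP_map]
    exact Multiset.card_le_card (Multiset.monotone_filter_right _
      fun i hi => lt_of_le_of_lt (shift_anti h _) hi)

theorem IsScale.wayBelow_scaleSum (he : IsScale e) (k : ℕ) (l : Multiset I) :
    WayBelow (scaleSum e (l.map (shift k))) (scaleSum e l) := by
  induction l using Multiset.induction with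
  | empty => exact fun z _ _ _ _ => ⟨0, Cu.zero_le _⟩
  | cons t l ih =>
    rw [Multiset.map_cons, scaleSum_cons, scaleSum_cons]
    exact Cu.wayBelow_add (he.wayBelow k t) ih

theorem IsScale.monotone_thresholds (he : IsScale e) (f : GenG) :
    Monotone fun n => scaleSum e (thresholds f n) := by
  intro n m hnm
  refine he.sum_le_sum fun x => ?_
  have : (count (thresholds f n) x : ℕ∞) ≤ count (thresholds f m) x := by
    rw [count_thresholds, count_thresholds]
    exact min_le_min_right _ (by exact_mod_cast hnm)
  exact_mod_cast this

/-- The extension of a scale to `𝔾`. -/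
def IsScale.ext (he : IsScale e) (f : GenG) : Cu A :=
  Cu.mk (Cu.exists_sup (he.monotone_thresholds f)).choose

theorem IsScale.isLUB_ext (he : IsScale e) (f : GenG) :
    IsLUB (Set.range fun n => scaleSum e (thresholds f n)) (he.ext f) :=
  (Cu.exists_sup (he.monotone_thresholds f)).choose_spec.1

theorem IsScale.le_ext (he : IsScale e) {l : Multiset I} {f : GenG} (h : IsBelow l f) :
    scaleSum e l ≤ he.ext f :=
  (he.sum_le_sum h.count_le).trans ((he.isLUB_ext f).1 ⟨_, rfl⟩)

theorem IsScale.ext_le (he : IsScale e) {f : GenG} {u : Cu A}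
    (h : ∀ l, IsBelow l f → scaleSum e l ≤ u) : he.ext f ≤ u := by
  refine (he.isLUB_ext f).2 ?_
  rintro _ ⟨n, rfl⟩
  exact h _ (isBelow_thresholds f n)

theorem IsScale.ext_mono (he : IsScale e) : Monotone he.ext := fun _ _ h =>
  he.ext_le fun _ hl => he.le_ext fun x => (hl x).trans (h x)

theorem IsScale.ext_ind (he : IsScale e) (t : I) : he.ext (ind t) = e t := by
  have h1 : ∀ x, (count {t} x : ℕ∞) = (ind t).toFun x := fun x => by
    rw [ind_apply, ← Multiset.cons_zero, count_cons]
    split_ifs <;> simp [count]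
  have h2 : scaleSum e {t} = e t := by simp [scaleSum]
  refine le_antisymm (he.ext_le fun l hl => ?_) ?_
  · rw [← h2]
    refine he.sum_le_sum fun x => ?_
    have := hl x
    rw [← h1] at this
    exact_mod_cast this
  · rw [← h2]
    exact he.le_ext fun x => (h1 x).le

theorem IsScale.ext_zero (he : IsScale e) : he.ext 0 = 0 := by
  refine le_antisymm (he.ext_le fun l hl => ?_) (Cu.zero_le _)
  refine (he.sum_le_sum (l' := 0) fun x => ?_).trans le_rfl
  have : (count l x : ℕ∞) ≤ 0 := hl x
  have : count l x = 0 := by simpa using this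
  omega

/-- Truncation is subadditive, `min(n, f + g) ≤ min(n, f) + min(n, g)`, and the thresholds of `f`
and `g` together are below `f + g`. -/
theorem IsScale.ext_add (he : IsScale e) (f g : GenG) : he.ext (f + g) = he.ext f + he.ext g := by
  have hsum : ∀ l l', scaleSum e (l + l') = scaleSum e l + scaleSum e l' := fun l l' => by
    rw [scaleSum, Multiset.map_add, Multiset.sum_add]
    rfl
  have hl := Cu.isLUB_add (he.monotone_thresholds f) (he.monotone_thresholds g) (he.isLUB_ext f)
    (he.isLUB_ext g)
  refine le_antisymm ((he.isLUB_ext (f + g)).2 ?_) (hl.2 ?_)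
  · rintro _ ⟨n, rfl⟩
    refine le_trans ?_ (hl.1 ⟨n, rfl⟩)
    change _ ≤ scaleSum e (thresholds f n) + scaleSum e (thresholds g n)
    rw [← hsum]
    refine he.sum_le_sum fun x => ?_
    have : (count (thresholds (f + g) n) x : ℕ∞) ≤
        ((count (thresholds f n + thresholds g n) x : ℕ) : ℕ∞) := by
      rw [count_add, Nat.cast_add, count_thresholds, count_thresholds, count_thresholds]
      change min _ (f.toFun x + g.toFun x) ≤ _
      rcases le_total (n : ℕ∞) (f.toFun x) with h | h
      · rw [min_eq_left h]
        exact (min_le_left _ _).trans le_self_add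
      · rcases le_total (n : ℕ∞) (g.toFun x) with h' | h'
        · rw [min_eq_left h']
          exact (min_le_left _ _).trans le_add_self
        · rw [min_eq_right h, min_eq_right h']
          exact min_le_right _ _
    exact_mod_cast this
  · rintro _ ⟨n, rfl⟩
    change scaleSum e (thresholds f n) + scaleSum e (thresholds g n) ≤ _
    rw [← hsum]
    refine he.le_ext fun x => ?_
    rw [count_add, Nat.cast_add]
    exact add_le_add (isBelow_thresholds f n x) (isBelow_thresholds g n x)

/-- A finite sum below `s` is the supremum of its right shifts, and each right shift is already
below some `z n`. -/
theorem IsScale.ext_sup (he : IsScale e) {z : ℕ → GenG} (hz : Monotone z) {s : GenG}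
    (hs : IsLUB (Set.range z) s) : IsLUB (Set.range (he.ext ∘ z)) (he.ext s) := by
  refine ⟨?_, fun u hu => he.ext_le fun l hl => (he.isLUB_scaleSum l).2 ?_⟩
  · rintro _ ⟨n, rfl⟩
    exact he.ext_mono (hs.1 ⟨n, rfl⟩)
  · rintro _ ⟨k, rfl⟩
    obtain ⟨n, hn⟩ := exists_isBelow_shift hz hs hl k
    exact (he.le_ext hn).trans (hu ⟨n, rfl⟩)

/-- If `f ≪ g`, then `f` lies below the right shift of finitely many thresholds of `g`; scales send
right shifts to compactly contained elements. -/
theorem IsScale.ext_wayBelow (he : IsScale e) {f g : GenG} (h : WayBelow f g) :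
    WayBelow (he.ext f) (he.ext g) := by
  obtain ⟨n, hn⟩ := h _ (monotone_approx g) g (isLUB_approx g) le_rfl
  refine (he.wayBelow_scaleSum n (thresholds g n)).mono ?_ ((he.isLUB_ext g).1 ⟨n, rfl⟩)
  refine (he.ext_mono hn).trans (he.ext_le fun l hl => he.sum_le_sum fun x => ?_)
  have := hl x
  rw [approx_apply] at this
  exact_mod_cast this

/-- The Thomsen morphism that extends a scale. -/
def IsScale.toTh (he : IsScale e) : Th (Cu A) where
  toFun := he.ext
  map_zero := he.ext_zero
  map_add := he.ext_add
  monotone := he.ext_mono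
  map_wayBelow _ _ := he.ext_wayBelow
  map_sup _ hz _ := he.ext_sup hz

theorem isPos_corner {a : A} (ha : 0 ≤ a) : IsPos (Stab.corner a) :=
  IsPos.map (D := A) (E := Stab A) Stab.corner (isPos_iff_nonneg.2 ha)

/-- The class of `a` in `Cu(A)`. -/
def Cu.corner (a : A) (ha : 0 ≤ a) : Cu A := Cu.mk ⟨Stab.corner a, isPos_corner ha⟩

theorem CuntzLE.corner {a b : A} (h : CuntzLE (D := A) a b) :
    CuntzLE (D := Stab A) (Stab.corner a) (Stab.corner b) := by
  have := CuntzLE.map (D := A) (E := Stab A) Stab.corner h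
  exact this

theorem Cu.corner_le_corner_iff {a b : A} (ha : 0 ≤ a) (hb : 0 ≤ b) :
    Cu.corner a ha ≤ Cu.corner b hb ↔ CuntzLE a b := by
  rw [Cu.corner, Cu.corner, Cu.mk_le_mk, PosStab.le_def]
  exact ⟨fun h => Stab.cuntzLE_of_corner h, fun h => CuntzLE.corner h⟩

theorem map_cut {A B : Type*} [NonUnitalCStarAlgebra A] [PartialOrder A] [StarOrderedRing A]
    [NonUnitalCStarAlgebra B] [PartialOrder B] [StarOrderedRing B] (φ : A →⋆ₙₐ[ℂ] B) {ε : ℝ}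
    (hε : 0 ≤ ε) {a : A} (ha : 0 ≤ a) : φ (cut ε a) = cut ε (φ a) := by
  have hsa : IsSelfAdjoint a := .of_nonneg ha
  exact φ.map_cfcₙ _ a (by fun_prop) (by simpa using hε) (homCLM φ).continuous hsa (hsa.map φ)

/-- The parameter is truncated at `1`, which is harmless because `(a - 1)₊ = 0` for a contraction.
-/
theorem cut_shift {a : A} (ha : 0 ≤ a) (h1 : ‖a‖ ≤ 1) (k : ℕ) (t : I) :
    cut (shift k t : ℝ) a = cut (1 / ((k : ℝ) + 1)) (cut t a) := by
  have hk : (0 : ℝ) ≤ 1 / ((k : ℝ) + 1) := by positivity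
  rw [cut_cut t.2.1 hk ha, shift, Set.coe_projIcc]
  rcases le_total ((t : ℝ) + 1 / ((k : ℝ) + 1)) 1 with h | h
  · rw [min_eq_right h, max_eq_right (add_nonneg t.2.1 hk)]
  · rw [min_eq_left h, max_eq_right zero_le_one, cut_eq_zero ha h1, cut_eq_zero ha (h1.trans h)]

theorem Cu.corner_cut_shift {a : A} (ha : 0 ≤ a) (h1 : ‖a‖ ≤ 1) (k : ℕ) (t : I) :
    Cu.corner (cut (shift k t : ℝ) a) (cut_nonneg _ _) =
      Cu.mk (PosStab.cut (1 / ((k : ℝ) + 1))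
        ⟨Stab.corner (cut t a), isPos_corner (cut_nonneg _ _)⟩) := by
  have hk : (0 : ℝ) ≤ 1 / ((k : ℝ) + 1) := by positivity
  have h : Stab.corner (cut (shift k t : ℝ) a) = cut (1 / ((k : ℝ) + 1)) (Stab.corner (cut t a)) := by
    rw [cut_shift ha h1, map_cut _ hk (cut_nonneg _ _)]
  have key : ∀ {x y : PosStab A}, x.val = y.val → Cu.mk x = Cu.mk y := by
    rintro ⟨x, _⟩ ⟨y, _⟩ rfl
    rfl
  exact key h

/-- The scale `t ↦ [(a - t)₊]` of a positive contraction. -/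
theorem isScale_cut {a : A} (ha : 0 ≤ a) (h1 : ‖a‖ ≤ 1) :
    IsScale fun t : I => Cu.corner (cut t a) (cut_nonneg _ _) where
  map_one := by
    have h : cut ((1 : I) : ℝ) a = 0 := cut_eq_zero ha h1
    refine Cu.mk_eq_mk ?_ ?_
    · change CuntzLE (Stab.corner (cut ((1 : I) : ℝ) a)) 0
      rw [h, _root_.map_zero]
      exact CuntzLE.refl _
    · exact CuntzLE.zero _
  antitone t s h := (Cu.corner_le_corner_iff _ _).2 (CuntzLE.cut_mono t.2.1 h ha)
  isLUB t := by
    simp only [Cu.corner_cut_shift ha h1]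
    exact Cu.isLUB_cut _
  wayBelow k t := by
    rw [Cu.corner_cut_shift ha h1]
    exact Cu.wayBelow_of_le_cut (by positivity : (0 : ℝ) < 1 / ((k : ℝ) + 1)) le_rfl

end Extension

end CuntzSemigroup
end


noncomputable section

namespace CuntzSemigroup

/-! ### Horizontal layers of a positive element. -/

section Layer

variable {D : Type*} [NonUnitalCStarAlgebra D] [PartialOrder D] [StarOrderedRing D]

/-- The layer of `a` between the levels `s` and `s + w`. -/
def layer (s w : ℝ) (a : D) : D := cfcₙ (fun x : ℝ => min (max (x - s) 0) w) a

variable {s w : ℝ} {a : D}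

theorem layerFun_zero (hs : 0 ≤ s) (hw : 0 ≤ w) : min (max ((0 : ℝ) - s) 0) w = 0 := by
  rw [max_eq_right (by linarith), min_eq_left hw]

theorem layer_nonneg (hw : 0 ≤ w) (a : D) : 0 ≤ layer s w a :=
  cfcₙ_nonneg fun x _ => le_min (le_max_right _ _) hw

theorem norm_layer_le (hw : 0 ≤ w) (a : D) : ‖layer s w a‖ ≤ w :=
  norm_cfcₙ_le fun x _ => by
    rw [Real.norm_eq_abs, abs_of_nonneg (le_min (le_max_right _ _) hw)]
    exact min_le_right _ _

theorem sum_layerFun (hw : 0 ≤ w) {x : ℝ} (hx : 0 ≤ x) (n : ℕ) :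
    ∑ k ∈ Finset.range n, min (max (x - k * w) 0) w = min x (n * w) := by
  induction n with
  | zero => simp [hx]
  | succ n ih =>
    rw [Finset.sum_range_succ, ih, Nat.cast_succ, add_mul, one_mul]
    rcases le_total x (n * w) with h | h
    · rw [min_eq_left h, max_eq_right (by linarith), min_eq_left hw,
        min_eq_left (by linarith), add_zero]
    · rw [min_eq_right h, max_eq_left (by linarith), ← min_add_add_left]
      congr 1
      ring

theorem le_norm_of_mem_quasispectrum (ha : 0 ≤ a) {x : ℝ} (hx : x ∈ quasispectrum ℝ a) :
    x ≤ ‖a‖ := by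
  have h1 := norm_apply_le_norm_cfcₙ (fun x : ℝ => x) a hx
  rw [cfcₙ_id' ℝ a, Real.norm_eq_abs] at h1
  exact (le_abs_self x).trans h1

theorem sum_layer (ha : 0 ≤ a) (hw : 0 ≤ w) {n : ℕ} (hn : ‖a‖ ≤ n * w) :
    ∑ k ∈ Finset.range n, layer (k * w) w a = a := by
  unfold layer
  rw [← cfcₙ_sum (fun (k : ℕ) (x : ℝ) => min (max (x - k * w) 0) w) a (Finset.range n)
    (fun k _ => by fun_prop) (fun k _ => layerFun_zero (by positivity) hw)]
  conv_rhs => rw [← cfcₙ_id' ℝ a]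
  refine cfcₙ_congr fun x hx => ?_
  rw [Finset.sum_fn]
  dsimp only
  rw [sum_layerFun hw (spec_nonneg ha hx), min_eq_left ((le_norm_of_mem_quasispectrum ha hx).trans hn)]

theorem map_layer {E : Type*} [NonUnitalCStarAlgebra E] [PartialOrder E] [StarOrderedRing E]
    (φ : D →⋆ₙₐ[ℂ] E) (hs : 0 ≤ s) (hw : 0 ≤ w) (ha : 0 ≤ a) :
    φ (layer s w a) = layer s w (φ a) := by
  have hsa : IsSelfAdjoint a := .of_nonneg ha
  exact φ.map_cfcₙ _ a (by fun_prop) (layerFun_zero hs hw) (homCLM φ).continuous hsa (hsa.map φ)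

theorem layer_cuntzLE_cut (hs : 0 ≤ s) (hw : 0 ≤ w) (ha : 0 ≤ a) :
    CuntzLE (layer s w a) (cut s a) :=
  CuntzLE.cfcₙ_of_le 1 ha zero_le_one (by fun_prop) (by fun_prop) (layerFun_zero hs hw)
    (by simpa using hs) (fun x _ => le_min (le_max_right _ _) hw)
    fun x _ => by rw [one_mul]; exact min_le_left _ _

theorem cut_layer {t : ℝ} (hs : 0 ≤ s) (hw : 0 ≤ w) (ht : 0 ≤ t) (ha : 0 ≤ a) :
    cut t (layer s w a) = cfcₙ (fun x : ℝ => max (min (max (x - s) 0) w - t) 0) a := by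
  unfold cut layer
  rw [← cfcₙ_comp' (fun x : ℝ => max (x - t) 0) (fun x : ℝ => min (max (x - s) 0) w) a
    (by fun_prop) (by simpa using ht) (by fun_prop) (layerFun_zero hs hw)]

/-- Where `x ≥ s + w` the layer has its full height `w`, so cutting it at `t < w` leaves the
positive constant `w - t`. -/
theorem cut_cuntzLE_cut_layer {t : ℝ} (hs : 0 ≤ s) (hw : 0 ≤ w) (ht : 0 ≤ t) (htw : t < w)
    (ha : 0 ≤ a) : CuntzLE (cut (s + w) a) (cut t (layer s w a)) := by
  rw [cut_layer hs hw ht ha]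
  have hwt : 0 < w - t := sub_pos.2 htw
  refine CuntzLE.cfcₙ_of_le (‖a‖ / (w - t)) ha (by positivity) (by fun_prop) (by fun_prop)
    ?_ ?_ (fun x _ => le_max_right _ _) fun x hx => ?_
  · rw [max_eq_right (by linarith)]
  · rw [layerFun_zero hs hw, max_eq_right (by linarith)]
  · rcases le_total x (s + w) with h | h
    · rw [max_eq_right (by linarith)]
      exact mul_nonneg (by positivity) (le_max_right _ _)
    · rw [max_eq_left (by linarith : 0 ≤ x - (s + w)), max_eq_left (by linarith : 0 ≤ x - s),
        min_eq_right (by linarith), max_eq_left hwt.le, div_mul_cancel₀ _ hwt.ne']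
      have := le_norm_of_mem_quasispectrum ha hx
      linarith

/-- The layer is constantly `w` on the support of `(x - s - w)₊`: divided by `w` it acts there as a
unit. -/
theorem layer_mul_sqrt_cut (hs : 0 ≤ s) (hw : 0 < w) (ha : 0 ≤ a) :
    layer s w a * CFC.sqrt (cut (s + w) a) = w • CFC.sqrt (cut (s + w) a) := by
  have h0 : max ((0 : ℝ) - (s + w)) 0 = 0 := max_eq_right (by linarith)
  have e : CFC.sqrt (cut (s + w) a) = cfcₙ (fun x : ℝ => √(max (x - (s + w)) 0)) a := by
    rw [CFC.sqrt_eq_real_sqrt _ (cut_nonneg _ _), cut,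
      ← cfcₙ_comp' Real.sqrt (fun x : ℝ => max (x - (s + w)) 0) a (by fun_prop)
        Real.sqrt_zero (by fun_prop) h0]
  rw [e, layer, ← cfcₙ_mul (fun x : ℝ => min (max (x - s) 0) w)
    (fun x : ℝ => √(max (x - (s + w)) 0)) a (by fun_prop) (layerFun_zero hs hw.le) (by fun_prop)
    (by rw [h0, Real.sqrt_zero]), ← cfcₙ_smul w _ a (by fun_prop) (by rw [h0, Real.sqrt_zero])]
  refine cfcₙ_congr fun x hx => ?_
  rw [smul_eq_mul]
  rcases le_total x (s + w) with h | h
  · rw [max_eq_right (by linarith : x - (s + w) ≤ 0), Real.sqrt_zero, mul_zero, mul_zero]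
  · rw [max_eq_left (by linarith : 0 ≤ x - s), min_eq_right (by linarith)]

theorem mul_self_le_of_norm_le_one {e : D} (he : 0 ≤ e) (h1 : ‖e‖ ≤ 1) : e * e ≤ e := by
  have h : e * e = cfcₙ (fun x : ℝ => x * x) e := by
    rw [cfcₙ_mul (fun x : ℝ => x) (fun x : ℝ => x) e, cfcₙ_id' ℝ e]
  rw [h]
  conv_rhs => rw [← cfcₙ_id' ℝ e]
  refine cfcₙ_mono fun x hx => ?_
  have h2 := (le_norm_of_mem_quasispectrum he hx).trans h1
  have h3 := spec_nonneg he hx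
  nlinarith

end Layer

/-! ### Dimension functions, and traces as integrals of ranks of cut-downs. -/

section Rank

variable {B : Type*} [NonUnitalCStarAlgebra B]

/-- The real part of a trace. -/
def reTrace (τ : TraceBall B) : B →ₗ[ℝ] ℝ where
  toFun b := (τ.1 b).re
  map_add' x y := by rw [map_add, Complex.add_re]
  map_smul' r x := by
    rw [← Complex.coe_smul, map_smul, smul_eq_mul, Complex.re_ofReal_mul]
    rfl

theorem reTrace_apply (τ : TraceBall B) (b : B) : reTrace τ b = (τ.1 b).re := rfl

theorem reTrace_mul_comm (τ : TraceBall B) (x y : B) :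
    reTrace τ (x * y) = reTrace τ (y * x) := by
  rw [reTrace_apply, τ.2.1.2, reTrace_apply]

theorem abs_reTrace_le (τ : TraceBall B) (x : B) : |reTrace τ x| ≤ ‖x‖ := by
  refine (Complex.abs_re_le_norm _).trans ?_
  refine ((WeakDual.toStrongDual τ.1).le_opNorm x).trans ?_
  exact mul_le_of_le_one_left (norm_nonneg _) τ.2.2

variable [PartialOrder B] [StarOrderedRing B]

theorem reTrace_nonneg (τ : TraceBall B) {x : B} (hx : 0 ≤ x) : 0 ≤ reTrace τ x := by
  obtain ⟨y, rfl⟩ := isPos_iff_nonneg.2 hx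
  exact (τ.2.1.1 y).1

theorem reTrace_mono (τ : TraceBall B) {x y : B} (h : x ≤ y) : reTrace τ x ≤ reTrace τ y := by
  have := reTrace_nonneg τ (sub_nonneg.2 h)
  rw [map_sub] at this
  linarith

/-- The dimension function of `τ`. -/
def rank (τ : TraceBall B) (b : B) : ℝ :=
  sSup {d : ℝ | ∃ c : B, 0 ≤ c ∧ ‖c‖ ≤ 1 ∧ CuntzLE c b ∧ reTrace τ c = d}

theorem reTrace_le_rank (τ : TraceBall B) {b c : B} (hc : 0 ≤ c) (h1 : ‖c‖ ≤ 1)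
    (h : CuntzLE c b) : reTrace τ c ≤ rank τ b := by
  refine le_csSup ⟨1, ?_⟩ ⟨c, hc, h1, h, rfl⟩
  rintro _ ⟨c, _, hc, _, rfl⟩
  exact (le_abs_self _).trans ((abs_reTrace_le τ c).trans hc)

theorem rank_le (τ : TraceBall B) {b : B} {d : ℝ}
    (h : ∀ c : B, 0 ≤ c → ‖c‖ ≤ 1 → CuntzLE c b → reTrace τ c ≤ d) : rank τ b ≤ d := by
  refine csSup_le ⟨_, 0, le_rfl, by simp, CuntzLE.zero b, rfl⟩ ?_
  rintro _ ⟨c, hc, h1, hcb, rfl⟩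
  exact h c hc h1 hcb

theorem rank_nonneg (τ : TraceBall B) (b : B) : 0 ≤ rank τ b := by
  simpa using reTrace_le_rank τ le_rfl (by simp : ‖(0 : B)‖ ≤ 1) (CuntzLE.zero b)

theorem rank_le_one (τ : TraceBall B) (b : B) : rank τ b ≤ 1 :=
  rank_le τ fun c _ hc _ => (le_abs_self _).trans ((abs_reTrace_le τ c).trans hc)

theorem rank_mono (τ : TraceBall B) {a b : B} (h : CuntzLE a b) : rank τ a ≤ rank τ b :=
  rank_le τ fun _ hc h1 hca => reTrace_le_rank τ hc h1 (hca.trans h)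

/-- If `c` is near `r b r*`, move to `W = √b r* r √b`, which has the same trace and norm as `r b
r*`. As `e` is a unit for `√b`, `W = e W e ≤ ‖W‖ e`, and `‖W‖` is nearly at most `1`. -/
theorem rank_le_reTrace (τ : TraceBall B) {b e : B} (hb : 0 ≤ b) (he : 0 ≤ e) (he1 : ‖e‖ ≤ 1)
    (heb : e * CFC.sqrt b = CFC.sqrt b) : rank τ b ≤ reTrace τ e := by
  refine rank_le τ fun c hc h1 hcb => le_of_forall_pos_le_add fun ε hε => ?_
  obtain ⟨r, hr⟩ := hcb (ε / 2) (half_pos hε)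
  set v := CFC.sqrt b with hv
  have hvsa : star v = v := IsSelfAdjoint.of_nonneg (CFC.sqrt_nonneg b)
  have hesa : star e = e := IsSelfAdjoint.of_nonneg he
  have hvv : v * v = b := CFC.sqrt_mul_sqrt_self b hb
  have hve : v * e = v := by rw [← hvsa, ← hesa, ← star_mul, heb]
  set W := star (r * v) * (r * v) with hW
  have hn : ‖W‖ ≤ 1 + ε / 2 := by
    have e1 : ‖W‖ = ‖r * b * star r‖ := by
      rw [hW, CStarRing.norm_star_mul_self, ← CStarRing.norm_self_mul_star, star_mul, hvsa, ← hvv]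
      congr 1
      noncomm_ring
    rw [e1]
    have := norm_add_le (r * b * star r - c) c
    rw [sub_add_cancel] at this
    linarith
  have hWe : W = e * W * e := by
    rw [hW, star_mul, hvsa]
    calc v * star r * (r * v) = (e * v) * star r * (r * (v * e)) := by rw [heb, hve]
      _ = _ := by noncomm_ring
  have h2 : reTrace τ W ≤ ‖W‖ * reTrace τ e := by
    have h3 : W ≤ ‖W‖ • (e * e) := by
      have := CStarAlgebra.star_left_conjugate_le_norm_smul (a := e) (b := W)
        (hb := .of_nonneg (star_mul_self_nonneg _))
      rw [hesa] at this
      rwa [← hWe] at this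
    refine (reTrace_mono τ h3).trans ?_
    rw [map_smul, smul_eq_mul]
    exact mul_le_mul_of_nonneg_left (reTrace_mono τ (mul_self_le_of_norm_le_one he he1))
      (norm_nonneg _)
  have h3 : reTrace τ (r * b * star r) = reTrace τ W := by
    rw [hW, star_mul, hvsa, ← hvv, reTrace_mul_comm τ (v * star r)]
    congr 1
    noncomm_ring
  have h4 := (neg_abs_le _).trans (le_refl (reTrace τ (r * b * star r - c)))
  have h5 := abs_reTrace_le τ (r * b * star r - c)
  rw [map_sub] at h4 h5
  have h6 : reTrace τ e ≤ 1 := (le_abs_self _).trans ((abs_reTrace_le τ e).trans he1)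
  have h7 := reTrace_nonneg τ he
  have h8 : ‖W‖ * reTrace τ e ≤ (1 + ε / 2) * reTrace τ e := mul_le_mul_of_nonneg_right hn h7
  have h9 := neg_abs_le (reTrace τ (r * b * star r) - reTrace τ c)
  nlinarith

/-- Upper Riemann sums. -/
theorem nsmul_reTrace_le_sum_rank (τ : TraceBall B) {a : B} (ha : 0 ≤ a) (h1 : ‖a‖ ≤ 1) {n : ℕ}
    (hn : 0 < n) : n * reTrace τ a ≤ ∑ k ∈ Finset.range n, rank τ (cut (k * (1 / n : ℝ)) a) := by
  have hn' : (0 : ℝ) < n := Nat.cast_pos.2 hn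
  have hw : (0 : ℝ) ≤ 1 / n := by positivity
  conv_lhs => rw [← sum_layer ha hw (n := n) (by rwa [mul_one_div_cancel hn'.ne'])]
  rw [map_sum, Finset.mul_sum]
  refine Finset.sum_le_sum fun k _ => ?_
  rw [← smul_eq_mul, ← map_smul]
  -- `n` times a layer of height `1/n` is a contraction Cuntz-below the cut-down at its lower end.
  refine reTrace_le_rank τ (smul_nonneg hn'.le (layer_nonneg hw a)) ?_
    ((CuntzLE.smul hn'.le _).trans (layer_cuntzLE_cut (by positivity) hw ha))
  rw [norm_smul, Real.norm_eq_abs, abs_of_pos hn']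
  calc _ ≤ (n : ℝ) * (1 / n) := mul_le_mul_of_nonneg_left (norm_layer_le hw a) hn'.le
    _ = 1 := mul_one_div_cancel hn'.ne'

/-- Lower Riemann sums. -/
theorem sum_rank_le_nsmul_reTrace (τ : TraceBall B) {a : B} (ha : 0 ≤ a) (h1 : ‖a‖ ≤ 1) {n : ℕ}
    (hn : 0 < n) :
    ∑ k ∈ Finset.range n, rank τ (cut ((k + 1 : ℕ) * (1 / n : ℝ)) a) ≤ n * reTrace τ a := by
  have hn' : (0 : ℝ) < n := Nat.cast_pos.2 hn
  have hw : (0 : ℝ) < 1 / n := by positivity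
  conv_rhs => rw [← sum_layer ha hw.le (n := n) (by rwa [mul_one_div_cancel hn'.ne'])]
  rw [map_sum, Finset.mul_sum]
  refine Finset.sum_le_sum fun k _ => ?_
  refine le_trans ?_ (map_smul (reTrace τ) (n : ℝ) _).le
  -- The same contraction is a unit for the cut-down at the upper end of the layer.
  refine rank_le_reTrace τ (cut_nonneg _ _) (smul_nonneg hn'.le (layer_nonneg hw.le a)) ?_ ?_
  · rw [norm_smul, Real.norm_eq_abs, abs_of_pos hn']
    calc _ ≤ (n : ℝ) * (1 / n) := mul_le_mul_of_nonneg_left (norm_layer_le hw.le a) hn'.le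
      _ = 1 := mul_one_div_cancel hn'.ne'
  · rw [Nat.cast_succ, add_mul, one_mul, smul_mul_assoc,
      layer_mul_sqrt_cut (by positivity) hw ha, smul_smul, mul_one_div_cancel hn'.ne', one_smul]

/-- The truncated index `k - 1` repeats `u 0` once and drops the last term, which is at least `E`.
-/
theorem sum_sub_one_le {u : ℕ → ℝ} {E : ℝ} {n : ℕ} (hE : ∀ i < n, E ≤ u i) (h0 : E ≤ u 0) :
    ∑ k ∈ Finset.range n, u (k - 1) ≤ ∑ k ∈ Finset.range n, u k + (u 0 - E) := by
  rcases n with _ | n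
  · simpa using h0
  · rw [Finset.sum_range_succ', Finset.sum_range_succ]
    have := hE n n.lt_succ_self
    simp only [Nat.add_sub_cancel, Nat.zero_sub]
    linarith

theorem sum_sub_le {u : ℕ → ℝ} {E : ℝ} {n : ℕ} (hE : ∀ i < n, E ≤ u i) (h0 : E ≤ u 0) (m : ℕ) :
    ∑ k ∈ Finset.range n, u (k - m) ≤ ∑ k ∈ Finset.range n, u k + m * (u 0 - E) := by
  induction m with
  | zero => simp
  | succ m ih =>
    have := sum_sub_one_le (u := fun k => u (k - m)) (n := n) (E := E)
      (fun i hi => hE _ (lt_of_le_of_lt (Nat.sub_le _ _) hi)) (by simpa using h0)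
    simp only [Nat.zero_sub] at this
    have e : ∀ k, k - 1 - m = k - (m + 1) := fun k => by omega
    simp only [e] at this
    push_cast
    linarith

/-- The trace is the integral of `t ↦ rank τ ((b - t)₊)` over `[0, 1]`; shifting this decreasing
function to the right by `r`, continued by its initial value, adds at most `r` times its drop from
`rank τ b` to `E`. -/
theorem reTrace_le_of_rank_le (τ : TraceBall B) {a b : B} (ha : 0 ≤ a) (ha1 : ‖a‖ ≤ 1)
    (hb : 0 ≤ b) (hb1 : ‖b‖ ≤ 1) {r E : ℝ} (hr : 0 ≤ r)
    (h : ∀ t : ℝ, 0 ≤ t → t < 1 → rank τ (cut t a) ≤ rank τ (cut (max (t - r) 0) b))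
    (hE : ∀ t : ℝ, 0 ≤ t → t < 1 → E ≤ rank τ (cut t b)) :
    reTrace τ a ≤ reTrace τ b + r * (rank τ b - E) := by
  -- Riemann sums with mesh `1/n`, where the shift by `r` becomes one by `m = ⌈r n⌉` steps. The
  -- rounding and the gap between upper and lower sums cost a bounded amount after multiplication by
  -- `n`, so they vanish in the limit.
  have key : ∀ n : ℕ, 0 < n →
      n * (reTrace τ a - reTrace τ b - r * (rank τ b - E)) ≤ 1 + (rank τ b - E) := fun n hn => by
    have hn' : (0 : ℝ) < n := Nat.cast_pos.2 hn
    set m := ⌈r * n⌉₊ with hm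
    set u : ℕ → ℝ := fun k => rank τ (cut (k * (1 / n : ℝ)) b) with hu
    have hlt : ∀ i < n, (i : ℝ) * (1 / n) < 1 := fun i hi => by
      rw [mul_one_div, div_lt_one hn']
      exact_mod_cast hi
    have hu0 : u 0 = rank τ b := by
      simp only [hu, Nat.cast_zero, zero_mul]
      rw [cut_zero hb]
    have hEu : ∀ i < n, E ≤ u i := fun i hi => hE _ (by positivity) (hlt i hi)
    have h1 := nsmul_reTrace_le_sum_rank τ ha ha1 hn
    have h2 : ∑ k ∈ Finset.range n, rank τ (cut (k * (1 / n : ℝ)) a) ≤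
        ∑ k ∈ Finset.range n, u (k - m) := by
      refine Finset.sum_le_sum fun k hk => ?_
      refine (h _ (by positivity) (hlt k (Finset.mem_range.1 hk))).trans ?_
      refine rank_mono τ (CuntzLE.cut_mono (by positivity) ?_ hb)
      rcases le_total k m with hkm | hkm
      · rw [Nat.sub_eq_zero_of_le hkm, Nat.cast_zero, zero_mul]
        exact le_max_right _ _
      · refine le_trans ?_ (le_max_left _ _)
        rw [Nat.cast_sub hkm, sub_mul]
        have : r * n ≤ m := Nat.le_ceil _
        rw [sub_le_sub_iff_left, mul_one_div, le_div_iff₀ hn']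
        exact this
    have h3 := sum_sub_le hEu (hEu 0 hn) m
    have h4 := sum_rank_le_nsmul_reTrace τ hb hb1 hn
    have h5 : ∑ k ∈ Finset.range n, u k ≤ u 0 + ∑ k ∈ Finset.range n, u (k + 1) := by
      have := Finset.sum_range_succ u n
      rw [Finset.sum_range_succ'] at this
      have := rank_nonneg τ (cut ((n : ℕ) * (1 / n : ℝ)) b)
      have : 0 ≤ u n := this
      linarith
    have h6 : (m : ℝ) ≤ r * n + 1 := (Nat.ceil_lt_add_one (by positivity)).le
    have h7 : 0 ≤ u 0 - E := sub_nonneg.2 (hEu 0 hn)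
    have h8 : (m : ℝ) * (u 0 - E) ≤ (r * n + 1) * (u 0 - E) := mul_le_mul_of_nonneg_right h6 h7
    have h9 : u 0 ≤ 1 := rank_le_one τ _
    rw [← hu0]
    have h4' : ∑ k ∈ Finset.range n, u (k + 1) ≤ n * reTrace τ b := h4
    nlinarith
  by_contra hcon
  have hpos : 0 < reTrace τ a - reTrace τ b - r * (rank τ b - E) := by linarith [not_le.1 hcon]
  obtain ⟨n, hn⟩ := exists_nat_gt ((1 + (rank τ b - E)) / (reTrace τ a - reTrace τ b - r * (rank τ b - E)))
  rw [div_lt_iff₀ hpos] at hn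
  have h1 := key (n + 1) n.succ_pos
  push_cast at h1
  nlinarith

/-- The error on layer `k` is `r` times the drop of rank between heights `k` and `k + 1` of `y`.
These drops telescope to at most `1`, so the bound does not grow with the number of layers. -/
theorem reTrace_sub_le_of_cuntzLE (τ : TraceBall B) {x y : B} (hx : 0 ≤ x) (hy : 0 ≤ y) {L : ℕ}
    (hxL : ‖x‖ ≤ L) (hyL : ‖y‖ ≤ L) {r : ℝ} (hr : 0 ≤ r)
    (h : ∀ k < L, ∀ t : ℝ, 0 ≤ t → t < 1 →
      CuntzLE (cut t (layer k 1 x)) (cut (max (t - r) 0) (layer k 1 y))) :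
    reTrace τ x - reTrace τ y ≤ r := by
  have h1 : ∀ k ∈ Finset.range L, reTrace τ (layer k 1 x) - reTrace τ (layer k 1 y) ≤
      r * (rank τ (cut k y) - rank τ (cut (k + 1 : ℕ) y)) := fun k hk => by
    have h2 := reTrace_le_of_rank_le τ (layer_nonneg zero_le_one x) (norm_layer_le zero_le_one x)
      (layer_nonneg zero_le_one y) (norm_layer_le zero_le_one y) hr
      (fun t h0 h1 => rank_mono τ (h k (Finset.mem_range.1 hk) t h0 h1))
      (E := rank τ (cut (k + 1 : ℕ) y))
      (fun t h0 h1 => rank_mono τ (by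
        rw [Nat.cast_succ]
        exact cut_cuntzLE_cut_layer (by positivity) zero_le_one h0 h1 hy))
    have h3 := rank_mono τ (layer_cuntzLE_cut (s := k) (by positivity) zero_le_one hy)
    have h4 := mul_le_mul_of_nonneg_left h3 hr
    rw [mul_sub] at h2 ⊢
    linarith
  have h2 := Finset.sum_le_sum h1
  rw [← Finset.mul_sum, Finset.sum_range_sub' (fun k : ℕ => rank τ (cut k y)),
    Finset.sum_sub_distrib, ← map_sum, ← map_sum] at h2
  have hxs := sum_layer hx zero_le_one (n := L) (by simpa using hxL)
  have hys := sum_layer hy zero_le_one (n := L) (by simpa using hyL)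
  simp only [mul_one] at hxs hys
  rw [hxs, hys] at h2
  have h3 := rank_le_one τ (cut (0 : ℕ) y)
  have h4 := rank_nonneg τ (cut (L : ℕ) y)
  refine h2.trans (mul_le_of_le_one_right hr (by linarith))

end Rank

end CuntzSemigroup
end


noncomputable section

namespace CuntzSemigroup

open scoped ComplexStarModule

/-! ### Jordan decomposition of differences of traces. -/

section Jordan

variable {A : Type*} [NonUnitalCStarAlgebra A] [PartialOrder A] [StarOrderedRing A]

/-- Bounded traces on the positive cone. -/
structure IsConeTrace (p : A → ℝ) (d : ℝ) : Prop where
  nonneg : ∀ x, 0 ≤ x → 0 ≤ p x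
  add : ∀ x y, 0 ≤ x → 0 ≤ y → p (x + y) = p x + p y
  le_norm : ∀ x, 0 ≤ x → p x ≤ d * ‖x‖
  trace : ∀ z, p (star z * z) = p (z * star z)

/-- Polarisation with `z = a* + b` and `z = a* + i b`. -/
theorem isTrace_of_star_mul_self {ρ : WeakDual ℂ A}
    (h0 : ∀ a, 0 ≤ (ρ (star a * a)).re ∧ (ρ (star a * a)).im = 0)
    (h : ∀ z, ρ (star z * z) = ρ (z * star z)) : IsTrace ρ := by
  refine ⟨h0, fun a b => ?_⟩
  have h1 := h (star a + b)
  have h2 := h (star a + Complex.I • b)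
  simp only [star_add, star_smul, star_star, mul_add, add_mul, smul_mul_assoc, mul_smul_comm,
    map_add, map_smul, smul_eq_mul, RCLike.star_def, Complex.conj_I] at h1 h2
  have h3 := h (star a)
  have h4 := h b
  rw [star_star] at h3
  have hI := Complex.I_mul_I
  rw [h3, h4] at h1 h2
  linear_combination (1 / 2 : ℂ) * h1 - (Complex.I / 2) * h2 + 
    (1 / 2 : ℂ) * (ρ (a * b) - ρ (b * a) - ρ (star b * star a) + ρ (star a * star b)) * hI

theorem IsConeTrace.sub_eq_sub {p : A → ℝ} {d : ℝ} (hp : IsConeTrace p d) {u v u' v' : A}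
    (hu : 0 ≤ u) (hv : 0 ≤ v) (hu' : 0 ≤ u') (hv' : 0 ≤ v') (h : u - v = u' - v') :
    p u - p v = p u' - p v' := by
  have h1 : u + v' = u' + v := by
    rw [← sub_eq_zero] at h ⊢
    rw [← h]
    abel
  have h2 := congrArg p h1
  rw [hp.add _ _ hu hv', hp.add _ _ hu' hv] at h2
  linarith

/-- Extend `p` by `p(h⁺) - p(h⁻)` to self-adjoint `h` and complexify. `IsConeTrace.sub_eq_sub` makes
this independent of the chosen difference, hence additive; each part contributes at most `d` to the
norm. -/
theorem IsConeTrace.exists_trace {p : A → ℝ} {d : ℝ} (hp : IsConeTrace p d) (hd : 0 ≤ d) :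
    ∃ ρ : WeakDual ℂ A, IsTrace ρ ∧ (∀ x, 0 ≤ x → (ρ x).re = p x) ∧
      ‖WeakDual.toStrongDual ρ‖ ≤ 2 * d := by
  have hdec : ∀ a : A, (ℜ a : A)⁺ - (ℜ a : A)⁻ = (ℜ a : A) := fun a =>
    CFC.posPart_sub_negPart _ (ℜ a).2
  have hp0 : ∀ a : A, 0 ≤ (ℜ a : A)⁺ := fun a => CFC.posPart_nonneg _
  have hn0 : ∀ a : A, 0 ≤ (ℜ a : A)⁻ := fun a => CFC.negPart_nonneg _
  let g : A →+ ℝ := AddMonoidHom.mk' (fun a => p (ℜ a : A)⁺ - p (ℜ a : A)⁻) fun a b => by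
    rw [hp.sub_eq_sub (hp0 (a + b)) (hn0 (a + b)) (add_nonneg (hp0 a) (hp0 b))
      (add_nonneg (hn0 a) (hn0 b)), hp.add _ _ (hp0 a) (hp0 b), hp.add _ _ (hn0 a) (hn0 b)]
    · ring
    · rw [hdec, add_sub_add_comm, hdec, hdec, map_add]
      rfl
  have hg : ∀ a, g a = p (ℜ a : A)⁺ - p (ℜ a : A)⁻ := fun a => rfl
  have hbound : ∀ a, ‖g a‖ ≤ 2 * d * ‖a‖ := fun a => by
    have hr : ‖(ℜ a : A)‖ ≤ ‖a‖ := realPart.norm_le a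
    have h1 : p (ℜ a : A)⁺ ≤ d * ‖a‖ := (hp.le_norm _ (hp0 a)).trans
      (mul_le_mul_of_nonneg_left ((CStarAlgebra.norm_posPart_le _).trans hr) hd)
    have h2 : p (ℜ a : A)⁻ ≤ d * ‖a‖ := (hp.le_norm _ (hn0 a)).trans
      (mul_le_mul_of_nonneg_left ((CStarAlgebra.norm_negPart_le _).trans hr) hd)
    have h3 := hp.nonneg _ (hp0 a)
    have h4 := hp.nonneg _ (hn0 a)
    have h5 : 0 ≤ d * ‖a‖ := by positivity
    rw [hg, Real.norm_eq_abs, abs_le]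
    constructor <;> linarith
  have hcont : Continuous g := AddMonoidHomClass.continuous_of_bound g (2 * d) hbound
  -- Homogeneity was not assumed of `p`: an additive bounded map is continuous and therefore real
  -- linear.
  let G : StrongDual ℝ A := g.toRealLinearMap hcont
  have hG : ∀ a, G a = g a := fun a => rfl
  let ρ : WeakDual ℂ A := StrongDual.toWeakDual (StrongDual.extendRCLike (𝕜 := ℂ) G)
  have hre : ∀ a, (ρ a).re = g a := fun a => by
    exact Module.Dual.re_extendRCLike_apply (𝕜 := ℂ) G.toLinearMap a
  have him : ∀ a, IsSelfAdjoint a → (ρ a).im = 0 := fun a ha => by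
    have h1 : (ρ a).im = -(ρ (Complex.I • a)).re := by
      rw [map_smul, smul_eq_mul, Complex.I_mul_re, neg_neg]
    have h2 : ℜ (Complex.I • a) = 0 := by
      rw [realPart_I_smul, ha.imaginaryPart, neg_zero]
    rw [h1, hre, hg, h2]
    simp
  have hpos : ∀ x, 0 ≤ x → (ρ x).re = p x := fun x hx => by
    have h0 : p 0 = 0 := by
      have := hp.add 0 0 le_rfl le_rfl
      rw [add_zero] at this
      linarith
    have h1 : (ℜ x : A) = x := (IsSelfAdjoint.of_nonneg hx).coe_realPart
    rw [hre, hg, hp.sub_eq_sub (hp0 x) (hn0 x) hx le_rfl (by rw [hdec, h1, sub_zero]), h0, sub_zero]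
  refine ⟨ρ, isTrace_of_star_mul_self (fun a => ⟨?_, him _ (.star_mul_self a)⟩) fun z => ?_, hpos, ?_⟩
  · rw [hpos _ (star_mul_self_nonneg a)]
    exact hp.nonneg _ (star_mul_self_nonneg a)
  · apply Complex.ext
    · rw [hpos _ (star_mul_self_nonneg z), hpos _ (mul_star_self_nonneg z), hp.trace]
    · rw [him _ (.star_mul_self z), him _ (.mul_star_self z)]
  · change ‖StrongDual.extendRCLike (𝕜 := ℂ) G‖ ≤ _
    rw [StrongDual.norm_extendRCLike]
    exact ContinuousLinearMap.opNorm_le_bound _ (by positivity) hbound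

theorem norm_invSqrt_conj_le {δ : ℝ} (hδ : 0 < δ) {y S : A} (hy : 0 ≤ y) (hyS : y ≤ S) :
    ‖invSqrt δ S * y * invSqrt δ S‖ ≤ 1 := by
  have hS : 0 ≤ S := hy.trans hyS
  have hg := isSelfAdjoint_invSqrt δ S
  have h1 : 0 ≤ invSqrt δ S * y * invSqrt δ S := by
    simpa [hg.star_eq] using star_left_conjugate_nonneg hy (invSqrt δ S)
  have h2 : invSqrt δ S * y * invSqrt δ S ≤ invSqrt δ S * S * invSqrt δ S := by
    simpa [hg.star_eq] using star_left_conjugate_le_conjugate hyS (invSqrt δ S)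
  refine (CStarAlgebra.norm_le_norm_of_nonneg_of_le h1 h2).trans ?_
  rw [invSqrt_conj_eq hδ hS]
  refine norm_cfcₙ_le fun s hs => ?_
  have hs0 := spec_nonneg hS hs
  rw [sq_invSqrtFun hs0, Real.norm_eq_abs, abs_of_nonneg (by positivity), ← mul_div_assoc,
    div_le_one (by positivity)]
  nlinarith

variable (f : A →ₗ[ℝ] ℝ) {d : ℝ}

/-- The positive variation of a functional on the positive cone. -/
def posVar (x : A) : ℝ := sSup {s : ℝ | ∃ y, 0 ≤ y ∧ y ≤ x ∧ f y = s}

variable {f}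

theorem le_posVar (hd : 0 ≤ d) (hb : ∀ x, |f x| ≤ d * ‖x‖) {x y : A} (hy : 0 ≤ y) (h : y ≤ x) :
    f y ≤ posVar f x := by
  refine le_csSup ⟨d * ‖x‖, ?_⟩ ⟨y, hy, h, rfl⟩
  rintro _ ⟨z, hz, hzx, rfl⟩
  exact ((le_abs_self _).trans (hb z)).trans
    (mul_le_mul_of_nonneg_left (CStarAlgebra.norm_le_norm_of_nonneg_of_le hz hzx) hd)

theorem posVar_le {x : A} (hx : 0 ≤ x) {c : ℝ} (h : ∀ y, 0 ≤ y → y ≤ x → f y ≤ c) :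
    posVar f x ≤ c := by
  refine csSup_le ⟨_, 0, le_rfl, hx, rfl⟩ ?_
  rintro _ ⟨y, hy, hyx, rfl⟩
  exact h y hy hyx

/-- Conjugating `y ≤ S` by an approximate square root of `S⁻¹`. -/
theorem exists_le_conj_add (hd : 0 ≤ d) (hb : ∀ x, |f x| ≤ d * ‖x‖)
    (htr : ∀ x y, f (x * y) = f (y * x)) {y S : A} (hy : 0 ≤ y) (hyS : y ≤ S) {ε : ℝ}
    (hε : 0 < ε) : ∃ Z : A, f y ≤ f (star Z * S * Z) + ε ∧
      ∀ w : A, f (star Z * (star w * w) * Z) ≤ posVar f (w * star w) := by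
  obtain ⟨δ, hδ, hlt⟩ := exists_pos_sqrt_mul_lt (‖CFC.sqrt y‖ * d) hε
  set v := CFC.sqrt y with hv
  set g := invSqrt δ S with hgdef
  have hg : star g = g := isSelfAdjoint_invSqrt δ S
  have hvs : star v = v := IsSelfAdjoint.of_nonneg (CFC.sqrt_nonneg y)
  have hvv : v * v = y := CFC.sqrt_mul_sqrt_self y hy
  refine ⟨g * v, ?_, fun w => ?_⟩
  · have h1 := norm_sqrt_conj_sub_le hδ hy hyS
    have h2 := hb (v * (g * S * g) * v - y)
    have e : star (g * v) * S * (g * v) = v * (g * S * g) * v := by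
      rw [star_mul, hg, hvs]
      noncomm_ring
    rw [e]
    rw [map_sub] at h2
    have h3 := neg_abs_le (f (v * (g * S * g) * v) - f y)
    have h4 := mul_le_mul_of_nonneg_left h1 hd
    have h5 : d * (√δ * ‖v‖) = √δ * (‖v‖ * d) := by ring
    linarith
  -- By the trace property the value is that of `w (g y g) w*`, which lies between `0` and `w w*`
  -- because `‖g y g‖ ≤ 1`.
  · have e1 : f (star (g * v) * (star w * w) * (g * v)) = f (w * (g * y * g) * star w) := by
      have : star (g * v) * (star w * w) * (g * v) = (v * g * star w) * (w * g * v) := by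
        rw [star_mul, hg, hvs]
        noncomm_ring
      rw [this, htr, ← hvv]
      congr 1
      noncomm_ring
    rw [e1]
    have hc : 0 ≤ g * y * g := by
      simpa [hg] using star_left_conjugate_nonneg hy g
    refine le_posVar hd hb (star_right_conjugate_nonneg hc w) ?_
    have h1 := CStarAlgebra.star_right_conjugate_le_norm_smul (a := w) (b := g * y * g)
      (hb := .of_nonneg hc)
    refine h1.trans ?_
    have h2 : (1 - ‖g * y * g‖) • (w * star w) ≥ 0 :=
      smul_nonneg (sub_nonneg.2 (norm_invSqrt_conj_le hδ hy hyS)) (mul_star_self_nonneg w)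
    rw [sub_smul, one_smul] at h2
    exact sub_nonneg.1 h2

/-- Riesz decomposition is not available for a general C*-algebra. Instead `z ≤ x + y` is replaced
by `Z* (x + y) Z`, which splits, and the trace property bounds each piece by the positive variation
of `x` or `y`. The same conjugation gives invariance under `z* z ↔ z z*`. -/
theorem isConeTrace_posVar (hd : 0 ≤ d) (hb : ∀ x, |f x| ≤ d * ‖x‖)
    (htr : ∀ x y, f (x * y) = f (y * x)) : IsConeTrace (posVar f) d where
  nonneg x hx := by simpa using le_posVar hd hb le_rfl hx
  add x y hx hy := by
    apply le_antisymm
    · refine posVar_le (add_nonneg hx hy) fun z hz hzS => le_of_forall_pos_le_add fun ε hε => ?_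
      obtain ⟨Z, h1, h2⟩ := exists_le_conj_add hd hb htr hz hzS hε
      have h3 : ∀ u : A, 0 ≤ u → f (star Z * u * Z) ≤ posVar f u := fun u hu => by
        have hs : star (CFC.sqrt u) = CFC.sqrt u := IsSelfAdjoint.of_nonneg (CFC.sqrt_nonneg u)
        have := h2 (CFC.sqrt u)
        rwa [hs, CFC.sqrt_mul_sqrt_self u hu] at this
      have h4 := h3 x hx
      have h5 := h3 y hy
      rw [mul_add, add_mul, map_add] at h1
      linarith
    · have h1 : posVar f x ≤ posVar f (x + y) - posVar f y := by
        refine posVar_le hx fun u hu hux => ?_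
        have h2 : posVar f y ≤ posVar f (x + y) - f u := posVar_le hy fun v hv hvy => by
          have := le_posVar hd hb (add_nonneg hu hv) (add_le_add hux hvy)
          rw [map_add] at this
          linarith
        linarith
      linarith
  le_norm x hx := posVar_le hx fun y hy hyx => ((le_abs_self _).trans (hb y)).trans
    (mul_le_mul_of_nonneg_left (CStarAlgebra.norm_le_norm_of_nonneg_of_le hy hyx) hd)
  trace := by
    have h : ∀ z : A, posVar f (star z * z) ≤ posVar f (z * star z) := fun z => by
      refine posVar_le (star_mul_self_nonneg z) fun y hy hyS =>
        le_of_forall_pos_le_add fun ε hε => ?_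
      obtain ⟨Z, h1, h2⟩ := exists_le_conj_add hd hb htr hy hyS hε
      exact h1.trans (add_le_add_left (h2 z) ε)
    exact fun z => le_antisymm (h z) (by simpa using h (star z))

/-- Jordan decomposition of the difference of two traces. -/
theorem exists_trace_add_eq_add (σ τ : TraceBall A) :
    ∃ ρ₁ ρ₂ : WeakDual ℂ A, IsTrace ρ₁ ∧ IsTrace ρ₂ ∧ σ.1 + ρ₂ = τ.1 + ρ₁ ∧
      ‖WeakDual.toStrongDual ρ₁‖ ≤ 3 * ‖WeakDual.toStrongDual (σ.1 - τ.1)‖ ∧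
      ‖WeakDual.toStrongDual ρ₂‖ ≤ 3 * ‖WeakDual.toStrongDual (σ.1 - τ.1)‖ := by
  set d := ‖WeakDual.toStrongDual (σ.1 - τ.1)‖ with hd
  have hd0 : 0 ≤ d := norm_nonneg _
  let f : A →ₗ[ℝ] ℝ := reTrace σ - reTrace τ
  have hf : ∀ x, f x = ((σ.1 - τ.1) x).re := fun x => by
    change (σ.1 x).re - (τ.1 x).re = (σ.1 x - τ.1 x).re
    rw [Complex.sub_re]
  have hb : ∀ x, |f x| ≤ d * ‖x‖ := fun x => by
    rw [hf]
    exact (Complex.abs_re_le_norm _).trans ((WeakDual.toStrongDual (σ.1 - τ.1)).le_opNorm x)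
  have htr : ∀ x y, f (x * y) = f (y * x) := fun x y => by
    change reTrace σ _ - reTrace τ _ = reTrace σ _ - reTrace τ _
    rw [reTrace_mul_comm, reTrace_mul_comm τ]
  obtain ⟨ρ, hρ, hρp, hρn⟩ := (isConeTrace_posVar hd0 hb htr).exists_trace hd0
  -- The positive variation has norm at most `2d`, and the negative one is its difference with `σ -
  -- τ`, so `3d` bounds both.
  refine ⟨ρ, ρ - (σ.1 - τ.1), hρ, ⟨fun a => ?_, fun a b => ?_⟩, by abel, ?_, ?_⟩
  · change 0 ≤ (ρ (star a * a) - (σ.1 - τ.1) (star a * a)).re ∧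
      (ρ (star a * a) - (σ.1 (star a * a) - τ.1 (star a * a))).im = 0
    constructor
    · rw [Complex.sub_re, ← hf, hρp _ (star_mul_self_nonneg a), sub_nonneg]
      exact le_posVar hd0 hb (star_mul_self_nonneg a) le_rfl
    · rw [Complex.sub_im, Complex.sub_im, (hρ.1 a).2, (σ.2.1.1 a).2, (τ.2.1.1 a).2, sub_zero,
        sub_zero]
  · change ρ (a * b) - (σ.1 (a * b) - τ.1 (a * b)) = ρ (b * a) - (σ.1 (b * a) - τ.1 (b * a))
    rw [hρ.2, σ.2.1.2, τ.2.1.2]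
  · linarith
  · rw [map_sub]
    refine (norm_sub_le _ _).trans ?_
    linarith

end Jordan

end CuntzSemigroup
end


noncomputable section

/-! ### Minimax, and representation of affine functions by self-adjoint elements. -/

namespace CuntzSemigroup

/-- A form of Sion's minimax theorem. -/
theorem exists_forall_lt_of_convexOn_of_concaveOn {E F : Type*} [TopologicalSpace E]
    [AddCommGroup E] [Module ℝ E] [IsTopologicalAddGroup E] (hE : ContinuousSMul ℝ E)
    [TopologicalSpace F] [AddCommGroup F] [Module ℝ F] [IsTopologicalAddGroup F]
    [ContinuousSMul ℝ F] {X : Set E} {Y : Set F} {f : E → F → ℝ} {t : ℝ} (hne : X.Nonempty)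
    (hk : IsCompact X) (hX : Convex ℝ X) (hY : Convex ℝ Y)
    (h1 : ∀ y ∈ Y, ContinuousOn (fun x => f x y) X) (h2 : ∀ y ∈ Y, ConvexOn ℝ X fun x => f x y)
    (h3 : ∀ x ∈ X, ContinuousOn (f x) Y) (h4 : ∀ x ∈ X, ConcaveOn ℝ Y (f x))
    (h : ∀ x ∈ X, ∃ y ∈ Y, t < f x y) : ∃ y ∈ Y, ∀ x ∈ X, t < f x y := by
  choose! Φ hΦY hΦ using h
  -- The witness at `p` still works near `p`, so by compactness finitely many witnesses suffice;
  -- convexity then merges them into one.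
  obtain ⟨s, hsX, hcover⟩ := hk.elim_nhdsWithin_subcover (fun p => {q | t < f q (Φ p)})
    fun p hp => (h1 _ (hΦY p hp) p hp).eventually_const_lt (hΦ p hp)
  refine Sion.exists_lt_iInf_of_lt_iInf_of_finite hne hk
    (fun y hy => (h1 y hy).lowerSemicontinuousOn) (fun y hy r => (h2 y hy).convex_le r) hY
    (fun x hx => (h3 x hx).upperSemicontinuousOn) (fun x hx r => (h4 x hx).convex_ge r) hX
    (s.finite_toSet.image Φ) ?_ fun p hp => ?_
  · rintro _ ⟨p, hp, rfl⟩
    exact hΦY p (hsX p hp)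
  · obtain ⟨q, hq, hpq⟩ := Set.mem_iUnion₂.1 (hcover hp)
    exact ⟨Φ q, ⟨q, hq, rfl⟩, hpq⟩

section Representation

variable {A : Type*} [NonUnitalCStarAlgebra A] [PartialOrder A] [StarOrderedRing A]

theorem isTrace_zero : IsTrace (0 : WeakDual ℂ A) := ⟨fun a => ⟨le_rfl, rfl⟩, fun a b => rfl⟩

theorem IsTrace.add {σ τ : WeakDual ℂ A} (hσ : IsTrace σ) (hτ : IsTrace τ) : IsTrace (σ + τ) := by
  refine ⟨fun a => ?_, fun a b => ?_⟩
  · change 0 ≤ (σ (star a * a) + τ (star a * a)).re ∧ (σ (star a * a) + τ (star a * a)).im = 0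
    rw [Complex.add_re, Complex.add_im, (hσ.1 a).2, (hτ.1 a).2, add_zero]
    exact ⟨add_nonneg (hσ.1 a).1 (hτ.1 a).1, rfl⟩
  · change σ (a * b) + τ (a * b) = σ (b * a) + τ (b * a)
    rw [hσ.2, hτ.2]

theorem IsTrace.smul {σ : WeakDual ℂ A} (hσ : IsTrace σ) {c : ℝ} (hc : 0 ≤ c) :
    IsTrace (c • σ) := by
  refine ⟨fun a => ?_, fun a b => ?_⟩
  · change 0 ≤ (c • σ (star a * a)).re ∧ (c • σ (star a * a)).im = 0
    rw [Complex.smul_re, Complex.smul_im, (hσ.1 a).2, smul_zero]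
    exact ⟨smul_nonneg hc (hσ.1 a).1, rfl⟩
  · change c • σ (a * b) = c • σ (b * a)
    rw [hσ.2]

theorem zero_mem_traceBall : (0 : WeakDual ℂ A) ∈ TraceBall A :=
  ⟨isTrace_zero, by rw [map_zero, norm_zero]; exact zero_le_one⟩

theorem norm_toStrongDual_smul (c : ℝ) (σ : WeakDual ℂ A) :
    ‖WeakDual.toStrongDual (c • σ)‖ = |c| * ‖WeakDual.toStrongDual σ‖ :=
  norm_smul c (WeakDual.toStrongDual σ)

theorem convex_traceBall : Convex ℝ (TraceBall A) := by
  intro σ hσ τ hτ a b ha hb hab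
  refine ⟨(hσ.1.smul ha).add (hτ.1.smul hb), ?_⟩
  rw [map_add]
  refine (norm_add_le _ _).trans ?_
  rw [norm_toStrongDual_smul, norm_toStrongDual_smul, abs_of_nonneg ha, abs_of_nonneg hb, ← hab]
  exact add_le_add (mul_le_of_le_one_right ha hσ.2) (mul_le_of_le_one_right hb hτ.2)

theorem IsTrace.inv_smul_mem {ρ : WeakDual ℂ A} (hρ : IsTrace ρ) {c : ℝ} (hc : 0 < c)
    (h : ‖WeakDual.toStrongDual ρ‖ ≤ c) : c⁻¹ • ρ ∈ TraceBall A := by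
  refine ⟨hρ.smul (inv_nonneg.2 hc.le), ?_⟩
  rw [norm_toStrongDual_smul, abs_of_pos (inv_pos.2 hc), inv_mul_le_iff₀ hc, mul_one]
  exact h

/-- Banach–Alaoglu: positivity and the trace identity are weak-* closed conditions. -/
theorem isCompact_traceBall : IsCompact (TraceBall A) := by
  have h1 : IsClosed {τ : WeakDual ℂ A | IsTrace τ} := by
    have e : {τ : WeakDual ℂ A | IsTrace τ} =
        (⋂ a : A, {τ | 0 ≤ (τ (star a * a)).re} ∩ {τ | (τ (star a * a)).im = 0}) ∩
          ⋂ (a : A) (b : A), {τ | τ (a * b) = τ (b * a)} := by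
      ext τ
      simp only [Set.mem_inter_iff, Set.mem_iInter, Set.mem_ofPred_eq]
      exact Iff.rfl
    rw [e]
    have hc := fun a : A => WeakDual.eval_continuous (𝕜 := ℂ) a
    refine (isClosed_iInter fun a => (isClosed_le continuous_const
      (Complex.continuous_re.comp (hc _))).inter (isClosed_eq
        (Complex.continuous_im.comp (hc _)) continuous_const)).inter
      (isClosed_iInter fun a => isClosed_iInter fun b => isClosed_eq (hc _) (hc _))
  have h2 := (WeakDual.isCompact_closedBall (𝕜 := ℂ) (E := A) 0 1).inter_left h1
  convert h2 using 1
  ext τ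
  simp only [Set.mem_inter_iff, Set.mem_preimage, mem_closedBall_zero_iff]
  exact Iff.rfl

namespace AffT₁

variable (F : AffT₁ A)

theorem map_combination {σ τ ρ : TraceBall A} {a b : ℝ} (ha : 0 ≤ a) (hb : 0 ≤ b) (hab : a + b = 1)
    (h : ρ.1 = a • σ.1 + b • τ.1) : F.toFun ρ = a * F.toFun σ + b * F.toFun τ := by
  obtain rfl : b = 1 - a := by linarith
  exact F.affine σ τ ρ a ha (by linarith) h

/-- An affine function on the trace ball is norm Lipschitz: by the Jordan decomposition `σ + ρ₂ = τ
+ ρ₁` with traces of norm at most `c = 3 ‖σ - τ‖`, and affinity turns this into `F σ - F τ = c (F μ₁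
- F μ₂)` with `μᵢ = ρᵢ / c`. -/
theorem abs_sub_le {M : ℝ} (hM : ∀ σ, |F.toFun σ| ≤ M) (σ τ : TraceBall A) :
    |F.toFun σ - F.toFun τ| ≤ 6 * M * ‖WeakDual.toStrongDual (σ.1 - τ.1)‖ := by
  obtain ⟨ρ₁, ρ₂, h1, h2, he, hn1, hn2⟩ := exists_trace_add_eq_add σ τ
  set d := ‖WeakDual.toStrongDual (σ.1 - τ.1)‖ with hd
  rcases (norm_nonneg (WeakDual.toStrongDual (σ.1 - τ.1))).eq_or_lt with h0 | h0
  · have : σ = τ := Subtype.ext (sub_eq_zero.1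
      ((map_eq_zero_iff _ WeakDual.toStrongDual.injective).1 (norm_eq_zero.1 h0.symm)))
    rw [this, sub_self, abs_zero, hd, ← h0, mul_zero]
  · have hc : 0 < 3 * d := by positivity
    set c := 3 * d with hcd
    let μ₁ : TraceBall A := ⟨c⁻¹ • ρ₁, h1.inv_smul_mem hc hn1⟩
    let μ₂ : TraceBall A := ⟨c⁻¹ • ρ₂, h2.inv_smul_mem hc hn2⟩
    have ha : (0 : ℝ) ≤ (1 + c)⁻¹ := by positivity
    have hb : (0 : ℝ) ≤ (1 + c)⁻¹ * c := by positivity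
    have hab : (1 + c)⁻¹ + (1 + c)⁻¹ * c = 1 := by field_simp
    have hs : ∀ ρ : WeakDual ℂ A, ((1 + c)⁻¹ * c) • c⁻¹ • ρ = (1 + c)⁻¹ • ρ := fun ρ => by
      refine DFunLike.ext _ _ fun x => ?_
      change ((1 + c)⁻¹ * c) • c⁻¹ • ρ x = (1 + c)⁻¹ • ρ x
      rw [smul_smul, mul_assoc, mul_inv_cancel₀ hc.ne', mul_one]
    -- The common value `(σ + ρ₂)/(1 + c) = (τ + ρ₁)/(1 + c)`, a convex combination in two ways.
    let ω : TraceBall A := ⟨(1 + c)⁻¹ • σ.1 + ((1 + c)⁻¹ * c) • μ₂.1,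
      convex_traceBall σ.2 μ₂.2 ha hb hab⟩
    have e1 := F.map_combination (σ := σ) (τ := μ₂) (ρ := ω) ha hb hab rfl
    have e2 := F.map_combination (σ := τ) (τ := μ₁) (ρ := ω) ha hb hab (by
      change (1 + c)⁻¹ • σ.1 + ((1 + c)⁻¹ * c) • c⁻¹ • ρ₂ =
        (1 + c)⁻¹ • τ.1 + ((1 + c)⁻¹ * c) • c⁻¹ • ρ₁
      rw [hs, hs, ← smul_add, ← smul_add, he])
    have e3 : F.toFun σ - F.toFun τ = c * (F.toFun μ₁ - F.toFun μ₂) := by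
      have h4 : (1 + c)⁻¹ * (F.toFun σ - F.toFun τ - c * (F.toFun μ₁ - F.toFun μ₂)) = 0 := by
        linarith
      rcases mul_eq_zero.1 h4 with h5 | h5
      · have : (0 : ℝ) < (1 + c)⁻¹ := by positivity
        linarith
      · linarith
    rw [e3, abs_mul, abs_of_pos hc, hcd]
    have h6 := (abs_sub (F.toFun μ₁) (F.toFun μ₂)).trans (add_le_add (hM μ₁) (hM μ₂))
    have h7 := mul_le_mul_of_nonneg_left h6 hc.le
    linarith

open Classical in
/-- The extension of `F` by zero. -/
def extend (σ : WeakDual ℂ A) : ℝ := if h : σ ∈ TraceBall A then F.toFun ⟨σ, h⟩ else 0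

theorem extend_of_mem {σ : WeakDual ℂ A} (h : σ ∈ TraceBall A) : F.extend σ = F.toFun ⟨σ, h⟩ :=
  dif_pos h

theorem continuousOn_extend : ContinuousOn F.extend (TraceBall A) := by
  rw [continuousOn_iff_continuous_domRestrict]
  convert F.continuous_toFun using 1
  funext σ
  exact F.extend_of_mem σ.2

theorem extend_combination {σ τ : WeakDual ℂ A} (hσ : σ ∈ TraceBall A) (hτ : τ ∈ TraceBall A)
    {a b : ℝ} (ha : 0 ≤ a) (hb : 0 ≤ b) (hab : a + b = 1) :
    F.extend (a • σ + b • τ) = a * F.extend σ + b * F.extend τ := by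
  rw [F.extend_of_mem hσ, F.extend_of_mem hτ, F.extend_of_mem (convex_traceBall hσ hτ ha hb hab)]
  exact F.map_combination ha hb hab rfl

theorem exists_mem_ball {R η : ℝ} (hR : 0 ≤ R) (hη : 0 < η) (ρ : WeakDual ℂ A) :
    ∃ y ∈ Metric.closedBall (0 : A) R, R * ‖WeakDual.toStrongDual ρ‖ - η < (ρ y).re := by
  set T := WeakDual.toStrongDual ρ with hT
  obtain ⟨z, hz, hlt⟩ := T.exists_lt_apply_of_lt_opNorm
    (r := ‖T‖ - η / (R + 1)) (sub_lt_self _ (by positivity))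
  obtain ⟨u, hu, huz⟩ := RCLike.exists_norm_eq_mul_self (T z)
  refine ⟨((R : ℂ) * u) • z, ?_, ?_⟩
  · rw [mem_closedBall_zero_iff, norm_smul, norm_mul, hu, mul_one, Complex.norm_real,
      Real.norm_eq_abs, abs_of_nonneg hR]
    exact mul_le_of_le_one_right hR hz.le
  · have e : ρ (((R : ℂ) * u) • z) = ((R * ‖T z‖ : ℝ) : ℂ) := by
      rw [map_smul, smul_eq_mul, mul_assoc]
      change (R : ℂ) * (u * T z) = _
      rw [← huz]
      push_cast
      rfl
    rw [e, Complex.ofReal_re]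
    have h1 := mul_le_mul_of_nonneg_left hlt.le hR
    have h2 : R * (η / (R + 1)) < η := by
      rw [← mul_div_assoc, div_lt_iff₀ (by positivity)]
      linarith
    linarith

/-- The pairing to which the minimax theorem is applied. -/
def gap (p : WeakDual ℂ A × WeakDual ℂ A) (y : A) : ℝ :=
  (p.1 y).re - (p.2 y).re - (F.extend p.1 - F.extend p.2)

theorem continuousOn_gap_left (y : A) :
    ContinuousOn (fun p => F.gap p y) (TraceBall A ×ˢ TraceBall A) := by
  have hc := Complex.continuous_re.comp (WeakDual.eval_continuous (𝕜 := ℂ) y)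
  exact ((hc.comp continuous_fst).sub (hc.comp continuous_snd)).continuousOn.sub
    ((F.continuousOn_extend.comp continuousOn_fst fun p hp => hp.1).sub
      (F.continuousOn_extend.comp continuousOn_snd fun p hp => hp.2))

theorem convexOn_gap (y : A) :
    ConvexOn ℝ (TraceBall A ×ˢ TraceBall A) fun p => F.gap p y := by
  refine ⟨convex_traceBall.prod convex_traceBall, fun p hp q hq a b ha hb hab => le_of_eq ?_⟩
  change ((a • p.1 y + b • q.1 y).re - (a • p.2 y + b • q.2 y).re -
    (F.extend (a • p.1 + b • q.1) - F.extend (a • p.2 + b • q.2))) =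
    a * ((p.1 y).re - (p.2 y).re - (F.extend p.1 - F.extend p.2)) +
    b * ((q.1 y).re - (q.2 y).re - (F.extend q.1 - F.extend q.2))
  rw [F.extend_combination hp.1 hq.1 ha hb hab, F.extend_combination hp.2 hq.2 ha hb hab]
  simp only [Complex.add_re, Complex.smul_re, smul_eq_mul]
  ring

theorem continuous_gap_right (p : WeakDual ℂ A × WeakDual ℂ A) : Continuous (F.gap p) := by
  have h := fun σ : WeakDual ℂ A => Complex.continuous_re.comp (WeakDual.toStrongDual σ).continuous
  exact ((h p.1).sub (h p.2)).sub continuous_const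

theorem concaveOn_gap (p : WeakDual ℂ A × WeakDual ℂ A) (R : ℝ) :
    ConcaveOn ℝ (Metric.closedBall (0 : A) R) (F.gap p) := by
  refine ⟨convex_closedBall _ _, fun x _ y _ a b ha hb hab => le_of_eq ?_⟩
  have h : ∀ σ : WeakDual ℂ A, (σ (a • x + b • y)).re = a * (σ x).re + b * (σ y).re := fun σ => by
    rw [← Complex.coe_smul a, ← Complex.coe_smul b, map_add, map_smul, map_smul, smul_eq_mul,
      smul_eq_mul, Complex.add_re, Complex.re_ofReal_mul, Complex.re_ofReal_mul]
  simp only [gap, h, smul_eq_mul]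
  linear_combination (-(F.extend p.1 - F.extend p.2)) * hab

/-- The pointwise hypothesis of the minimax theorem: in the ball of radius `6M`, `Re (σ - τ)(y)`
comes arbitrarily close to `6M ‖σ - τ‖`, which dominates `F σ - F τ`. -/
theorem exists_lt_gap {M : ℝ} (hM : ∀ σ, |F.toFun σ| ≤ M) {η : ℝ} (hη : 0 < η)
    (p : WeakDual ℂ A × WeakDual ℂ A) (hp : p ∈ TraceBall A ×ˢ TraceBall A) :
    ∃ y ∈ Metric.closedBall (0 : A) (6 * M), -η < F.gap p y := by
  have hM0 : 0 ≤ M := (abs_nonneg _).trans (hM ⟨0, zero_mem_traceBall⟩)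
  obtain ⟨y, hy, hlt⟩ := exists_mem_ball (by positivity : 0 ≤ 6 * M) hη (p.1 - p.2)
  refine ⟨y, hy, ?_⟩
  have h1 := F.abs_sub_le hM ⟨p.1, hp.1⟩ ⟨p.2, hp.2⟩
  have h2 := le_abs_self (F.toFun ⟨p.1, hp.1⟩ - F.toFun ⟨p.2, hp.2⟩)
  have h3 : ((p.1 - p.2) y).re = (p.1 y).re - (p.2 y).re := Complex.sub_re _ _
  rw [gap, F.extend_of_mem hp.1, F.extend_of_mem hp.2]
  rw [h3] at hlt
  linarith

theorem exists_forall_lt_gap {M : ℝ} (hM : ∀ σ, |F.toFun σ| ≤ M) {η : ℝ} (hη : 0 < η) :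
    ∃ a ∈ Metric.closedBall (0 : A) (6 * M), ∀ p ∈ TraceBall A ×ˢ TraceBall A, -η < F.gap p a := by
  have hs : ContinuousSMul ℝ (WeakDual ℂ A × WeakDual ℂ A) := inferInstance
  exact exists_forall_lt_of_convexOn_of_concaveOn hs
    ⟨(0, 0), zero_mem_traceBall, zero_mem_traceBall⟩ (isCompact_traceBall.prod isCompact_traceBall)
    (convex_traceBall.prod convex_traceBall) (convex_closedBall _ _)
    (fun y _ => F.continuousOn_gap_left y) (fun y _ => F.convexOn_gap y)
    (fun p _ => (F.continuous_gap_right p).continuousOn) (fun p _ => F.concaveOn_gap p _)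
    (F.exists_lt_gap hM hη)

/-- The pairs `(σ, 0)` and `(0, σ)` turn the one-sided minimax inequality into a two-sided estimate.
-/
theorem exists_approx {M : ℝ} (hM : ∀ σ, |F.toFun σ| ≤ M) {η : ℝ} (hη : 0 < η) :
    ∃ a : A, ‖a‖ ≤ 6 * M ∧ ∀ σ : TraceBall A, |F.toFun σ - reTrace σ a| ≤ η := by
  obtain ⟨a, haY, ha⟩ := F.exists_forall_lt_gap hM hη
  refine ⟨a, mem_closedBall_zero_iff.1 haY, fun σ => ?_⟩
  have h0 : F.extend 0 = 0 := by
    rw [F.extend_of_mem zero_mem_traceBall]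
    exact F.map_zero _ rfl
  have hz : ((0 : WeakDual ℂ A) a).re = 0 := rfl
  have h1 := ha (σ.1, 0) ⟨σ.2, zero_mem_traceBall⟩
  have h2 := ha (0, σ.1) ⟨zero_mem_traceBall, σ.2⟩
  rw [gap, hz, h0, F.extend_of_mem σ.2] at h1 h2
  rw [reTrace_apply, _root_.abs_le]
  constructor <;> linarith

/-- The difference of `F` and the function of `b`. -/
def subEv (b : A) : AffT₁ A where
  toFun σ := F.toFun σ - reTrace σ b
  continuous_toFun := F.continuous_toFun.sub (Complex.continuous_re.comp
    ((WeakDual.eval_continuous b).comp continuous_subtype_val))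
  map_zero σ h := by
    rw [F.map_zero σ h, reTrace_apply, h]
    exact sub_self _
  affine σ τ ρ s h0 h1 h := by
    have h2 : ρ.1 b = (s : ℂ) * σ.1 b + ((1 - s : ℝ) : ℂ) * τ.1 b := by
      rw [h]
      rfl
    rw [F.affine σ τ ρ s h0 h1 h, reTrace_apply, reTrace_apply, reTrace_apply, h2, Complex.add_re,
      Complex.re_ofReal_mul, Complex.re_ofReal_mul]
    ring

theorem exists_bound : ∃ M : ℝ, 0 < M ∧ ∀ σ, |F.toFun σ| ≤ M := by
  have : CompactSpace (TraceBall A) := isCompact_iff_compactSpace.1 isCompact_traceBall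
  obtain ⟨M, hM⟩ := (isCompact_range F.continuous_toFun).isBounded.exists_norm_le
  exact ⟨max M 1, by positivity, fun σ => (hM _ ⟨σ, rfl⟩).trans (le_max_left _ _)⟩

/-- Apply the approximation to the remainder again and again. The error halves each time, and the
correction has norm at most six times the bound on the current remainder, so the corrections sum to
an exact representative. -/
theorem exists_eq_reTrace : ∃ b : A, ∀ σ, F.toFun σ = reTrace σ b := by
  obtain ⟨M, hM0, hM⟩ := F.exists_bound
  let P : ℕ → A → Prop := fun n b => ∀ σ, |F.toFun σ - reTrace σ b| ≤ M * (1 / 2) ^ n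
  have step : ∀ n b, P n b → ∃ c, P (n + 1) c ∧ ‖c - b‖ ≤ 6 * M * (1 / 2) ^ n := fun n b hb => by
    obtain ⟨a, ha, h⟩ := (F.subEv b).exists_approx hb (by positivity : 0 < M * (1 / 2) ^ (n + 1))
    refine ⟨b + a, fun σ => ?_, by rw [add_sub_cancel_left]; linarith⟩
    rw [_root_.map_add, ← sub_sub]
    exact h σ
  choose! g hg hgn using step
  let b : ℕ → A := fun n => Nat.rec 0 g n
  have hb : ∀ n, P n (b n) := fun n => by
    induction n with
    | zero =>
      intro σ
      change |F.toFun σ - reTrace σ 0| ≤ _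
      rw [_root_.map_zero, sub_zero, pow_zero, mul_one]
      exact hM σ
    | succ n ih => exact hg n _ ih
  have hcauchy : CauchySeq b := cauchySeq_of_le_geometric (1 / 2) (6 * M) (by norm_num) fun n => by
    rw [dist_comm, dist_eq_norm]
    exact hgn n _ (hb n)
  obtain ⟨c, hc⟩ := cauchySeq_tendsto_of_complete hcauchy
  refine ⟨c, fun σ => ?_⟩
  have h1 : Filter.Tendsto (fun n => |F.toFun σ - reTrace σ (b n)|) Filter.atTop
      (nhds |F.toFun σ - reTrace σ c|) := by
    have : Continuous fun x : A => |F.toFun σ - reTrace σ x| :=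
      (continuous_const.sub (Complex.continuous_re.comp
        (WeakDual.toStrongDual σ.1).continuous)).abs
    exact (this.tendsto c).comp hc
  have h2 : Filter.Tendsto (fun n : ℕ => M * (1 / 2 : ℝ) ^ n) Filter.atTop (nhds 0) := by
    simpa using (tendsto_pow_atTop_nhds_zero_of_lt_one (by norm_num : (0 : ℝ) ≤ 1 / 2)
      (by norm_num)).const_mul M
  have h3 := le_of_tendsto_of_tendsto' h1 h2 fun n => hb n σ
  exact sub_eq_zero.1 (abs_eq_zero.1 (le_antisymm h3 (abs_nonneg _)))

end AffT₁

open scoped ComplexStarModule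

theorem im_trace_eq_zero (σ : TraceBall A) {x : A} (hx : IsSelfAdjoint x) : (σ.1 x).im = 0 := by
  have h : ∀ y : A, 0 ≤ y → (σ.1 y).im = 0 := fun y hy => by
    obtain ⟨z, rfl⟩ := isPos_iff_nonneg.2 hy
    exact (σ.2.1.1 z).2
  rw [← CFC.posPart_sub_negPart x hx, map_sub, Complex.sub_im, h _ (CFC.posPart_nonneg x),
    h _ (CFC.negPart_nonneg x), sub_zero]

theorem reTrace_realPart (σ : TraceBall A) (b : A) : reTrace σ (ℜ b : A) = reTrace σ b := by
  conv_rhs => rw [← realPart_add_I_smul_imaginaryPart b]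
  have : reTrace σ (Complex.I • (ℑ b : A)) = 0 := by
    rw [reTrace_apply, map_smul, smul_eq_mul, Complex.I_mul_re,
      im_trace_eq_zero σ (ℑ b).2, neg_zero]
  rw [map_add, this, add_zero]

/-- Every element of `Aff T₁(A)` is the function of a self-adjoint element. -/
theorem AffT₁.exists_eq_selfAdjoint (F : AffT₁ A) :
    ∃ h : selfAdjoint A, ∀ σ, F.toFun σ = reTrace σ (h : A) := by
  obtain ⟨b, hb⟩ := F.exists_eq_reTrace
  exact ⟨ℜ b, fun σ => by rw [hb, reTrace_realPart]⟩

end Representation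

/-! ### From the Cuntz distance to traces. -/

section Main

variable {A B : Type*} [NonUnitalCStarAlgebra A] [PartialOrder A] [StarOrderedRing A]
  [NonUnitalCStarAlgebra B] [PartialOrder B] [StarOrderedRing B]

open unitInterval

theorem Cu.map_corner (φ : A →⋆ₙₐ[ℂ] B) {a : A} (ha : 0 ≤ a) {b : B} (hb : 0 ≤ b) (h : φ a = b) :
    Cu.map φ (Cu.corner a ha) = Cu.corner b hb := by
  have key : ∀ {x y : PosStab B}, x.val = y.val → Cu.mk x = Cu.mk y := by
    rintro ⟨x, _⟩ ⟨y, _⟩ rfl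
    rfl
  subst h
  exact key (Stab.map_corner φ a)

/-- The Thomsen morphism of a positive contraction. -/
def thomsen {a : A} (ha : 0 ≤ a) (h1 : ‖a‖ ≤ 1) : Th (Cu A) := (isScale_cut ha h1).toTh

theorem map_thomsen_ind (φ : A →⋆ₙₐ[ℂ] B) {a : A} (ha : 0 ≤ a) (h1 : ‖a‖ ≤ 1) (t : I) :
    (Cu.map φ ∘ (thomsen ha h1).toFun) (GenG.ind t) = Cu.corner (cut t (φ a)) (cut_nonneg _ _) := by
  change Cu.map φ ((isScale_cut ha h1).ext (GenG.ind t)) = _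
  rw [IsScale.ext_ind]
  exact Cu.map_corner φ _ _ (map_cut φ t.2.1 ha)

theorem map_nonneg_of_nonneg (φ : A →⋆ₙₐ[ℂ] B) {a : A} (ha : 0 ≤ a) : 0 ≤ φ a :=
  isPos_iff_nonneg.1 ((isPos_iff_nonneg.2 ha).map φ)

/-- Some admissible `s` is smaller than `r`, and cut-downs decrease in the height. Comparison of
corner classes in `Cu(B)` descends to `B`. -/
theorem cuntzLE_of_dCu_lt (φ ψ : A →⋆ₙₐ[ℂ] B) {a : A} (ha : 0 ≤ a) (h1 : ‖a‖ ≤ 1) {r : ℝ}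
    (h : dCu (Cu.map φ ∘ (thomsen ha h1).toFun) (Cu.map ψ ∘ (thomsen ha h1).toFun) <
      ENNReal.ofReal r) {t : ℝ} (ht0 : 0 ≤ t) (ht1 : t < 1) :
    CuntzLE (cut t (φ a)) (cut (max (t - r) 0) (ψ a)) ∧
      CuntzLE (cut t (ψ a)) (cut (max (t - r) 0) (φ a)) := by
  simp only [dCu, iInf_lt_iff] at h
  obtain ⟨s, hs, hcond, hsr⟩ := h
  have hsr' : s < r := by
    by_contra hcon
    exact absurd hsr (not_lt.2 (ENNReal.ofReal_le_ofReal (not_lt.1 hcon)))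
  have h2 := hcond ⟨t, ht0, ht1.le⟩ ht1
  rw [map_thomsen_ind, map_thomsen_ind, map_thomsen_ind, map_thomsen_ind,
    Cu.corner_le_corner_iff, Cu.corner_le_corner_iff] at h2
  have e : ((lowerBy s ⟨t, ht0, ht1.le⟩ : I) : ℝ) = max (t - s) 0 := by
    rw [lowerBy, Set.coe_projIcc, max_comm, min_eq_right]
    change t - s ≤ 1
    linarith
  rw [e] at h2
  have hle : max (t - r) 0 ≤ max (t - s) 0 := max_le_max (by linarith) le_rfl
  exact ⟨h2.1.trans (CuntzLE.cut_mono (le_max_right _ _) hle (map_nonneg_of_nonneg ψ ha)),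
    h2.2.trans (CuntzLE.cut_mono (le_max_right _ _) hle (map_nonneg_of_nonneg φ ha))⟩

/-- The Thomsen morphism of the layer of `x` between `k` and `k + 1`. -/
def thomsenLayer (x : A) (k : ℕ) : Th (Cu A) :=
  thomsen (layer_nonneg zero_le_one x) (norm_layer_le (s := k) zero_le_one x)

/-- Homomorphisms commute with taking layers, so comparing the images of the layers of `x` is
comparing the layers of its images. -/
theorem abs_reTrace_sub_le (φ ψ : A →⋆ₙₐ[ℂ] B) {x : A} (hx : 0 ≤ x) {L : ℕ} (hL : ‖x‖ ≤ L) {r : ℝ}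
    (hr : 0 ≤ r) (h : ∀ k < L, dCu (Cu.map φ ∘ (thomsenLayer x k).toFun)
      (Cu.map ψ ∘ (thomsenLayer x k).toFun) < ENNReal.ofReal r) (τ : TraceBall B) :
    |reTrace τ (φ x) - reTrace τ (ψ x)| ≤ r := by
  have hφ := map_nonneg_of_nonneg φ hx
  have hψ := map_nonneg_of_nonneg ψ hx
  have hφL : ‖φ x‖ ≤ L := (NonUnitalStarAlgHom.norm_apply_le φ x).trans hL
  have hψL : ‖ψ x‖ ≤ L := (NonUnitalStarAlgHom.norm_apply_le ψ x).trans hL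
  have key : ∀ k < L, ∀ t : ℝ, 0 ≤ t → t < 1 →
      CuntzLE (cut t (layer k 1 (φ x))) (cut (max (t - r) 0) (layer k 1 (ψ x))) ∧
      CuntzLE (cut t (layer k 1 (ψ x))) (cut (max (t - r) 0) (layer k 1 (φ x))) :=
    fun k hk t ht0 ht1 => by
      rw [← map_layer φ k.cast_nonneg zero_le_one hx, ← map_layer ψ k.cast_nonneg zero_le_one hx]
      exact cuntzLE_of_dCu_lt φ ψ _ _ (h k hk) ht0 ht1
  rw [abs_le]
  have h1 := reTrace_sub_le_of_cuntzLE τ hφ hψ hφL hψL hr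
    fun k hk t ht0 ht1 => (key k hk t ht0 ht1).1
  have h2 := reTrace_sub_le_of_cuntzLE τ hψ hφ hψL hφL hr
    fun k hk t ht0 ht1 => (key k hk t ht0 ht1).2
  constructor <;> linarith

end Main

end CuntzSemigroup
end

theorem mainTheorem8 {A : Type u} [NonUnitalCStarAlgebra A] [PartialOrder A]
    [StarOrderedRing A] (hA : StableRankOne A) (H : Set (AffT₁ A)) (hH : H.Finite) :
    ∃ N : Set (Th (Cu A)), N.Finite ∧
      ∀ (B : Type v) [NonUnitalCStarAlgebra B] [PartialOrder B] [StarOrderedRing B],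
        StableRankOne B → ∀ (φ ψ : A →⋆ₙₐ[ℂ] B) (ε : ℝ), 0 < ε →
          dN N (Cu.map φ) (Cu.map ψ) < ENNReal.ofReal (ε / 2) →
            ∀ h ∈ H, AffT₁.dist (AffT₁.map φ h) (AffT₁.map ψ h) < ENNReal.ofReal ε := by
  choose h hh using fun F : AffT₁ A => F.exists_eq_selfAdjoint
  let L : AffT₁ A → ℕ := fun F => ⌈‖(h F : A)‖⌉₊
  -- The unit layers of the positive and negative parts of `h`; their number depends only on `‖h‖`.
  let N : AffT₁ A → Set (Th (Cu A)) := fun F =>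
    (thomsenLayer (h F : A)⁺ '' ↑(Finset.range (L F))) ∪
      (thomsenLayer (h F : A)⁻ '' ↑(Finset.range (L F)))
  have hN : ∀ F, (N F).Finite := fun F =>
    ((Finset.finite_toSet _).image _).union ((Finset.finite_toSet _).image _)
  refine ⟨⋃ F ∈ H, N F, hH.biUnion fun F _ => hN F, ?_⟩
  intro B _ _ _ _ φ ψ ε hε hd F hF
  -- A number strictly between `d_N` and `ε/2`: the uniform bound `2r` then keeps the inequality
  -- strict after the supremum over traces.
  obtain ⟨r, hr0, hdr, hrε⟩ := ENNReal.lt_iff_exists_real_btwn.1 hd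
  have hr : r < ε / 2 := (ENNReal.ofReal_lt_ofReal_iff (half_pos hε)).1 hrε
  have hν : ∀ ν ∈ N F, dCu (Cu.map φ ∘ ν.toFun) (Cu.map ψ ∘ ν.toFun) < ENNReal.ofReal r :=
    fun ν hν => lt_of_le_of_lt (le_iSup₂ (f := fun (ν : Th (Cu A))
      (_ : ν ∈ ⋃ F ∈ H, N F) => dCu (Cu.map φ ∘ ν.toFun) (Cu.map ψ ∘ ν.toFun)) ν
      (Set.mem_biUnion hF hν)) hdr
  have hL : ‖(h F : A)‖ ≤ L F := Nat.le_ceil _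
  have hdec : (h F : A)⁺ - (h F : A)⁻ = h F := CFC.posPart_sub_negPart _ (h F).2
  have key : ∀ τ : TraceBall B, |(AffT₁.map φ F).toFun τ - (AffT₁.map ψ F).toFun τ| ≤ 2 * r := by
    intro τ
    have h1 := abs_reTrace_sub_le φ ψ (CFC.posPart_nonneg (h F : A))
      ((CStarAlgebra.norm_posPart_le _).trans hL) hr0
      (fun k hk => hν _ (Or.inl ⟨k, Finset.mem_coe.2 (Finset.mem_range.2 hk), rfl⟩)) τ
    have h2 := abs_reTrace_sub_le φ ψ (CFC.negPart_nonneg (h F : A))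
      ((CStarAlgebra.norm_negPart_le _).trans hL) hr0
      (fun k hk => hν _ (Or.inr ⟨k, Finset.mem_coe.2 (Finset.mem_range.2 hk), rfl⟩)) τ
    have e : ∀ χ : A →⋆ₙₐ[ℂ] B, (AffT₁.map χ F).toFun τ =
        reTrace τ (χ (h F : A)⁺) - reTrace τ (χ (h F : A)⁻) := fun χ => by
      change F.toFun (tracePullback χ τ) = _
      rw [hh F, ← map_sub, ← map_sub, hdec]
      rfl
    rw [e φ, e ψ]
    rw [abs_le] at h1 h2 ⊢
    constructor <;> linarith
  refine lt_of_le_of_lt (iSup₂_le fun τ _ => ENNReal.ofReal_le_ofReal (key τ)) ?_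
  rw [ENNReal.ofReal_lt_ofReal_iff hε]
  linarith
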